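/- A permutation $\pi\in S_n$ contains an occurrence of $\sigma\in S_m$ (as a consecutive pattern) at position $i$ if $\pi_i\pi_{i+1}\cdots\pi_{i+m-1}$ is in the same relative order as $\sigma$; let $c_\sigma(\pi)$ be the number of occurrences. Let $$P_\sigma(u,z)=\sum_{n\ge 0}\sum_{\pi\in S_n}u^{c_\sigma(\pi)}\frac{z^n}{n!},\qquad \omega_\sigma(u,z)=\frac1{P_\sigma(u,z)},$$ as formal power series in $z$ over $\mathbb{Q}[u]$; derivatives and initial values below are with respect to $z$. Patterns $\sigma,\tau$ are strongly c-Wilf-equivalent, $\sigma\sim\tau$, if $P_\sigma=P_\tau$. Let $O_\sigma$ be the set of $1\le d<m$ such that the last $m-d$ and the first $m-d$ entries of $\sigma$ are in the same relative order. Let $I^\sigma_{n,k}$ ($k\ge1$) be the set of tuples $(i_1,\dots,i_k)$ with $i_1=1$, $i_k=n-m+1$ and $i_{j+1}-i_j\in O_\sigma$ for $1\le j<k$. For such a tuple the cluster poset $P^\sigma_{n,i_1,\dots,i_k}$ is the set $\{\pi_1,\dots,\pi_n\}$ with the order generated by the relations $\pi_{i_j+a-1}<\pi_{i_j+b-1}$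 for $1\le j\le k$ and $1\le a,b\le m$ with $\sigma_a<\sigma_b$. Then: 1. $123546\sim124536$, and for both patterns $\omega$ is the unique solution of $\omega^{(5)}+(1-u)(\omega'+\omega)=0$ with $\omega(0)=1$, $\omega'(0)=-1$, $\omega^{(i)}(0)=0$ for $2\le i\le 4$. 2. $123645\sim124635$; these two patterns have the same sets $I_{n,k}$ and, for each tuple in them, isomorphic cluster posets; and for both patterns $\omega$ is the unique solution of $\omega^{(5)}+(1-u)z(\omega''+\omega')=0$ with the same initial conditions. 3. $132465\sim142365$; these two patterns have the same sets $I_{n,k}$ and, for each tuple in them, isomorphic cluster posets; and for both patterns $\omega$ is the unique solution of $\omega^{(5)}+(1-u)(\omega''+z\omega')=0$ with the same initial conditions. 4. $154263\sim165243$, and for all $n,k$ and every tuple in $I^{154263}_{n,k}$ there is exactly one tuple in $I^{165243}_{n,k}$ whose cluster poset is isomorphic to that of the given tuple. 5. The relation $\sim$ partitions the $720$ patterns of length $6$ into exactly $92$ equivalence classes. -/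

import Mathlib

namespace ConsecutivePattern

/-- Permutations of `{1, …, n}` are represented by `Equiv.Perm (Fin n)`: entries, values and
positions are all shifted down by one. `OccursAt σ π i` says that the `m` adjacent entries of `π`
starting at the (zero-based) position `i` are in the same relative order as `σ`. -/
def OccursAt {m n : ℕ} (σ : Equiv.Perm (Fin m)) (π : Equiv.Perm (Fin n)) (i : ℕ) : Prop :=
  ∃ h : i + m ≤ n, ∀ a b : Fin m,
    π ⟨i + a, by omega⟩ < π ⟨i + b, by omega⟩ ↔ σ a < σ b

instance {m n : ℕ} (σ : Equiv.Perm (Fin m)) (π : Equiv.Perm (Fin n)) (i : ℕ) :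
    Decidable (OccursAt σ π i) := by
  unfold OccursAt
  infer_instance

/-- The number `c_σ(π)` of occurrences of `σ` in `π` as a consecutive pattern. -/
def occCount {m n : ℕ} (σ : Equiv.Perm (Fin m)) (π : Equiv.Perm (Fin n)) : ℕ :=
  ((Finset.range (n + 1)).filter (fun i => OccursAt σ π i)).card

/-- The generating function `P_σ(u, z) = ∑ₙ ∑_{π ∈ Sₙ} u ^ c_σ(π) zⁿ / n!`, as a formal power
series in `z` with coefficients in `ℚ[u]`. -/
noncomputable def P {m : ℕ} (σ : Equiv.Perm (Fin m)) : PowerSeries (Polynomial ℚ) :=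
  PowerSeries.mk fun n =>
    Polynomial.C ((n.factorial : ℚ)⁻¹) *
      ∑ π : Equiv.Perm (Fin n), (Polynomial.X : Polynomial ℚ) ^ occCount σ π

/-- The multiplicative inverse `ω_σ(u, z) = 1 / P_σ(u, z)` (see `P_mul_omega`). -/
noncomputable def omega {m : ℕ} (σ : Equiv.Perm (Fin m)) : PowerSeries (Polynomial ℚ) :=
  PowerSeries.invOfUnit (P σ) 1

theorem P_mul_omega {m : ℕ} (hm : 0 < m) (σ : Equiv.Perm (Fin m)) : P σ * omega σ = 1 := by
  refine PowerSeries.mul_invOfUnit _ _ ?_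
  have h : ∀ π : Equiv.Perm (Fin 0), occCount σ π = 0 := by
    intro π
    unfold occCount
    rw [Finset.card_eq_zero, Finset.filter_eq_empty_iff]
    rintro i - ⟨h, -⟩
    omega
  simp [P, ← PowerSeries.coeff_zero_eq_constantCoeff_apply, h]

/-- Strong c-Wilf-equivalence. -/
def StronglyCWilfEquiv {m : ℕ} (σ τ : Equiv.Perm (Fin m)) : Prop :=
  P σ = P τ

/-- Strong c-Wilf-equivalence as an equivalence relation on the patterns of length `m`. -/
def strongSetoid (m : ℕ) : Setoid (Equiv.Perm (Fin m)) where
  r := StronglyCWilfEquiv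
  iseqv := ⟨fun _ => rfl, fun h => Eq.symm h, fun h₁ h₂ => Eq.trans h₁ h₂⟩

/-- The overlap set of `σ`: the `d` with `1 ≤ d < m` such that the last `m - d` entries of `σ`
are in the same relative order as its first `m - d` entries. -/
def overlapSet {m : ℕ} (σ : Equiv.Perm (Fin m)) : Set ℕ :=
  {d | 1 ≤ d ∧ d < m ∧ ∀ (a b : ℕ) (ha : a + d < m) (hb : b + d < m),
    σ ⟨a + d, ha⟩ < σ ⟨b + d, hb⟩ ↔ σ ⟨a, by omega⟩ < σ ⟨b, by omega⟩}

/-- The set `I_{n,k}` of sequences of (zero-based) starting positions of the `k ≥ 1` marked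
occurrences in a cluster of length `n`: the first one is `0`, the last one is `n - m`, and
consecutive ones differ by an element of the overlap set. -/
def indexTuples {m : ℕ} (σ : Equiv.Perm (Fin m)) (n k : ℕ) : Set (Fin k → ℕ) :=
  {i | (∃ hk : 0 < k, i ⟨0, hk⟩ = 0 ∧ i ⟨k - 1, by omega⟩ + m = n) ∧
    ∀ (j : ℕ) (hj : j + 1 < k), ∃ d ∈ overlapSet σ,
      i ⟨j + 1, hj⟩ = i ⟨j, by omega⟩ + d}

/-- The relations `π_x < π_y` between the entries in positions `x` and `y` which are forced by
requiring occurrences of `σ` at the positions `i₁, …, i_k`. -/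
def clusterRel {m : ℕ} (σ : Equiv.Perm (Fin m)) (n : ℕ) {k : ℕ} (i : Fin k → ℕ)
    (x y : Fin n) : Prop :=
  ∃ (j : Fin k) (a b : Fin m), (x : ℕ) = i j + a ∧ (y : ℕ) = i j + b ∧ σ a < σ b

/-- The order of the cluster poset with ground set `Fin n`: the reflexive transitive closure of
the forced relations. -/
def clusterLE {m : ℕ} (σ : Equiv.Perm (Fin m)) (n : ℕ) {k : ℕ} (i : Fin k → ℕ) :
    Fin n → Fin n → Prop :=
  Relation.ReflTransGen (clusterRel σ n i)

/-- The cluster posets of `σ` at `i` and of `τ` at `i'` are isomorphic. -/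
def ClusterPosetsIso {m : ℕ} (σ τ : Equiv.Perm (Fin m)) (n : ℕ) {k : ℕ} (i i' : Fin k → ℕ) :
    Prop :=
  Nonempty (clusterLE σ n i ≃r clusterLE τ n i')

/-- The partial derivative with respect to `z`. -/
noncomputable def D (f : PowerSeries (Polynomial ℚ)) : PowerSeries (Polynomial ℚ) :=
  PowerSeries.derivative (Polynomial ℚ) f

/-- The power series `1 - u`, constant in `z`. -/
noncomputable def oneSubU : PowerSeries (Polynomial ℚ) :=
  PowerSeries.C (1 - (Polynomial.X : Polynomial ℚ))

/-- The initial conditions `f(0) = 1`, `f'(0) = -1` and `f⁽ⁱ⁾(0) = 0` for `2 ≤ i ≤ 4`. -/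
def InitialConditions (f : PowerSeries (Polynomial ℚ)) : Prop :=
  PowerSeries.constantCoeff f = 1 ∧ PowerSeries.constantCoeff (D f) = -1 ∧
    ∀ i : ℕ, 2 ≤ i → i ≤ 4 → PowerSeries.constantCoeff (D^[i] f) = 0

/-! Patterns of length 6. Each is given by its one-line notation, with all entries shifted down by
one, followed by the one-line notation of its inverse. -/

def p123546 : Equiv.Perm (Fin 6) :=
  ⟨![0, 1, 2, 4, 3, 5], ![0, 1, 2, 4, 3, 5], by decide, by decide⟩

def p124536 : Equiv.Perm (Fin 6) :=
  ⟨![0, 1, 3, 4, 2, 5], ![0, 1, 4, 2, 3, 5], by decide, by decide⟩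

def p123645 : Equiv.Perm (Fin 6) :=
  ⟨![0, 1, 2, 5, 3, 4], ![0, 1, 2, 4, 5, 3], by decide, by decide⟩

def p124635 : Equiv.Perm (Fin 6) :=
  ⟨![0, 1, 3, 5, 2, 4], ![0, 1, 4, 2, 5, 3], by decide, by decide⟩

def p132465 : Equiv.Perm (Fin 6) :=
  ⟨![0, 2, 1, 3, 5, 4], ![0, 2, 1, 3, 5, 4], by decide, by decide⟩

def p142365 : Equiv.Perm (Fin 6) :=
  ⟨![0, 3, 1, 2, 5, 4], ![0, 2, 3, 1, 5, 4], by decide, by decide⟩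

def p154263 : Equiv.Perm (Fin 6) :=
  ⟨![0, 4, 3, 1, 5, 2], ![0, 3, 5, 2, 1, 4], by decide, by decide⟩

def p165243 : Equiv.Perm (Fin 6) :=
  ⟨![0, 5, 4, 1, 3, 2], ![0, 3, 5, 4, 2, 1], by decide, by decide⟩

end ConsecutivePattern

/-! Everything rests on the cluster method of Goulden and Jackson. Expanding u^c as ((u - 1) + 1)^c
marks a set of occurrences, and splitting the marked windows at the first gap between positions that
no window covers gives ω = 1 - ∑_{n ≥ 1} C_n(u) zⁿ/n!. Here C_n sums, over the clusters of length n,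
(u - 1) to the number of marks times the number of linear extensions of the cluster poset
(`coeff_omega`); the single letter without marks contributes the term -z. So two patterns are
equivalent as soon as each cluster has equally many linear extensions for both
(`P_eq_of_markCount_eq`), and conversely equivalent patterns have equal cluster numbers
(`clusterNumber_eq_of_P_eq`).

Differential equations. When the first entry of a pattern is its smallest, the small entries of the
first window of a cluster can be removed one at a time, each being the unique minimum of what is
left. What remains is a shorter cluster with some initial entries missing, possibly together with
one isolated element, which may be inserted anywhere. This gives a linear recurrence for C_n, which
is the differential equation read off coefficientwise (`clusterRecurrence_omega`).

Equivalences. In the first three pairs the patterns differ by exchanging two entries at distance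
two. Doing this in all marked windows simultaneously is an involution of the positions, and it
carries the relations of one cluster poset into the order generated by those of the other, even
where windows overlap (`relHom_windowSwap_two`, `relHom_windowSwap_one`). For 154263 and 165243 both
cluster posets are identified with one explicit tree: a spine with chains attached (`clusterLEIso`).
The heights at which the tree branches, together with its size, determine the sequence of overlaps,
whence the uniqueness of the matching tuple (`eq_of_isForkLevel`).

The 92 classes. For the upper bound, reversal and complement reduce to patterns whose first entry is
smaller than the last, with small sum; patterns whose overlapping windows share the same values in
the same way are equivalent (`Compatible.P_eq`); and the four pairs above provide the remaining
mergers. For the lower bound, cluster numbers with two and three marks separate the 92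
representatives. Both bounds end in finite computations on lists of entries, proved to compute the
intended quantities and evaluated by the kernel. -/

namespace ConsecutivePattern

/-! ### Linear extensions of a relation on a finite set -/

open Finset in
open Classical in
/-- The number of ways to list `n` elements of `A` one after the other so that each listed element
is `R`-minimal among those not listed before; for `n = #A` this is the number of linear extensions
of `R` on `A`. -/
noncomputable def linExt (R : ℕ → ℕ → Prop) : ℕ → Finset ℕ → ℕ
  | 0, _ => 1
  | n + 1, A => ∑ x ∈ A.filter (fun x => ∀ y ∈ A, ¬ R y x), linExt R n (A.erase x)

theorem linExt_image {R R' : ℕ → ℕ → Prop} {φ : ℕ → ℕ} (hφ : Function.Injective φ) (n : ℕ)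
    (A : Finset ℕ) (h : ∀ x ∈ A, ∀ y ∈ A, R x y ↔ R' (φ x) (φ y)) :
    linExt R' n (A.image φ) = linExt R n A := by
  classical
  induction n generalizing A with
  | zero => rfl
  | succ n ih =>
    simp only [linExt]
    rw [Finset.filter_image, Finset.sum_image hφ.injOn]
    refine Finset.sum_congr ?_ ?_
    · ext x
      simp only [Finset.mem_filter, Finset.forall_mem_image]
      refine and_congr_right fun hx => forall₂_congr fun y hy => not_congr (h y hy x hx).symm
    · intro x hx
      rw [← Finset.image_erase hφ]
      exact ih _ fun a ha b hb => h a (Finset.mem_of_mem_erase ha) b (Finset.mem_of_mem_erase hb)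

theorem linExt_congr {R R' : ℕ → ℕ → Prop} (n : ℕ) (A : Finset ℕ)
    (h : ∀ x ∈ A, ∀ y ∈ A, R x y ↔ R' x y) : linExt R n A = linExt R' n A := by
  simpa using (linExt_image (φ := id) Function.injective_id n A h).symm

/-- The first letter is forced. It is enough that each other element has something below it, not
necessarily `x`; this is what the overlapping windows of a cluster provide. -/
theorem linExt_of_unique_min {R : ℕ → ℕ → Prop} {n : ℕ} {A : Finset ℕ} (x : ℕ) (hx : x ∈ A)
    (h : ∀ y ∈ A, ¬ R y x) (h' : ∀ y ∈ A, y ≠ x → ∃ z ∈ A, R z y) :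
    linExt R (n + 1) A = linExt R n (A.erase x) := by
  classical
  have : A.filter (fun x => ∀ y ∈ A, ¬ R y x) = {x} := by
    ext y
    simp only [Finset.mem_filter, Finset.mem_singleton]
    constructor
    · rintro ⟨hy, hy'⟩
      by_contra hne
      obtain ⟨z, hz, hr⟩ := h' y hy hne
      exact hy' z hz hr
    · rintro rfl
      exact ⟨hx, h⟩
  simp only [linExt]
  rw [this, Finset.sum_singleton]

/-- Linear extensions of a disjoint union are shuffles. The induction splits on whether the first
letter comes from `A` or from `B`; the two contributions add up by Pascal's rule. -/
theorem linExt_union {R : ℕ → ℕ → Prop} (a b : ℕ) (A B : Finset ℕ) (hA : A.card = a)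
    (hB : B.card = b) (hd : Disjoint A B) (hAB : ∀ x ∈ A, ∀ y ∈ B, ¬ R x y ∧ ¬ R y x) :
    linExt R (a + b) (A ∪ B) = (a + b).choose a * (linExt R a A * linExt R b B) := by
  classical
  induction hn : a + b generalizing a b A B with
  | zero =>
    obtain ⟨rfl, rfl⟩ : a = 0 ∧ b = 0 := by omega
    simp [linExt]
  | succ n ih =>
    have key : linExt R (n + 1) (A ∪ B) =
        ∑ x ∈ A.filter (fun x => ∀ y ∈ A, ¬ R y x), linExt R n (A.erase x ∪ B) +
        ∑ x ∈ B.filter (fun x => ∀ y ∈ B, ¬ R y x), linExt R n (A ∪ B.erase x) := by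
      simp only [linExt]
      rw [Finset.filter_union, Finset.sum_union
        (hd.mono (Finset.filter_subset _ _) (Finset.filter_subset _ _))]
      congr 1
      · refine Finset.sum_congr ?_ ?_
        · ext x
          simp only [Finset.mem_filter, Finset.mem_union]
          refine and_congr_right fun hx => ⟨fun h y hy => h y (Or.inl hy), fun h y hy => ?_⟩
          rcases hy with hy | hy
          · exact h y hy
          · exact (hAB x hx y hy).2
        · intro x hx
          rw [Finset.erase_union_distrib, Finset.erase_eq_of_notMem (s := B)]
          exact Finset.disjoint_left.1 hd (Finset.mem_of_mem_filter _ hx)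
      · refine Finset.sum_congr ?_ ?_
        · ext x
          simp only [Finset.mem_filter, Finset.mem_union]
          refine and_congr_right fun hx => ⟨fun h y hy => h y (Or.inr hy), fun h y hy => ?_⟩
          rcases hy with hy | hy
          · exact (hAB y hy x hx).1
          · exact h y hy
        · intro x hx
          rw [Finset.erase_union_distrib, Finset.erase_eq_of_notMem (s := A)]
          exact Finset.disjoint_right.1 hd (Finset.mem_of_mem_filter _ hx)
    have h1 : ∑ x ∈ A.filter (fun x => ∀ y ∈ A, ¬ R y x), linExt R n (A.erase x ∪ B) =
        if a = 0 then 0 else n.choose (a - 1) * (linExt R a A * linExt R b B) := by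
      rcases a with _ | a
      · rw [Finset.card_eq_zero] at hA
        simp [hA]
      · rw [if_neg (Nat.succ_ne_zero a), Nat.add_sub_cancel, linExt, Finset.sum_mul, Finset.mul_sum]
        refine Finset.sum_congr rfl fun x hx => ?_
        have hx' := Finset.mem_of_mem_filter _ hx
        refine ih a b _ _ ?_ hB ?_ ?_ (by omega)
        · rw [Finset.card_erase_of_mem hx', hA]; rfl
        · exact hd.mono_left (Finset.erase_subset _ _)
        · exact fun x hx y hy => hAB x (Finset.mem_of_mem_erase hx) y hy
    have h2 : ∑ x ∈ B.filter (fun x => ∀ y ∈ B, ¬ R y x), linExt R n (A ∪ B.erase x) =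
        if b = 0 then 0 else n.choose a * (linExt R a A * linExt R b B) := by
      rcases b with _ | b
      · rw [Finset.card_eq_zero] at hB
        simp [hB]
      · rw [if_neg (Nat.succ_ne_zero b), linExt, Finset.mul_sum, Finset.mul_sum]
        refine Finset.sum_congr rfl fun x hx => ?_
        have hx' := Finset.mem_of_mem_filter _ hx
        refine ih a b _ _ hA ?_ ?_ ?_ (by omega)
        · rw [Finset.card_erase_of_mem hx', hB]; rfl
        · exact hd.mono_right (Finset.erase_subset _ _)
        · exact fun x hx y hy => hAB x hx y (Finset.mem_of_mem_erase hy)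
    rw [key, h1, h2]
    rcases a with _ | a
    · rcases b with _ | b
      · omega
      · simp
    · rcases b with _ | b
      · obtain rfl : n = a := by omega
        simp
      · rw [if_neg (by omega), if_neg (by omega), Nat.add_sub_cancel, Nat.choose_succ_succ]
        ring

open Classical in
/-- The set of the words which list `n` elements of `A` as counted by `linExt`. -/
noncomputable def linExtWords (R : ℕ → ℕ → Prop) : ℕ → Finset ℕ → Finset (List ℕ)
  | 0, _ => {[]}
  | n + 1, A => (A.filter (fun x => ∀ y ∈ A, ¬ R y x)).biUnion
      fun x => (linExtWords R n (A.erase x)).image (List.cons x)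

theorem card_linExtWords (R : ℕ → ℕ → Prop) (n : ℕ) (A : Finset ℕ) :
    (linExtWords R n A).card = linExt R n A := by
  classical
  induction n generalizing A with
  | zero => rfl
  | succ n ih =>
    simp only [linExtWords, linExt]
    rw [Finset.card_biUnion]
    · refine Finset.sum_congr rfl fun x _ => ?_
      rw [Finset.card_image_of_injective _ List.cons_injective, ih]
    · intro x _ y _ hxy
      simp only [Function.onFun, Finset.disjoint_left, Finset.mem_image, not_exists, not_and]
      rintro _ ⟨w, _, rfl⟩ w' _ h
      exact hxy (List.cons.inj h).1.symm

/-- The last clause is needed because a letter is tested for minimality against a set containing the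
letter itself, whereas `Pairwise` only sees pairs of distinct places. -/
theorem mem_linExtWords {R : ℕ → ℕ → Prop} {n : ℕ} {A : Finset ℕ} (hA : A.card = n) {w : List ℕ} :
    w ∈ linExtWords R n A ↔
      w.Nodup ∧ w.toFinset = A ∧ w.Pairwise (fun x y => ¬ R y x) ∧ ∀ x ∈ A, ¬ R x x := by
  classical
  induction n generalizing A w with
  | zero =>
    rw [Finset.card_eq_zero] at hA
    subst hA
    simp only [linExtWords, Finset.mem_singleton]
    constructor
    · rintro rfl; simp
    · rintro ⟨-, h, -⟩; simpa using h
  | succ n ih =>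
    simp only [linExtWords, Finset.mem_biUnion, Finset.mem_filter, Finset.mem_image]
    constructor
    · rintro ⟨x, ⟨hx, hmin⟩, w, hw, rfl⟩
      rw [ih (by rw [Finset.card_erase_of_mem hx, hA]; rfl)] at hw
      obtain ⟨h1, h2, h3, h4⟩ := hw
      have hmem : ∀ y ∈ w, y ∈ A.erase x := fun y hy => by rw [← h2]; simpa using hy
      refine ⟨?_, ?_, ?_, ?_⟩
      · refine List.nodup_cons.2 ⟨fun h => ?_, h1⟩
        simpa using hmem x h
      · rw [List.toFinset_cons, h2, Finset.insert_erase hx]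
      · exact List.pairwise_cons.2 ⟨fun y hy => hmin y (Finset.mem_of_mem_erase (hmem y hy)), h3⟩
      · intro y hy
        by_cases hyx : y = x
        · subst hyx; exact hmin y hy
        · exact h4 y (Finset.mem_erase.2 ⟨hyx, hy⟩)
    · rintro ⟨h1, h2, h3, h4⟩
      rcases w with _ | ⟨x, w⟩
      · simp at h2
        rw [← h2] at hA
        simp at hA
      · have hx : x ∈ A := by rw [← h2]; simp
        rw [List.nodup_cons] at h1
        rw [List.pairwise_cons] at h3
        have hw : w.toFinset = A.erase x := by
          rw [← h2, List.toFinset_cons, Finset.erase_insert]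
          simpa using h1.1
        refine ⟨x, ⟨hx, fun y hy => ?_⟩, w, ?_, rfl⟩
        · rw [← h2, List.toFinset_cons, Finset.mem_insert] at hy
          rcases hy with rfl | hy
          · exact h4 y hx
          · exact h3.1 y (by simpa using hy)
        · rw [ih (by rw [Finset.card_erase_of_mem hx, hA]; rfl)]
          exact ⟨h1.2, hw, h3.2, fun y hy => h4 y (Finset.mem_of_mem_erase hy)⟩

/-- The number of permutations which are strictly monotone with respect to a relation is the number
of its linear extensions. -/
theorem card_monotone_perm (R : ℕ → ℕ → Prop) (n : ℕ) :
    Nat.card {π : Equiv.Perm (Fin n) // ∀ x y : Fin n, R x y → π x < π y} =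
      linExt R n (Finset.range n) := by
  classical
  -- The positions listed by increasing value: monotone permutations are exactly those for which
  -- this word is a linear extension.
  let word (π : Equiv.Perm (Fin n)) : List ℕ := List.ofFn fun v => (π.symm v : ℕ)
  have hword : ∀ π : Equiv.Perm (Fin n), (∀ x y : Fin n, R x y → π x < π y) ↔
      word π ∈ linExtWords R n (Finset.range n) := by
    intro π
    rw [mem_linExtWords (by simp)]
    have h1 : (word π).Nodup :=
      List.nodup_ofFn.2 fun a b h => π.symm.injective (Fin.ext h)
    have h2 : (word π).toFinset = Finset.range n := by
      ext x
      simp only [word, List.mem_toFinset, List.mem_ofFn', Set.mem_range, Finset.mem_range]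
      exact ⟨fun ⟨v, hv⟩ => hv ▸ (π.symm v).2, fun hx => ⟨π ⟨x, hx⟩, by simp⟩⟩
    simp only [h1, h2, true_and, word, List.pairwise_ofFn, Finset.mem_range]
    constructor
    · intro h
      refine ⟨fun a b hab hr => ?_, fun x hx hr => lt_irrefl _ (h ⟨x, hx⟩ ⟨x, hx⟩ hr)⟩
      have := h _ _ hr
      simp only [Equiv.apply_symm_apply] at this
      exact absurd hab this.asymm
    · rintro ⟨h, h'⟩ x y hr
      by_contra hlt
      rcases eq_or_lt_of_le (not_lt.1 hlt) with he | hlt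
      · rw [π.injective he] at hr
        exact h' x x.2 hr
      · exact h hlt (by simpa using hr)
  have hinj : Function.Injective word := by
    intro π π' h
    have h := List.ofFn_injective h
    have : π.symm = π'.symm := Equiv.ext fun v => Fin.ext (congrFun h v)
    simpa using congrArg Equiv.symm this
  rw [← card_linExtWords, ← Fintype.card_coe, ← Nat.card_eq_fintype_card]
  refine Nat.card_congr (Equiv.ofBijective
    (fun π => ⟨word π.1, (hword π.1).1 π.2⟩) ⟨?_, ?_⟩)
  · exact fun π π' h => Subtype.ext (hinj (congrArg Subtype.val h))
  · rintro ⟨w, hw⟩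
    obtain ⟨h1, h2, -⟩ := (mem_linExtWords (by simp)).1 hw
    have hlen : w.length = n := by
      rw [← List.toFinset_card_of_nodup h1, h2, Finset.card_range]
    have hlt : ∀ v : Fin n, w.get (v.cast hlen.symm) < n := fun v => by
      rw [← Finset.mem_range, ← h2, List.mem_toFinset]
      exact List.get_mem _ _
    have hbij : Function.Bijective fun v : Fin n => (⟨w.get (v.cast hlen.symm), hlt v⟩ : Fin n) :=
      Finite.injective_iff_bijective.1 fun a b h => by
        have := (List.nodup_iff_injective_get.1 h1) (Fin.mk.inj h)
        simpa using this
    have hw' : word (Equiv.ofBijective _ hbij).symm = w := by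
      refine List.ext_get (by simp [word, hlen]) fun i hi hi' => ?_
      simp [word]
    exact ⟨⟨(Equiv.ofBijective _ hbij).symm, (hword _).2 (hw'.symm ▸ hw)⟩, Subtype.ext hw'⟩

/-! ### Permutations with prescribed marked occurrences -/

/-- The relations `x < y` between positions which are forced by requiring occurrences of `σ` at the
positions in `S`. -/
def rel (σ : Equiv.Perm (Fin 6)) (S : Finset ℕ) (x y : ℕ) : Prop :=
  ∃ i ∈ S, ∃ a b : Fin 6, x = i + a ∧ y = i + b ∧ σ a < σ b

/-- The number of permutations with occurrences of `σ` at all positions in `S`. -/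
noncomputable def markCount (σ : Equiv.Perm (Fin 6)) (n : ℕ) (S : Finset ℕ) : ℕ :=
  (Finset.univ.filter fun π : Equiv.Perm (Fin n) => ∀ i ∈ S, OccursAt σ π i).card

theorem occursAt_iff {σ : Equiv.Perm (Fin 6)} {n : ℕ} {π : Equiv.Perm (Fin n)} {i : ℕ}
    (hi : i + 6 ≤ n) : OccursAt σ π i ↔
      ∀ a b : Fin 6, σ a < σ b → π ⟨i + a, by omega⟩ < π ⟨i + b, by omega⟩ := by
  constructor
  · rintro ⟨_, h⟩ a b hab
    exact (h a b).2 hab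
  · refine fun h => ⟨hi, fun a b => ⟨fun hab => ?_, h a b⟩⟩
    by_contra hlt
    rcases eq_or_lt_of_le (not_lt.1 hlt) with he | hlt
    · rw [σ.injective he] at hab
      exact lt_irrefl _ hab
    · exact lt_asymm hab (h _ _ hlt)

theorem forall_occursAt_iff {σ : Equiv.Perm (Fin 6)} {n : ℕ} {π : Equiv.Perm (Fin n)}
    {S : Finset ℕ} (hS : ∀ i ∈ S, i + 6 ≤ n) : (∀ i ∈ S, OccursAt σ π i) ↔
      ∀ x y : Fin n, rel σ S x y → π x < π y := by
  constructor
  · rintro h x y ⟨i, hi, a, b, hx, hy, hab⟩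
    have := (occursAt_iff (hS i hi)).1 (h i hi) a b hab
    convert this
  · intro h i hi
    rw [occursAt_iff (hS i hi)]
    exact fun a b hab => h _ _ ⟨i, hi, a, b, rfl, rfl, hab⟩

theorem markCount_eq_linExt {σ : Equiv.Perm (Fin 6)} {n : ℕ} {S : Finset ℕ}
    (hS : ∀ i ∈ S, i + 6 ≤ n) :
    markCount σ n S = linExt (rel σ S) n (Finset.range n) := by
  classical
  rw [← card_monotone_perm, Nat.card_eq_fintype_card, Fintype.card_subtype, markCount]
  simp only [forall_occursAt_iff hS]

theorem lt_of_transGen {n : ℕ} {R : ℕ → ℕ → Prop} {π : Equiv.Perm (Fin n)}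
    (h : ∀ x y : Fin n, R x y → π x < π y) {x y : Fin n}
    (hxy : Relation.TransGen (fun x y : Fin n => R x y) x y) : π x < π y := by
  induction hxy with
  | single h1 => exact h _ _ h1
  | tail _ h1 ih => exact ih.trans (h _ _ h1)

/-- Precomposition with `φ` injects the permutations marked for `τ` into those marked for `σ`. Since
values increase along chains of relations, `φ` need only send a relation to a chain. -/
theorem markCount_le_of_hom {σ τ : Equiv.Perm (Fin 6)} {n : ℕ} {S T : Finset ℕ}
    (hS : ∀ i ∈ S, i + 6 ≤ n) (hT : ∀ i ∈ T, i + 6 ≤ n) (φ : Equiv.Perm (Fin n))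
    (h : ∀ x y : Fin n, rel σ S x y →
      Relation.TransGen (fun x y : Fin n => rel τ T x y) (φ x) (φ y)) :
    markCount τ n T ≤ markCount σ n S := by
  refine Finset.card_le_card_of_injOn (fun π => φ.trans π) ?_ ?_
  · intro π hπ
    simp only [Finset.coe_filter, Finset.mem_univ, true_and, Set.mem_ofPred_eq,
      forall_occursAt_iff hS, forall_occursAt_iff hT] at hπ ⊢
    exact fun x y hxy => lt_of_transGen hπ (h x y hxy)
  · intro π _ π' _ he
    ext x
    simpa using congrArg (fun f : Equiv.Perm (Fin n) => ((f (φ.symm x) : Fin n) : ℕ)) he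

theorem markCount_eq_of_iso {σ τ : Equiv.Perm (Fin 6)} {n : ℕ} {S T : Finset ℕ}
    (hS : ∀ i ∈ S, i + 6 ≤ n) (hT : ∀ i ∈ T, i + 6 ≤ n) (φ : Equiv.Perm (Fin n))
    (h : ∀ x y : Fin n, rel σ S x y →
      Relation.TransGen (fun x y : Fin n => rel τ T x y) (φ x) (φ y))
    (h' : ∀ x y : Fin n, rel τ T x y →
      Relation.TransGen (fun x y : Fin n => rel σ S x y) (φ.symm x) (φ.symm y)) :
    markCount σ n S = markCount τ n T :=
  le_antisymm (markCount_le_of_hom hT hS φ.symm h') (markCount_le_of_hom hS hT φ h)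

theorem rel_image_add (σ : Equiv.Perm (Fin 6)) (S : Finset ℕ) (d x y : ℕ) :
    rel σ (S.image (· + d)) (x + d) (y + d) ↔ rel σ S x y := by
  constructor
  · rintro ⟨i, hi, a, b, hx, hy, hab⟩
    obtain ⟨j, hj, rfl⟩ := Finset.mem_image.1 hi
    exact ⟨j, hj, a, b, by omega, by omega, hab⟩
  · rintro ⟨i, hi, a, b, rfl, rfl, hab⟩
    exact ⟨i + d, Finset.mem_image_of_mem _ hi, a, b, by omega, by omega, hab⟩

theorem range_image_add (n d : ℕ) : (Finset.range n).image (· + d) = Finset.Ico d (n + d) := by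
  ext x
  simp only [Finset.mem_image, Finset.mem_range, Finset.mem_Ico]
  exact ⟨fun ⟨y, hy, h⟩ => by omega, fun h => ⟨x - d, by omega, by omega⟩⟩

theorem linExt_rel_shift (σ : Equiv.Perm (Fin 6)) (S : Finset ℕ) (n d k : ℕ) :
    linExt (rel σ (S.image (· + d))) k (Finset.Ico d (n + d)) =
      linExt (rel σ S) k (Finset.range n) := by
  rw [← range_image_add]
  exact linExt_image (add_left_injective d) _ _ fun x _ y _ => (rel_image_add σ S d x y).symm

/-! ### The cluster method -/

/-- `S` is the set of positions of a cluster of length `n`: the windows of length `6` starting in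
`S` leave no gap between adjacent positions uncovered. -/
def IsCluster (n : ℕ) (S : Finset ℕ) : Prop :=
  (∀ i ∈ S, i + 6 ≤ n) ∧ ∀ l, 0 < l → l < n → ∃ i ∈ S, i < l ∧ l < i + 6

open Classical in
/-- The sets of positions of the clusters of length `n`. -/
noncomputable def clusters (n : ℕ) : Finset (Finset ℕ) :=
  (Finset.range (n + 1 - 6)).powerset.filter (IsCluster n)

theorem mem_clusters {n : ℕ} {S : Finset ℕ} : S ∈ clusters n ↔ IsCluster n S := by
  classical
  simp only [clusters, Finset.mem_filter, Finset.mem_powerset, and_iff_right_iff_imp]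
  intro h i hi
  have := h.1 i hi
  rw [Finset.mem_range]
  omega


theorem occursAt_le {σ : Equiv.Perm (Fin 6)} {n i : ℕ} {π : Equiv.Perm (Fin n)}
    (h : OccursAt σ π i) : i + 6 ≤ n := h.1

theorem rel_union_image_add_left {σ : Equiv.Perm (Fin 6)} {l : ℕ} {S T : Finset ℕ}
    {x y : ℕ} (h : x < l ∨ y < l) :
    rel σ (S ∪ T.image (· + l)) x y ↔ rel σ S x y := by
  constructor
  · rintro ⟨i, hi, a, b, hx, hy, hab⟩
    refine ⟨i, ?_, a, b, hx, hy, hab⟩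
    rcases Finset.mem_union.1 hi with hi | hi
    · exact hi
    · obtain ⟨j, _, rfl⟩ := Finset.mem_image.1 hi
      omega
  · rintro ⟨i, hi, h⟩
    exact ⟨i, Finset.mem_union_left _ hi, h⟩

theorem rel_union_image_add_right {σ : Equiv.Perm (Fin 6)} {l : ℕ} {S T : Finset ℕ}
    (hS : ∀ i ∈ S, i + 6 ≤ l) {x y : ℕ} (h : l ≤ x ∨ l ≤ y) :
    rel σ (S ∪ T.image (· + l)) x y ↔ rel σ (T.image (· + l)) x y := by
  constructor
  · rintro ⟨i, hi, a, b, hx, hy, hab⟩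
    refine ⟨i, ?_, a, b, hx, hy, hab⟩
    rcases Finset.mem_union.1 hi with hi | hi
    · have := hS i hi
      omega
    · exact hi
  · rintro ⟨i, hi, h⟩
    exact ⟨i, Finset.mem_union_right _ hi, h⟩

theorem rel_lt {σ : Equiv.Perm (Fin 6)} {l : ℕ} {S : Finset ℕ} (hS : ∀ i ∈ S, i + 6 ≤ l) {x y : ℕ}
    (h : rel σ S x y) : x < l ∧ y < l := by
  obtain ⟨i, hi, a, b, rfl, rfl, -⟩ := h
  have := hS i hi
  omega

/-- No marked window straddles `l`, so the forced relations never join the two blocks and the linear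
extensions are shuffles. -/
theorem markCount_union {σ : Equiv.Perm (Fin 6)} {n l : ℕ} (hl : l ≤ n) {S T : Finset ℕ}
    (hS : ∀ i ∈ S, i + 6 ≤ l) (hT : ∀ i ∈ T, i + 6 ≤ n - l) :
    markCount σ n (S ∪ T.image (· + l)) =
      n.choose l * (markCount σ l S * markCount σ (n - l) T) := by
  have hST : ∀ i ∈ S ∪ T.image (· + l), i + 6 ≤ n := by
    intro i hi
    rcases Finset.mem_union.1 hi with hi | hi
    · exact (hS i hi).trans hl
    · obtain ⟨j, hj, rfl⟩ := Finset.mem_image.1 hi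
      have := hT j hj
      omega
  rw [markCount_eq_linExt hST, markCount_eq_linExt hS, markCount_eq_linExt hT,
    ← linExt_rel_shift σ T (n - l) l, Nat.sub_add_cancel hl]
  have hr : Finset.range n = Finset.range l ∪ Finset.Ico l n := by
    ext x; simp only [Finset.mem_range, Finset.mem_union, Finset.mem_Ico]; omega
  have := linExt_union (R := rel σ (S ∪ T.image (· + l))) l (n - l) (Finset.range l)
    (Finset.Ico l n) (by simp) (by simp)
    (Finset.disjoint_left.2 fun x hx hx' => by
      rw [Finset.mem_range] at hx; rw [Finset.mem_Ico] at hx'; omega)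
    (fun x hx y hy => by
      rw [Finset.mem_range] at hx
      rw [Finset.mem_Ico] at hy
      rw [rel_union_image_add_left (Or.inl hx), rel_union_image_add_left (Or.inr hx)]
      constructor <;> intro h <;> have := rel_lt hS h <;> omega)
  rw [Nat.add_sub_cancel' hl, ← hr] at this
  rw [this]
  congr 2
  · exact linExt_congr _ _ fun x hx y _ =>
      rel_union_image_add_left (Or.inl (Finset.mem_range.1 hx))
  · exact linExt_congr _ _ fun x hx y _ =>
      rel_union_image_add_right hS (Or.inl (Finset.mem_Ico.1 hx).1)

/-- Splitting a set of marked positions at the first gap between adjacent positions which is not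
covered by a marked window. -/
theorem sum_powerset_eq_sum_clusters {M : Type*} [AddCommMonoid M] (F : Finset ℕ → M) {n : ℕ}
    (hn : 0 < n) :
    ∑ S ∈ (Finset.range (n + 1 - 6)).powerset, F S =
      ∑ l ∈ Finset.Icc 1 n, ∑ S ∈ clusters l, ∑ T ∈ (Finset.range (n - l + 1 - 6)).powerset,
        F (S ∪ T.image (· + l)) := by
  classical
  have hpos : ∀ {k : ℕ} {T : Finset ℕ}, T ∈ (Finset.range (k + 1 - 6)).powerset ↔
      ∀ i ∈ T, i + 6 ≤ k := by
    intro k T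
    simp only [Finset.mem_powerset, Finset.subset_iff, Finset.mem_range]
    exact forall₂_congr fun i _ => by omega
  have hprod : ∀ l, ∑ S ∈ clusters l, ∑ T ∈ (Finset.range (n - l + 1 - 6)).powerset,
      F (S ∪ T.image (· + l)) = ∑ p ∈ clusters l ×ˢ (Finset.range (n - l + 1 - 6)).powerset,
      F (p.1 ∪ p.2.image (· + l)) := fun l =>
    (Finset.sum_product _ _ fun p : Finset ℕ × Finset ℕ => F (p.1 ∪ p.2.image (· + l))).symm
  rw [Finset.sum_congr rfl fun l _ => hprod l, Finset.sum_sigma']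
  symm
  refine Finset.sum_bij (fun p _ => p.2.1 ∪ p.2.2.image (· + p.1)) ?_ ?_ ?_ (fun _ _ => rfl)
  · rintro ⟨l, S, T⟩ h
    simp only [Finset.mem_sigma, Finset.mem_Icc, Finset.mem_product, mem_clusters, hpos] at h ⊢
    obtain ⟨hl, hS, hT⟩ := h
    intro i hi
    rcases Finset.mem_union.1 hi with hi | hi
    · have := hS.1 i hi
      omega
    · obtain ⟨j, hj, rfl⟩ := Finset.mem_image.1 hi
      have := hT j hj
      omega
  · rintro ⟨l, S, T⟩ h ⟨l', S', T'⟩ h' he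
    simp only [Finset.mem_sigma, Finset.mem_Icc, Finset.mem_product, mem_clusters, hpos] at h h' he
    -- The length of the first cluster is determined: a smaller `l` would be a gap covered by a
    -- window of the longer cluster, although no window of the other decomposition crosses it.
    have hlt : ∀ {l : ℕ} {S T : Finset ℕ} {l' : ℕ} {S' T' : Finset ℕ},
        IsCluster l S → IsCluster l' S' → 0 < l →
        S ∪ T.image (· + l) = S' ∪ T'.image (· + l') → ¬ l < l' := by
      intro l S T l' S' T' hS hS' hl he hlt
      obtain ⟨i, hi, h1, h2⟩ := hS'.2 l hl hlt
      have hi' : i ∈ S ∪ T.image (· + l) := he ▸ Finset.mem_union_left _ hi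
      rcases Finset.mem_union.1 hi' with hi | hi
      · have := hS.1 i hi
        omega
      · obtain ⟨j, _, rfl⟩ := Finset.mem_image.1 hi
        omega
    obtain rfl : l = l' := le_antisymm
      (not_lt.1 (hlt h'.2.1 h.2.1 (by omega) he.symm)) (not_lt.1 (hlt h.2.1 h'.2.1 (by omega) he))
    have hmem : ∀ {S T : Finset ℕ}, (∀ i ∈ S, i + 6 ≤ l) → ∀ i,
        (i ∈ S ↔ i < l ∧ i ∈ S ∪ T.image (· + l)) ∧ (i ∈ T ↔ i + l ∈ S ∪ T.image (· + l)) := by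
      intro S T hS i
      simp only [Finset.mem_union, Finset.mem_image]
      refine ⟨⟨fun hi => ⟨by have := hS i hi; omega, Or.inl hi⟩, ?_⟩, fun hi => Or.inr ⟨i, hi, rfl⟩,
        ?_⟩
      · rintro ⟨h1, hi | ⟨j, hj, rfl⟩⟩
        · exact hi
        · omega
      · rintro (hi | ⟨j, hj, hji⟩)
        · have := hS _ hi
          omega
        · rwa [Nat.add_right_cancel hji] at hj
    have hSS : S = S' := by
      ext i
      rw [(hmem (T := T) h.2.1.1 i).1, (hmem (T := T') h'.2.1.1 i).1, he]
    have hTT : T = T' := by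
      ext i
      rw [(hmem (T := T) h.2.1.1 i).2, (hmem (T := T') h'.2.1.1 i).2, he]
    rw [hSS, hTT]
  · intro U hU
    rw [hpos] at hU
    -- The cut is the least positive `l` that no window of `U` crosses; the end `n` is always such a
    -- point.
    have hex : ∃ l, 0 < l ∧ ∀ i ∈ U, i < l → i + 6 ≤ l :=
      ⟨n, hn, fun i hi _ => hU i hi⟩
    obtain ⟨l, ⟨hl, hU1⟩, hmin⟩ : ∃ l, (0 < l ∧ ∀ i ∈ U, i < l → i + 6 ≤ l) ∧
        ∀ l' < l, ¬ (0 < l' ∧ ∀ i ∈ U, i < l' → i + 6 ≤ l') :=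
      ⟨Nat.find hex, Nat.find_spec hex, fun _ => Nat.find_min hex⟩
    have hln : l ≤ n := not_lt.1 fun h => hmin n h ⟨hn, fun i hi _ => hU i hi⟩
    refine ⟨⟨l, U.filter (· < l), (U.filter (l ≤ ·)).image (· - l)⟩, ?_, ?_⟩
    · simp only [Finset.mem_sigma, Finset.mem_Icc, Finset.mem_product, mem_clusters, hpos]
      refine ⟨⟨hl, hln⟩, ⟨?_, ?_⟩, ?_⟩
      · intro i hi
        rw [Finset.mem_filter] at hi
        exact hU1 i hi.1 hi.2
      · intro k hk hkl
        have := hmin k hkl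
        simp only [hk, true_and, not_forall, not_le] at this
        obtain ⟨i, hi, h1, h2⟩ := this
        exact ⟨i, Finset.mem_filter.2 ⟨hi, h1.trans hkl⟩, h1, h2⟩
      · intro i hi
        obtain ⟨j, hj, rfl⟩ := Finset.mem_image.1 hi
        rw [Finset.mem_filter] at hj
        have := hU j hj.1
        omega
    · ext i
      simp only [Finset.mem_union, Finset.mem_filter, Finset.mem_image]
      constructor
      · rintro (h | ⟨_, ⟨j, hj, rfl⟩, rfl⟩)
        · exact h.1
        · rw [Nat.sub_add_cancel hj.2]
          exact hj.1
      · intro hi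
        by_cases h : i < l
        · exact Or.inl ⟨hi, h⟩
        · exact Or.inr ⟨i - l, ⟨i, ⟨hi, not_lt.1 h⟩, rfl⟩, by omega⟩

open Polynomial in
/-- The cluster polynomial: the sum over all clusters of length `n` of `u - 1` to the number of
marked occurrences. -/
noncomputable def clusterPoly (σ : Equiv.Perm (Fin 6)) (n : ℕ) : Polynomial ℚ :=
  ∑ S ∈ clusters n, (X - 1) ^ S.card * (markCount σ n S : Polynomial ℚ)

-- Expanding u^c = ((u - 1) + 1)^c turns a choice of marked occurrences into a factor u - 1 for each
-- mark; exchanging the sums then counts, for each set of marks, the permutations admitting it.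
open Polynomial in
theorem sum_occCount_eq (σ : Equiv.Perm (Fin 6)) (n : ℕ) :
    ∑ π : Equiv.Perm (Fin n), (X : Polynomial ℚ) ^ occCount σ π =
      ∑ S ∈ (Finset.range (n + 1 - 6)).powerset,
        (X - 1) ^ S.card * (markCount σ n S : Polynomial ℚ) := by
  classical
  have h1 : ∀ π : Equiv.Perm (Fin n), (X : Polynomial ℚ) ^ occCount σ π =
      ∑ S ∈ (Finset.range (n + 1 - 6)).powerset,
        if ∀ i ∈ S, OccursAt σ π i then (X - 1) ^ S.card else 0 := by
    intro π
    have := Finset.sum_pow_mul_eq_add_pow (X - 1 : Polynomial ℚ) 1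
      ((Finset.range (n + 1)).filter (fun i => OccursAt σ π i))
    rw [sub_add_cancel] at this
    rw [occCount, ← this, ← Finset.sum_filter]
    refine Finset.sum_congr ?_ fun S _ => by simp
    ext S
    simp only [Finset.mem_powerset, Finset.subset_iff, Finset.mem_filter, Finset.mem_range]
    constructor
    · intro h
      exact ⟨fun i hi => by have := occursAt_le (h hi).2; omega, fun i hi => (h hi).2⟩
    · rintro ⟨h, h'⟩ i hi
      have := h hi
      exact ⟨by omega, h' i hi⟩
  simp_rw [h1]
  rw [Finset.sum_comm]
  refine Finset.sum_congr rfl fun S _ => ?_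
  rw [← Finset.sum_filter, Finset.sum_const, markCount, nsmul_eq_mul, mul_comm]

theorem sum_occCount_recurrence (σ : Equiv.Perm (Fin 6)) {n : ℕ} (hn : 0 < n) :
    ∑ π : Equiv.Perm (Fin n), (Polynomial.X : Polynomial ℚ) ^ occCount σ π =
      ∑ l ∈ Finset.Icc 1 n, (n.choose l : Polynomial ℚ) * (clusterPoly σ l *
        ∑ π : Equiv.Perm (Fin (n - l)), (Polynomial.X : Polynomial ℚ) ^ occCount σ π) := by
  rw [sum_occCount_eq, sum_powerset_eq_sum_clusters _ hn]
  refine Finset.sum_congr rfl fun l hl => ?_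
  rw [Finset.mem_Icc] at hl
  rw [sum_occCount_eq, clusterPoly, Finset.sum_mul, Finset.mul_sum]
  refine Finset.sum_congr rfl fun S hS => ?_
  rw [Finset.mul_sum, Finset.mul_sum]
  refine Finset.sum_congr rfl fun T hT => ?_
  rw [mem_clusters] at hS
  have hT' : ∀ i ∈ T, i + 6 ≤ n - l := fun i hi => by
    have := Finset.mem_range.1 (Finset.mem_powerset.1 hT hi)
    omega
  rw [markCount_union hl.2 hS.1 hT', Finset.card_union_of_disjoint,
    Finset.card_image_of_injective _ (add_left_injective l), pow_add]
  · push_cast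
    ring
  · refine Finset.disjoint_left.2 fun i hi hi' => ?_
    obtain ⟨j, _, rfl⟩ := Finset.mem_image.1 hi'
    have := hS.1 _ hi
    omega

/-- The series `Q` with these coefficients satisfies P · Q = 1: in degree n > 0 this is
`sum_occCount_recurrence` divided by n!. Inverses being unique, `Q` is ω. -/
theorem coeff_omega (σ : Equiv.Perm (Fin 6)) (n : ℕ) : PowerSeries.coeff n (omega σ) =
    if n = 0 then 1 else -(Polynomial.C ((n.factorial : ℚ)⁻¹) * clusterPoly σ n) := by
  let Q : PowerSeries (Polynomial ℚ) := PowerSeries.mk fun n =>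
    if n = 0 then 1 else -(Polynomial.C ((n.factorial : ℚ)⁻¹) * clusterPoly σ n)
  have hP0 : PowerSeries.coeff 0 (P σ) = 1 := by
    have := congrArg (PowerSeries.coeff 0) (P_mul_omega (by norm_num) σ)
    simpa [omega] using this
  have hPQ : P σ * Q = 1 := by
    ext1 n
    rcases Nat.eq_zero_or_pos n with rfl | hn
    · rw [PowerSeries.coeff_mul, Finset.Nat.antidiagonal_zero, Finset.sum_singleton, hP0]
      simp [Q]
    · have hn0 : PowerSeries.coeff n (1 : PowerSeries (Polynomial ℚ)) = 0 := by
        rw [PowerSeries.coeff_one, if_neg hn.ne']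
      rw [mul_comm, PowerSeries.coeff_mul, hn0, Finset.Nat.sum_antidiagonal_eq_sum_range_succ_mk,
        Finset.sum_range_succ', add_comm]
      have h1 : (PowerSeries.coeff 0 Q) * PowerSeries.coeff (n - 0) (P σ) =
          Polynomial.C ((n.factorial : ℚ)⁻¹) * ∑ l ∈ Finset.Icc 1 n, (n.choose l : Polynomial ℚ) *
            (clusterPoly σ l *
              ∑ π : Equiv.Perm (Fin (n - l)), (Polynomial.X : Polynomial ℚ) ^ occCount σ π) := by
        rw [← sum_occCount_recurrence σ hn]
        simp only [Q, PowerSeries.coeff_mk, P, if_true, one_mul, Nat.sub_zero]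
      have hIcc : Finset.Icc 1 n = Finset.Ico 1 (n + 1) := by
        ext; simp only [Finset.mem_Icc, Finset.mem_Ico]; omega
      rw [h1, hIcc, Finset.sum_Ico_eq_sum_range, Finset.mul_sum, Nat.add_sub_cancel,
        ← Finset.sum_add_distrib]
      refine Finset.sum_eq_zero fun i hi => ?_
      rw [Finset.mem_range] at hi
      have hc : (n.factorial : ℚ)⁻¹ * (n.choose (1 + i) : ℚ) =
          ((i + 1).factorial : ℚ)⁻¹ * ((n - (i + 1)).factorial : ℚ)⁻¹ := by
        rw [add_comm 1 i, Nat.cast_choose ℚ (show i + 1 ≤ n by omega)]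
        have := Nat.factorial_ne_zero n
        have := Nat.factorial_ne_zero (i + 1)
        have := Nat.factorial_ne_zero (n - (i + 1))
        field_simp
      have hc' := congrArg (Polynomial.C (R := ℚ)) hc
      rw [map_mul, map_mul, map_natCast] at hc'
      simp only [Q, PowerSeries.coeff_mk, P, if_neg (Nat.succ_ne_zero i)]
      rw [← mul_assoc, hc', add_comm 1 i]
      ring
  calc PowerSeries.coeff n (omega σ) = PowerSeries.coeff n (omega σ * (P σ * Q)) := by
        rw [hPQ, mul_one]
    _ = PowerSeries.coeff n Q := by
        rw [← mul_assoc, mul_comm (omega σ), P_mul_omega (by norm_num), one_mul]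
    _ = _ := PowerSeries.coeff_mk _ _

theorem P_eq_of_omega_eq {σ τ : Equiv.Perm (Fin 6)} (h : omega σ = omega τ) : P σ = P τ := by
  calc P σ = P σ * (P τ * omega τ) := by rw [P_mul_omega (by norm_num), mul_one]
    _ = P τ * (P σ * omega σ) := by rw [h]; ring
    _ = P τ := by rw [P_mul_omega (by norm_num), mul_one]

/-- The criterion behind every equivalence proved below, except those coming from reversal and
complement. -/
theorem P_eq_of_markCount_eq {σ τ : Equiv.Perm (Fin 6)}
    (h : ∀ n S, IsCluster n S → markCount σ n S = markCount τ n S) : P σ = P τ := by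
  refine P_eq_of_omega_eq (PowerSeries.ext fun n => ?_)
  rw [coeff_omega, coeff_omega]
  have : clusterPoly σ n = clusterPoly τ n :=
    Finset.sum_congr rfl fun S hS => by rw [h n S (mem_clusters.1 hS)]
  rw [this]

/-- The cluster numbers: the number of permutations of length `n` with `k` marked occurrences
which form a cluster. -/
noncomputable def clusterNumber (σ : Equiv.Perm (Fin 6)) (n k : ℕ) : ℕ :=
  ∑ S ∈ (clusters n).filter (fun S => S.card = k), markCount σ n S

open Polynomial in
theorem clusterNumber_eq_coeff (σ : Equiv.Perm (Fin 6)) (n k : ℕ) :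
    (clusterNumber σ n k : ℚ) = ((clusterPoly σ n).comp (X + 1)).coeff k := by
  simp only [clusterPoly, Polynomial.sum_comp, Polynomial.mul_comp, Polynomial.pow_comp,
    Polynomial.sub_comp, Polynomial.X_comp, Polynomial.one_comp, Polynomial.natCast_comp,
    add_sub_cancel_right, Polynomial.finsetSum_coeff, Polynomial.coeff_mul_natCast,
    Polynomial.coeff_X_pow, clusterNumber, Nat.cast_sum, Finset.sum_filter]
  refine Finset.sum_congr rfl fun S _ => ?_
  split_ifs <;> simp_all

/-- The converse direction, used to separate classes: substituting u + 1 for u in the cluster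
polynomial makes the cluster numbers its coefficients. -/
theorem clusterNumber_eq_of_P_eq {σ τ : Equiv.Perm (Fin 6)} (h : P σ = P τ) {n : ℕ} (hn : 0 < n)
    (k : ℕ) : clusterNumber σ n k = clusterNumber τ n k := by
  have h1 : omega σ = omega τ := by rw [omega, h, omega]
  have h2 := congrArg (PowerSeries.coeff n) h1
  rw [coeff_omega, coeff_omega, if_neg hn.ne', if_neg hn.ne', neg_inj] at h2
  have h3 : clusterPoly σ n = clusterPoly τ n := by
    refine mul_left_cancel₀ ?_ h2
    rw [Ne, Polynomial.C_eq_zero, inv_eq_zero, Nat.cast_eq_zero]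
    exact Nat.factorial_ne_zero n
  have h4 : (clusterNumber σ n k : ℚ) = clusterNumber τ n k := by
    rw [clusterNumber_eq_coeff, clusterNumber_eq_coeff, h3]
  exact_mod_cast h4

/-! ### Clusters built by prepending a window -/

theorem IsCluster.zero_mem {n : ℕ} {S : Finset ℕ} (h : IsCluster n S) (hn : 2 ≤ n) : 0 ∈ S := by
  obtain ⟨i, hi, h1, -⟩ := h.2 1 one_pos (by omega)
  obtain rfl : i = 0 := by omega
  exact hi

theorem IsCluster.six_le {n : ℕ} {S : Finset ℕ} (h : IsCluster n S) (hn : 2 ≤ n) : 6 ≤ n := by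
  simpa using h.1 0 (h.zero_mem hn)

theorem clusters_eq_empty {n : ℕ} (h2 : 2 ≤ n) (h5 : n ≤ 5) : clusters n = ∅ := by
  refine Finset.eq_empty_of_forall_notMem fun S hS => ?_
  have := (mem_clusters.1 hS).six_le h2
  omega

/-- An unmarked letter is a degenerate cluster, having no gap to cover; it accounts for ω'(0) = -1.
-/
theorem clusters_one : clusters 1 = {∅} := by
  ext S
  rw [mem_clusters, Finset.mem_singleton]
  constructor
  · intro h
    refine Finset.eq_empty_of_forall_notMem fun i hi => ?_
    have := h.1 i hi
    omega
  · rintro rfl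
    exact ⟨by simp, fun l _ _ => by omega⟩

theorem clusters_six : clusters 6 = {{0}} := by
  ext S
  rw [mem_clusters, Finset.mem_singleton]
  constructor
  · intro h
    refine Finset.Subset.antisymm (fun i hi => ?_) (by simpa using h.zero_mem (by norm_num))
    have := h.1 i hi
    simp only [Finset.mem_singleton]
    omega
  · rintro rfl
    exact ⟨by simp, fun l h1 h2 => ⟨0, by simp, h1, by omega⟩⟩

theorem IsCluster.cons {n d : ℕ} {S : Finset ℕ} (h1 : 1 ≤ d) (h5 : d ≤ 5) (hn : d + 2 ≤ n)
    (h : IsCluster (n - d) S) : IsCluster n (insert 0 (S.image (· + d))) := by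
  have h6 := h.six_le (by omega)
  constructor
  · intro i hi
    rcases Finset.mem_insert.1 hi with rfl | hi
    · omega
    · obtain ⟨j, hj, rfl⟩ := Finset.mem_image.1 hi
      have := h.1 j hj
      omega
  · intro l hl hln
    by_cases hl6 : l < 6
    · exact ⟨0, Finset.mem_insert_self _ _, hl, by omega⟩
    · obtain ⟨i, hi, h1, h2⟩ := h.2 (l - d) (by omega) (by omega)
      exact ⟨i + d, Finset.mem_insert_of_mem (Finset.mem_image_of_mem _ hi), by omega, by omega⟩

theorem IsCluster.exists_cons {n : ℕ} {S : Finset ℕ} (hn : 7 ≤ n) (h : IsCluster n S) :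
    ∃ d, 1 ≤ d ∧ d ≤ 5 ∧ ∃ T, IsCluster (n - d) T ∧ S = insert 0 (T.image (· + d)) := by
  have h0 := h.zero_mem (by omega)
  have hex : ∃ d, d ∈ S ∧ 0 < d := by
    -- The gap just after the first window must be covered by another window, so the second mark
    -- exists; the same gap bounds its position by 5.
    obtain ⟨i, hi, h1, h2⟩ := h.2 6 (by norm_num) (by omega)
    exact ⟨i, hi, by omega⟩
  obtain ⟨d, ⟨hd, hd0⟩, hmin⟩ : ∃ d, (d ∈ S ∧ 0 < d) ∧ ∀ i ∈ S, 0 < i → d ≤ i :=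
    ⟨Nat.find hex, Nat.find_spec hex, fun i hi h => Nat.find_min' hex ⟨hi, h⟩⟩
  have hd5 : d ≤ 5 := by
    obtain ⟨i, hi, h1, h2⟩ := h.2 6 (by norm_num) (by omega)
    have := hmin i hi (by omega)
    omega
  have hdn := h.1 d hd
  refine ⟨d, hd0, hd5, (S.erase 0).image (· - d), ⟨?_, ?_⟩, ?_⟩
  · intro i hi
    obtain ⟨j, hj, rfl⟩ := Finset.mem_image.1 hi
    rw [Finset.mem_erase] at hj
    have := h.1 j hj.2
    have := hmin j hj.2 (by omega)
    omega
  · intro l hl hln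
    obtain ⟨i, hi, h1, h2⟩ := h.2 (l + d) (by omega) (by omega)
    rcases Nat.eq_zero_or_pos i with rfl | hi0
    · exact ⟨0, Finset.mem_image.2 ⟨d, Finset.mem_erase.2 ⟨by omega, hd⟩, by omega⟩, hl, by omega⟩
    · have := hmin i hi hi0
      exact ⟨i - d, Finset.mem_image_of_mem _ (Finset.mem_erase.2 ⟨by omega, hi⟩), by omega,
        by omega⟩
  · rw [Finset.image_image]
    have : (S.erase 0).image ((· + d) ∘ (· - d)) = S.erase 0 := by
      conv_rhs => rw [← Finset.image_id (s := S.erase 0)]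
      refine Finset.image_congr fun i hi => ?_
      rw [Finset.mem_coe, Finset.mem_erase] at hi
      have := hmin i hi.2 (by omega)
      simp only [Function.comp, id]
      omega
    rw [this, Finset.insert_erase h0]

/-- Decomposing clusters according to the second marked window. -/
theorem sum_clusters_eq {M : Type*} [AddCommMonoid M] (F : Finset ℕ → M) {n : ℕ} (hn : 7 ≤ n) :
    ∑ S ∈ clusters n, F S =
      ∑ d ∈ Finset.Icc 1 5, ∑ S ∈ clusters (n - d), F (insert 0 (S.image (· + d))) := by
  rw [Finset.sum_sigma']
  symm
  refine Finset.sum_bij (fun p _ => insert 0 (p.2.image (· + p.1))) ?_ ?_ ?_ (fun _ _ => rfl)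
  · rintro ⟨d, S⟩ h
    simp only [Finset.mem_sigma, Finset.mem_Icc, mem_clusters] at h ⊢
    exact h.2.cons h.1.1 h.1.2 (by omega)
  · rintro ⟨d, S⟩ h ⟨d', S'⟩ h' he
    simp only [Finset.mem_sigma, Finset.mem_Icc, mem_clusters] at h h' he
    have hle : ∀ {d : ℕ} {S : Finset ℕ} {d' : ℕ} {S' : Finset ℕ}, d ≤ 5 → 1 ≤ d → IsCluster (n - d) S →
        insert 0 (S.image (· + d)) = insert 0 (S'.image (· + d')) → d' ≤ d := by
      intro d S d' S' hd hd1 hS he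
      have h0 := hS.zero_mem (by omega)
      have : d ∈ insert 0 (S.image (· + d)) :=
        Finset.mem_insert_of_mem (Finset.mem_image.2 ⟨0, h0, by simp⟩)
      rw [he] at this
      rcases Finset.mem_insert.1 this with h | h
      · omega
      · obtain ⟨j, _, h⟩ := Finset.mem_image.1 h
        omega
    obtain rfl : d = d' := le_antisymm (hle h'.1.2 h'.1.1 h'.2 he.symm) (hle h.1.2 h.1.1 h.2 he)
    have hmem : ∀ {S : Finset ℕ} i, i ∈ S ↔ i + d ∈ insert 0 (S.image (· + d)) := by
      intro S i
      simp only [Finset.mem_insert, Finset.mem_image]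
      exact ⟨fun hi => Or.inr ⟨i, hi, rfl⟩, fun h => h.elim (fun h => by omega)
        fun ⟨j, hj, hji⟩ => Nat.add_right_cancel hji ▸ hj⟩
    have : S = S' := by
      ext i
      rw [hmem (S := S), he, ← hmem]
    rw [this]
  · intro S hS
    rw [mem_clusters] at hS
    obtain ⟨d, h1, h5, T, hT, rfl⟩ := hS.exists_cons hn
    exact ⟨⟨d, T⟩, by simp only [Finset.mem_sigma, Finset.mem_Icc, mem_clusters]; exact ⟨⟨h1, h5⟩, hT⟩,
      rfl⟩

theorem zero_notMem_image_add {d : ℕ} (hd : 1 ≤ d) (S : Finset ℕ) : 0 ∉ S.image (· + d) := by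
  simp only [Finset.mem_image, not_exists, not_and]
  intro i _
  omega

theorem card_insert_zero_image_add {d : ℕ} (hd : 1 ≤ d) (S : Finset ℕ) :
    (insert 0 (S.image (· + d))).card = S.card + 1 := by
  rw [Finset.card_insert_of_notMem (zero_notMem_image_add hd S),
    Finset.card_image_of_injective _ (add_left_injective d)]


/-! ### Removing small entries from the first window: recurrences for marked clusters -/

/-- The entries of a pattern of length `6` as a function on the natural numbers. -/
def entry (σ : Equiv.Perm (Fin 6)) (a : ℕ) : ℕ := if h : a < 6 then σ ⟨a, h⟩ else 0

theorem entry_of_lt (σ : Equiv.Perm (Fin 6)) {a : ℕ} (h : a < 6) : entry σ a = σ ⟨a, h⟩ :=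
  dif_pos h

theorem rel_iff {σ : Equiv.Perm (Fin 6)} {S : Finset ℕ} {x y : ℕ} : rel σ S x y ↔
    ∃ i ∈ S, i ≤ x ∧ x < i + 6 ∧ i ≤ y ∧ y < i + 6 ∧ entry σ (x - i) < entry σ (y - i) := by
  constructor
  · rintro ⟨i, hi, a, b, rfl, rfl, hab⟩
    refine ⟨i, hi, by omega, by omega, by omega, by omega, ?_⟩
    rw [Nat.add_sub_cancel_left, Nat.add_sub_cancel_left, entry_of_lt σ a.2, entry_of_lt σ b.2]
    exact hab
  · rintro ⟨i, hi, h1, h2, h3, h4, hab⟩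
    rw [entry_of_lt σ (by omega), entry_of_lt σ (by omega)] at hab
    exact ⟨i, hi, ⟨x - i, by omega⟩, ⟨y - i, by omega⟩, by simp only; omega, by simp only; omega, hab⟩

theorem mem_overlapSet_iff {σ : Equiv.Perm (Fin 6)} {d : ℕ} : d ∈ overlapSet σ ↔
    1 ≤ d ∧ d < 6 ∧ ∀ a < 6, ∀ b < 6, a + d < 6 → b + d < 6 →
      (entry σ (a + d) < entry σ (b + d) ↔ entry σ a < entry σ b) := by
  refine and_congr_right fun _ => and_congr_right fun _ => ⟨fun h a h1 b h2 ha hb => ?_,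
    fun h a b ha hb => ?_⟩
  · rw [entry_of_lt σ ha, entry_of_lt σ hb, entry_of_lt σ h1, entry_of_lt σ h2]
    exact h a b ha hb
  · have := h a (by omega) b (by omega) ha hb
    rw [entry_of_lt σ ha, entry_of_lt σ hb, entry_of_lt σ (by omega),
      entry_of_lt σ (by omega)] at this
    exact this

theorem mem_overlapSet_of_occursAt {σ : Equiv.Perm (Fin 6)} {n i d : ℕ} {π : Equiv.Perm (Fin n)}
    (h : OccursAt σ π i) (h' : OccursAt σ π (i + d)) (h1 : 1 ≤ d) (h6 : d < 6) :
    d ∈ overlapSet σ := by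
  refine ⟨h1, h6, fun a b ha hb => ?_⟩
  obtain ⟨_, h⟩ := h
  obtain ⟨_, h'⟩ := h'
  rw [← h ⟨a + d, ha⟩ ⟨b + d, hb⟩, ← h' ⟨a, by omega⟩ ⟨b, by omega⟩]
  simp only [add_comm, add_left_comm]

theorem markCount_eq_zero {σ : Equiv.Perm (Fin 6)} {n i d : ℕ} {S : Finset ℕ} (hi : i ∈ S)
    (hid : i + d ∈ S) (h1 : 1 ≤ d) (h6 : d < 6) (hd : d ∉ overlapSet σ) : markCount σ n S = 0 := by
  rw [markCount, Finset.card_eq_zero, Finset.filter_eq_empty_iff]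
  exact fun π _ h => hd (mem_overlapSet_of_occursAt (h i hi) (h _ hid) h1 h6)

/-- Removing from a cluster the smallest entry of its first window not removed before. -/
theorem linExt_rel_remove {σ : Equiv.Perm (Fin 6)} {n k d : ℕ} {U : Finset ℕ} (hU : IsCluster n U)
    (hn : 6 ≤ n) (hd : ∀ i ∈ U, i = 0 ∨ d ≤ i) (h0 : ∀ b < 6, ¬ entry σ b < entry σ 0)
    (h0' : ∀ b < 6, 0 < b → entry σ 0 < entry σ b)
    (L : Finset ℕ) (p : ℕ) (hp : p < 6) (hpL : p ∉ L)
    (hmin : ∀ y < 6, y ∉ L → y ≠ p → entry σ p < entry σ y)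
    (hpd : p ≤ d ∨ p = d + 1 ∧ ∀ a < 6, entry σ a < entry σ 1 → d + a ∈ L)
    (hL : ∀ x ∈ L, x ≤ d)
    (hdL : d ∈ L → ∀ b < 6, 6 ≤ d + b → ∃ c < 6, entry σ c < entry σ b ∧ d + c ∉ L) :
    linExt (rel σ U) (k + 1) (Finset.range n \ L) =
      linExt (rel σ U) k (Finset.range n \ insert p L) := by
  rw [linExt_of_unique_min p]
  · congr 1
    ext x
    simp only [Finset.mem_erase, Finset.mem_sdiff, Finset.mem_insert]
    tauto
  · simp only [Finset.mem_sdiff, Finset.mem_range]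
    exact ⟨by omega, hpL⟩
  · intro y hy hr
    rw [Finset.mem_sdiff] at hy
    obtain ⟨i, hi, h1, h2, h3, h4, h5⟩ := rel_iff.1 hr
    -- Minimality of `p`: inside the first window it is the smallest entry left. A later window
    -- containing `p` either starts at `p`, where its smallest entry sits, or starts at `d` with `p`
    -- in second place, and then its smaller entries have already been removed.
    rcases hd i hi with rfl | hdi
    · rw [Nat.sub_zero, Nat.sub_zero] at h5
      rcases eq_or_ne y p with rfl | hne
      · exact lt_irrefl _ h5
      · exact lt_asymm h5 (hmin y (by omega) hy.2 hne)
    · by_cases hpi : p = i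
      · rw [hpi, Nat.sub_self] at h5
        exact h0 _ (by omega) h5
      · rcases hpd with hpd | ⟨rfl, hpd⟩
        · omega
        · obtain rfl : d = i := by omega
          rw [Nat.add_sub_cancel_left] at h5
          have := hpd _ (by omega) h5
          rw [Nat.add_sub_cancel' h1] at this
          exact hy.2 this
  · intro y hy hne
    rw [Finset.mem_sdiff, Finset.mem_range] at hy
    by_cases hy6 : y < 6
    · refine ⟨p, ?_, rel_iff.2 ⟨0, hU.zero_mem (by omega), by omega, by omega, by omega, by omega,
        hmin y hy6 hy.2 hne⟩⟩
      rw [Finset.mem_sdiff, Finset.mem_range]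
      exact ⟨by omega, hpL⟩
    · obtain ⟨i, hi, h1, h2⟩ := hU.2 y (by omega) hy.1
      -- An element beyond the first window is not minimal: the first entry of a window covering it
      -- is smaller. Should that entry be gone, the window is the one starting at `d`, and `hdL`
      -- supplies another smaller entry still present.
      by_cases hiL : i ∈ L
      · have hid : i = d := by
          have := hL i hiL
          have := hd i hi
          omega
        subst hid
        obtain ⟨c, hc, h3, h4⟩ := hdL hiL (y - i) (by omega) (by omega)
        have := hU.1 i hi
        refine ⟨i + c, ?_, rel_iff.2 ⟨i, hi, by omega, by omega, by omega, by omega, ?_⟩⟩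
        · rw [Finset.mem_sdiff, Finset.mem_range]
          exact ⟨by omega, h4⟩
        · rwa [Nat.add_sub_cancel_left]
      · refine ⟨i, ?_, rel_iff.2 ⟨i, hi, by omega, by omega, by omega, by omega, ?_⟩⟩
        · rw [Finset.mem_sdiff, Finset.mem_range]
          exact ⟨by omega, hiL⟩
        · rw [Nat.sub_self]
          exact h0' _ (by omega) (by omega)

theorem Ico_image_add (a b d : ℕ) :
    (Finset.Ico a b).image (· + d) = Finset.Ico (a + d) (b + d) := by
  ext x
  simp only [Finset.mem_image, Finset.mem_Ico]
  exact ⟨fun ⟨y, hy, h⟩ => by omega, fun h => ⟨x - d, by omega, by omega⟩⟩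

/-- As `d` is an overlap, the second window already imposes on the common positions the order that
the first one does. So after everything before `d` is removed, the first window is redundant. -/
theorem rel_cons_iff {σ : Equiv.Perm (Fin 6)} {S : Finset ℕ} {d : ℕ} (hd : d ∈ overlapSet σ)
    (h0 : 0 ∈ S) {x y : ℕ} (hx : d ≤ x) (hy : d ≤ y) :
    rel σ (insert 0 (S.image (· + d))) x y ↔ rel σ (S.image (· + d)) x y := by
  constructor
  · intro h
    obtain ⟨i, hi, h1, h2, h3, h4, h5⟩ := rel_iff.1 h
    rcases Finset.mem_insert.1 hi with rfl | hi
    · refine rel_iff.2 ⟨0 + d, Finset.mem_image_of_mem _ h0, by omega, by omega, by omega, by omega,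
        ?_⟩
      rw [← (mem_overlapSet_iff.1 hd).2.2 _ (by omega) _ (by omega) (by omega) (by omega)]
      rwa [zero_add, Nat.sub_add_cancel hx, Nat.sub_add_cancel hy]
    · exact rel_iff.2 ⟨i, hi, h1, h2, h3, h4, h5⟩
  · rintro ⟨i, hi, h⟩
    exact ⟨i, Finset.mem_insert_of_mem hi, h⟩

theorem linExt_rel_cons {σ : Equiv.Perm (Fin 6)} {S : Finset ℕ} {d : ℕ} (hd : d ∈ overlapSet σ)
    (h0 : 0 ∈ S) (k a b : ℕ) :
    linExt (rel σ (insert 0 (S.image (· + d)))) k (Finset.Ico (a + d) (b + d)) =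
      linExt (rel σ S) k (Finset.Ico a b) := by
  rw [linExt_congr _ _ fun x hx y hy => rel_cons_iff hd h0
    (le_trans (by omega) (Finset.mem_Ico.1 hx).1) (le_trans (by omega) (Finset.mem_Ico.1 hy).1),
    ← Ico_image_add]
  exact linExt_image (add_left_injective d) _ _ fun x _ y _ => (rel_image_add σ S d x y).symm

/-- The position `p` lies in the first window only, whose other entries have all been removed. It is
therefore incomparable to the `k` remaining elements and can be inserted in `k + 1` places. -/
theorem linExt_rel_cons_isolated {σ : Equiv.Perm (Fin 6)} {S : Finset ℕ} {d p k : ℕ} (hp : p < d)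
    (hp0 : p < 6) : linExt (rel σ (insert 0 (S.image (· + d)))) (k + 1)
        (insert p (Finset.Ico 6 (k + 6))) =
      (k + 1) * linExt (rel σ (insert 0 (S.image (· + d)))) k (Finset.Ico 6 (k + 6)) := by
  have hnot : ∀ y, 6 ≤ y → ∀ i ∈ insert 0 (S.image (· + d)), ¬ (i ≤ p ∧ y < i + 6) := by
    intro y hy i hi
    rcases Finset.mem_insert.1 hi with rfl | hi
    · omega
    · obtain ⟨j, _, rfl⟩ := Finset.mem_image.1 hi
      omega
  have := linExt_union (R := rel σ (insert 0 (S.image (· + d)))) 1 k {p} (Finset.Ico 6 (k + 6))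
    (by simp) (by simp) (by simp; omega) (by
      intro x hx y hy
      rw [Finset.mem_singleton] at hx
      subst hx
      rw [Finset.mem_Ico] at hy
      simp only [rel_iff, not_exists, not_and]
      exact ⟨fun i hi h1 h2 h3 h4 => absurd ⟨h1, h4⟩ (hnot y hy.1 i hi),
        fun i hi h1 h2 h3 h4 => absurd ⟨h3, h2⟩ (hnot y hy.1 i hi)⟩)
  rw [add_comm 1 k, Nat.choose_one_right] at this
  rw [Finset.insert_eq p, this]
  have h1 : linExt (rel σ (insert 0 (S.image (· + d)))) 1 {p} = 1 := by
    exact linExt_of_unique_min p (Finset.mem_singleton_self p) (by simp [rel_iff])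
      fun y hy hne => absurd (Finset.mem_singleton.1 hy) hne
  rw [h1, one_mul]


/-- The conditions of `linExt_rel_remove`. -/
def CanRemove (σ : Equiv.Perm (Fin 6)) (d : ℕ) (L : Finset ℕ) (p : ℕ) : Prop :=
  p < 6 ∧ p ∉ L ∧ (∀ y < 6, y ∉ L → y ≠ p → entry σ p < entry σ y) ∧
    (p ≤ d ∨ p = d + 1 ∧ ∀ a < 6, entry σ a < entry σ 1 → d + a ∈ L) ∧ (∀ x ∈ L, x ≤ d) ∧
    (d ∈ L → ∀ b < 6, 6 ≤ d + b → ∃ c ∈ Finset.range 6, entry σ c < entry σ b ∧ d + c ∉ L)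

set_option synthInstance.maxSize 1000 in
instance (σ : Equiv.Perm (Fin 6)) (d : ℕ) (L : Finset ℕ) (p : ℕ) :
    Decidable (CanRemove σ d L p) := by
  unfold CanRemove
  infer_instance

theorem linExt_rel_remove_list {σ : Equiv.Perm (Fin 6)} {n k d : ℕ} {U : Finset ℕ}
    (hU : IsCluster n U) (hn : 6 ≤ n) (hd : ∀ i ∈ U, i = 0 ∨ d ≤ i)
    (h0 : ∀ b < 6, 0 < b → entry σ 0 < entry σ b) (ps : List ℕ) (L : Finset ℕ)
    (h : ∀ j < ps.length, CanRemove σ d (L ∪ (ps.take j).toFinset) (ps.getD j 0)) :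
    linExt (rel σ U) (k + ps.length) (Finset.range n \ L) =
      linExt (rel σ U) k (Finset.range n \ (L ∪ ps.toFinset)) := by
  have h0' : ∀ b < 6, ¬ entry σ b < entry σ 0 := by
    intro b hb
    rcases Nat.eq_zero_or_pos b with rfl | hb0
    · exact lt_irrefl _
    · exact (h0 b hb hb0).asymm
  induction ps generalizing L with
  | nil => simp
  | cons p ps ih =>
    have hp : CanRemove σ d L p := by simpa using h 0 (by simp)
    obtain ⟨h1, h2, h3, h4, h5, h6⟩ := hp
    rw [List.length_cons, ← add_assoc,
      linExt_rel_remove hU hn hd h0' h0 L p h1 h2 h3 h4 h5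
        (by simpa only [Finset.mem_range] using h6), ih]
    · congr 2
      ext x
      simp only [Finset.mem_union, Finset.mem_insert, List.mem_toFinset, List.mem_cons]
      tauto
    · intro j hj
      have := h (j + 1) (by simpa using hj)
      simp only [List.take_succ_cons, List.toFinset_cons, List.getD_cons_succ] at this
      convert this using 1
      ext x
      simp only [Finset.mem_union, Finset.mem_insert]
      tauto

theorem markCount_eq_linExt_remove {σ : Equiv.Perm (Fin 6)} {n k d : ℕ} {U : Finset ℕ}
    (hU : IsCluster n U) (hn : 6 ≤ n) (hd : ∀ i ∈ U, i = 0 ∨ d ≤ i)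
    (h0 : ∀ b < 6, 0 < b → entry σ 0 < entry σ b) (ps : List ℕ)
    (h : ∀ j < ps.length, CanRemove σ d (ps.take j).toFinset (ps.getD j 0)) (hk : k + ps.length = n)
    {A : Finset ℕ} (hA : Finset.range n \ ps.toFinset = A) :
    markCount σ n U = linExt (rel σ U) k A := by
  have := linExt_rel_remove_list (k := k) hU hn hd h0 ps ∅ (by simpa using h)
  rw [Finset.sdiff_empty, Finset.empty_union, hA] at this
  rw [markCount_eq_linExt hU.1, ← this, hk]

theorem mem_cons_cases {d i : ℕ} {S : Finset ℕ} (hi : i ∈ insert 0 (S.image (· + d))) :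
    i = 0 ∨ d ≤ i := by
  rcases Finset.mem_insert.1 hi with rfl | hi
  · exact Or.inl rfl
  · obtain ⟨j, _, rfl⟩ := Finset.mem_image.1 hi
    exact Or.inr (by simp)

/-- Used to recognise a shorter cluster that has lost its first few entries. The removals take `d`
to be 1, which asks nothing about where the second window starts. -/
theorem markCount_eq_linExt_Ico {σ : Equiv.Perm (Fin 6)} {n k j : ℕ} {S : Finset ℕ}
    (hS : IsCluster n S) (hn : 6 ≤ n) (h0 : ∀ b < 6, 0 < b → entry σ 0 < entry σ b)
    (h : ∀ i < (List.range j).length,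
      CanRemove σ 1 ((List.range j).take i).toFinset ((List.range j).getD i 0)) (hk : k + j = n) :
    markCount σ n S = linExt (rel σ S) k (Finset.Ico j n) := by
  refine markCount_eq_linExt_remove hS hn (fun i _ => by omega) h0 (List.range j) h
    (by simpa using hk) ?_
  ext x
  simp only [Finset.mem_sdiff, Finset.mem_range, List.mem_toFinset, List.mem_range, Finset.mem_Ico]
  omega

section recurrences

variable {n : ℕ} {S : Finset ℕ}

/-- The five smallest entries of the first window, listed by value, fill its first five places. They
include the first entry of the next window, which is the forced minimum of the shorter cluster, so
no freedom is gained or lost. -/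
theorem markCount_p123546_cons_four (hS : IsCluster n S) (hn : 2 ≤ n) :
    markCount p123546 (n + 4) (insert 0 (S.image (· + 4))) = markCount p123546 n S := by
  have h6 := hS.six_le hn
  obtain ⟨k, rfl⟩ := Nat.exists_eq_add_of_le' h6
  have h0 := hS.zero_mem hn
  have hU := IsCluster.cons (n := k + 6 + 4) (d := 4) (S := S) (by norm_num) (by norm_num)
    (by omega) hS
  rw [markCount_eq_linExt_remove (k := k + 5) (d := 4) hU (by omega) (fun _ => mem_cons_cases)
      (by decide) [0, 1, 2, 4, 3] (by decide) (by simp) (A := Finset.Ico (1 + 4) (k + 6 + 4)) ?_,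
    linExt_rel_cons (mem_overlapSet_iff.2 (by decide)) h0,
    markCount_eq_linExt_Ico (k := k + 5) (j := 1) hS h6 (by decide) (by decide) (by omega)]
  ext x
  simp only [Finset.mem_sdiff, Finset.mem_range, List.mem_toFinset, List.mem_cons, Finset.mem_Ico,
    List.not_mem_nil, or_false]
  omega

theorem markCount_p123546_cons_five (hS : IsCluster n S) (hn : 2 ≤ n) :
    markCount p123546 (n + 5) (insert 0 (S.image (· + 5))) = markCount p123546 n S := by
  have h6 := hS.six_le hn
  obtain ⟨k, rfl⟩ := Nat.exists_eq_add_of_le' h6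
  have h0 := hS.zero_mem hn
  have hU := IsCluster.cons (n := k + 6 + 5) (d := 5) (S := S) (by norm_num) (by norm_num)
    (by omega) hS
  rw [markCount_eq_linExt_remove (k := k + 6) (d := 5) hU (by omega) (fun _ => mem_cons_cases)
      (by decide) [0, 1, 2, 4, 3] (by decide) (by simp) (A := Finset.Ico (0 + 5) (k + 6 + 5)) ?_,
    linExt_rel_cons (mem_overlapSet_iff.2 (by decide)) h0,
    markCount_eq_linExt_Ico (k := k + 6) (j := 0) hS h6 (by decide) (by decide) (by omega)]
  ext x
  simp only [Finset.mem_sdiff, Finset.mem_range, List.mem_toFinset, List.mem_cons, Finset.mem_Ico,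
    List.not_mem_nil, or_false]
  omega

/-- After the five smallest entries of the first window, its maximum, in place 3, is isolated. The
rest is the shorter cluster without its two forced initial entries, of size n - 2, which leaves n -
1 places for the maximum. -/
theorem markCount_p123645_cons_four (hS : IsCluster n S) (hn : 2 ≤ n) :
    markCount p123645 (n + 4) (insert 0 (S.image (· + 4))) = (n - 1) * markCount p123645 n S := by
  have h6 := hS.six_le hn
  obtain ⟨k, rfl⟩ := Nat.exists_eq_add_of_le' h6
  have h0 := hS.zero_mem hn
  have hU := IsCluster.cons (n := k + 6 + 4) (d := 4) (S := S) (by norm_num) (by norm_num)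
    (by omega) hS
  rw [markCount_eq_linExt_remove (k := k + 4 + 1) (d := 4) hU (by omega) (fun _ => mem_cons_cases)
      (by decide) [0, 1, 2, 4, 5] (by decide) (by simp) (A := insert 3 (Finset.Ico 6 (k + 4 + 6))) ?_,
    linExt_rel_cons_isolated (by norm_num) (by norm_num),
    show Finset.Ico 6 (k + 4 + 6) = Finset.Ico (2 + 4) (k + 6 + 4) from rfl,
    linExt_rel_cons (mem_overlapSet_iff.2 (by decide)) h0,
    markCount_eq_linExt_Ico (k := k + 4) (j := 2) hS h6 (by decide) (by decide) (by omega)]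
  · rfl
  ext x
  simp only [Finset.mem_sdiff, Finset.mem_range, List.mem_toFinset, List.mem_cons, Finset.mem_Ico,
    List.not_mem_nil, or_false, Finset.mem_insert]
  omega

/-- As for distance 4, but only the first entry of the shorter cluster is consumed, so the isolated
maximum has n places. -/
theorem markCount_p123645_cons_five (hS : IsCluster n S) (hn : 2 ≤ n) :
    markCount p123645 (n + 5) (insert 0 (S.image (· + 5))) = n * markCount p123645 n S := by
  have h6 := hS.six_le hn
  obtain ⟨k, rfl⟩ := Nat.exists_eq_add_of_le' h6
  have h0 := hS.zero_mem hn
  have hU := IsCluster.cons (n := k + 6 + 5) (d := 5) (S := S) (by norm_num) (by norm_num)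
    (by omega) hS
  rw [markCount_eq_linExt_remove (k := k + 5 + 1) (d := 5) hU (by omega) (fun _ => mem_cons_cases)
      (by decide) [0, 1, 2, 4, 5] (by decide) (by simp) (A := insert 3 (Finset.Ico 6 (k + 5 + 6))) ?_,
    linExt_rel_cons_isolated (by norm_num) (by norm_num),
    show Finset.Ico 6 (k + 5 + 6) = Finset.Ico (1 + 5) (k + 6 + 5) from rfl,
    linExt_rel_cons (mem_overlapSet_iff.2 (by decide)) h0,
    markCount_eq_linExt_Ico (k := k + 5) (j := 1) hS h6 (by decide) (by decide) (by omega)]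
  ext x
  simp only [Finset.mem_sdiff, Finset.mem_range, List.mem_toFinset, List.mem_cons, Finset.mem_Ico,
    List.not_mem_nil, or_false, Finset.mem_insert]
  omega

/-- The three entries before the overlap are the three smallest of the first window, so their order
is forced and the whole shorter cluster remains. -/
theorem markCount_p132465_cons_three (hS : IsCluster n S) (hn : 2 ≤ n) :
    markCount p132465 (n + 3) (insert 0 (S.image (· + 3))) = markCount p132465 n S := by
  have h6 := hS.six_le hn
  obtain ⟨k, rfl⟩ := Nat.exists_eq_add_of_le' h6
  have h0 := hS.zero_mem hn
  have hU := IsCluster.cons (n := k + 6 + 3) (d := 3) (S := S) (by norm_num) (by norm_num)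
    (by omega) hS
  rw [markCount_eq_linExt_remove (k := k + 6) (d := 3) hU (by omega) (fun _ => mem_cons_cases)
      (by decide) [0, 2, 1] (by decide) (by simp) (A := Finset.Ico (0 + 3) (k + 6 + 3)) ?_,
    linExt_rel_cons (mem_overlapSet_iff.2 (by decide)) h0,
    markCount_eq_linExt_Ico (k := k + 6) (j := 0) hS h6 (by decide) (by decide) (by omega)]
  ext x
  simp only [Finset.mem_sdiff, Finset.mem_range, List.mem_toFinset, List.mem_cons, Finset.mem_Ico,
    List.not_mem_nil, or_false]
  omega

/-- Here the isolated entry is the maximum in place 4; the shorter cluster has lost its first entry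
only. -/
theorem markCount_p132465_cons_five (hS : IsCluster n S) (hn : 2 ≤ n) :
    markCount p132465 (n + 5) (insert 0 (S.image (· + 5))) = n * markCount p132465 n S := by
  have h6 := hS.six_le hn
  obtain ⟨k, rfl⟩ := Nat.exists_eq_add_of_le' h6
  have h0 := hS.zero_mem hn
  have hU := IsCluster.cons (n := k + 6 + 5) (d := 5) (S := S) (by norm_num) (by norm_num)
    (by omega) hS
  rw [markCount_eq_linExt_remove (k := k + 5 + 1) (d := 5) hU (by omega) (fun _ => mem_cons_cases)
      (by decide) [0, 2, 1, 3, 5] (by decide) (by simp) (A := insert 4 (Finset.Ico 6 (k + 5 + 6))) ?_,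
    linExt_rel_cons_isolated (by norm_num) (by norm_num),
    show Finset.Ico 6 (k + 5 + 6) = Finset.Ico (1 + 5) (k + 6 + 5) from rfl,
    linExt_rel_cons (mem_overlapSet_iff.2 (by decide)) h0,
    markCount_eq_linExt_Ico (k := k + 5) (j := 1) hS h6 (by decide) (by decide) (by omega)]
  ext x
  simp only [Finset.mem_sdiff, Finset.mem_range, List.mem_toFinset, List.mem_cons, Finset.mem_Ico,
    List.not_mem_nil, or_false, Finset.mem_insert]
  omega

end recurrences


/-! ### From recurrences to differential equations -/

open Polynomial in
/-- The coefficients of a power series as an exponential generating function. -/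
noncomputable def egfCoeff (f : PowerSeries ℚ[X]) (n : ℕ) : ℚ[X] :=
  (n.factorial : ℚ[X]) * PowerSeries.coeff n f

theorem egfCoeff_injective : Function.Injective egfCoeff := by
  intro f g h
  refine PowerSeries.ext fun n => mul_left_cancel₀ ?_ (congrFun h n)
  exact_mod_cast Nat.factorial_ne_zero n

theorem egfCoeff_zero_left (n : ℕ) : egfCoeff 0 n = 0 := by simp [egfCoeff]

theorem egfCoeff_add (f g : PowerSeries (Polynomial ℚ)) (n : ℕ) :
    egfCoeff (f + g) n = egfCoeff f n + egfCoeff g n := by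
  simp [egfCoeff, mul_add]

theorem egfCoeff_D (f : PowerSeries (Polynomial ℚ)) (n : ℕ) :
    egfCoeff (D f) n = egfCoeff f (n + 1) := by
  rw [egfCoeff, egfCoeff, D, PowerSeries.coeff_derivative, Nat.factorial_succ]
  push_cast
  ring

theorem egfCoeff_iterate_D (f : PowerSeries (Polynomial ℚ)) (k n : ℕ) :
    egfCoeff (D^[k] f) n = egfCoeff f (n + k) := by
  induction k generalizing n with
  | zero => rfl
  | succ k ih => rw [Function.iterate_succ_apply', egfCoeff_D, ih]; congr 1; omega

theorem egfCoeff_oneSubU_mul (f : PowerSeries (Polynomial ℚ)) (n : ℕ) :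
    egfCoeff (oneSubU * f) n = (1 - Polynomial.X) * egfCoeff f n := by
  rw [egfCoeff, egfCoeff, oneSubU, PowerSeries.coeff_C_mul]
  ring

theorem egfCoeff_X_mul (f : PowerSeries (Polynomial ℚ)) (n : ℕ) :
    egfCoeff (PowerSeries.X * f) n = n * egfCoeff f (n - 1) := by
  rcases n with _ | n
  · simp [egfCoeff]
  · rw [egfCoeff, egfCoeff, PowerSeries.coeff_succ_X_mul, Nat.add_sub_cancel, Nat.factorial_succ]
    push_cast
    ring

theorem constantCoeff_eq_egfCoeff (f : PowerSeries (Polynomial ℚ)) :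
    PowerSeries.constantCoeff f = egfCoeff f 0 := by
  simp [egfCoeff]

theorem initialConditions_iff {f : PowerSeries (Polynomial ℚ)} : InitialConditions f ↔
    egfCoeff f 0 = 1 ∧ egfCoeff f 1 = -1 ∧ ∀ i, 2 ≤ i → i ≤ 4 → egfCoeff f i = 0 := by
  simp only [InitialConditions, constantCoeff_eq_egfCoeff, egfCoeff_D, egfCoeff_iterate_D, zero_add]

open Polynomial in
/-- The recurrence satisfied by the coefficients of the power series `ω`. -/
def ClusterRecurrence (a b : ℕ → ℕ) (j : ℕ) (s : ℕ → ℚ[X]) : Prop :=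
  (s 0 = 1 ∧ s 1 = -1 ∧ ∀ i, 2 ≤ i → i ≤ 4 → s i = 0) ∧
    ∀ n, s (n + 5) = (X - 1 : ℚ[X]) * ((a n : ℚ[X]) * s (n + j) + (b n : ℚ[X]) * s n)

theorem ClusterRecurrence.unique {a b : ℕ → ℕ} {j : ℕ} (hj : j ≤ 4)
    {s t : ℕ → Polynomial ℚ} (hs : ClusterRecurrence a b j s) (ht : ClusterRecurrence a b j t) :
    s = t := by
  funext n
  induction n using Nat.strong_induction_on with
  | _ n ih =>
    by_cases hn : n < 5
    · rcases Nat.lt_or_ge n 2 with h | h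
      · interval_cases n
        · rw [hs.1.1, ht.1.1]
        · rw [hs.1.2.1, ht.1.2.1]
      · rw [hs.1.2.2 n h (by omega), ht.1.2.2 n h (by omega)]
    · obtain ⟨m, rfl⟩ := Nat.exists_eq_add_of_le' (not_lt.1 hn)
      rw [hs.2, ht.2, ih (m + j) (by omega), ih m (by omega)]

theorem egfCoeff_omega_zero (σ : Equiv.Perm (Fin 6)) : egfCoeff (omega σ) 0 = 1 := by
  simp [egfCoeff, coeff_omega]

theorem egfCoeff_omega (σ : Equiv.Perm (Fin 6)) {n : ℕ} (hn : n ≠ 0) :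
    egfCoeff (omega σ) n = -clusterPoly σ n := by
  rw [egfCoeff, coeff_omega, if_neg hn, mul_neg, ← mul_assoc, ← map_natCast Polynomial.C,
    ← map_mul, mul_inv_cancel₀ (by exact_mod_cast Nat.factorial_ne_zero n), map_one, one_mul]

theorem clusterPoly_eq_zero (σ : Equiv.Perm (Fin 6)) {n : ℕ} (h2 : 2 ≤ n) (h5 : n ≤ 5) :
    clusterPoly σ n = 0 := by
  rw [clusterPoly, clusters_eq_empty h2 h5, Finset.sum_empty]

theorem clusterPoly_one (σ : Equiv.Perm (Fin 6)) : clusterPoly σ 1 = 1 := by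
  simp [clusterPoly, clusters_one, markCount]

theorem markCount_six (σ : Equiv.Perm (Fin 6)) : markCount σ 6 {0} = 1 := by
  rw [markCount, Finset.card_eq_one]
  refine ⟨σ, ?_⟩
  ext π
  simp only [Finset.mem_singleton, forall_eq, Finset.mem_filter, Finset.mem_univ, true_and]
  constructor
  · rintro ⟨_, h⟩
    have h' : ∀ a b : Fin 6, π a < π b ↔ σ a < σ b := by
      intro a b
      rw [← h a b]
      simp
    have hm : StrictMono (π ∘ σ.symm) := fun a b hab => by
      simpa [h'] using hab
    have h1 : π ∘ σ.symm = id := (hm.range_inj strictMono_id).1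
      (by rw [Set.range_id, (π.surjective.comp σ.symm.surjective).range_eq])
    refine Equiv.ext fun a => ?_
    simpa using congrFun h1 (σ a)
  · rintro rfl
    exact ⟨by norm_num, fun a b => by simp⟩

theorem clusterPoly_six (σ : Equiv.Perm (Fin 6)) : clusterPoly σ 6 = Polynomial.X - 1 := by
  simp [clusterPoly, clusters_six, markCount_six]

/-- Classify clusters of length n + 5 by the distance to the second window, 5 - j or 5: deleting the
first window leaves a cluster of length n + j or n and costs one factor u - 1. -/
theorem clusterRecurrence_omega {σ : Equiv.Perm (Fin 6)} {a b : ℕ → ℕ} {j : ℕ} (hj1 : 1 ≤ j)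
    (hj2 : j ≤ 2) (hO : ∀ d ∈ overlapSet σ, d = 5 - j ∨ d = 5)
    (ha : ∀ n S, 2 ≤ n → IsCluster (n + j) S →
      markCount σ (n + 5) (insert 0 (S.image (· + (5 - j)))) = a n * markCount σ (n + j) S)
    (hb : ∀ n S, 2 ≤ n → IsCluster n S →
      markCount σ (n + 5) (insert 0 (S.image (· + 5))) = b n * markCount σ n S)
    (h0 : a 0 * egfCoeff (omega σ) j + b 0 = 0) (h1 : b 1 = 1) :
    ClusterRecurrence a b j (egfCoeff (omega σ)) := by
  refine ⟨⟨egfCoeff_omega_zero σ, ?_, fun i h2 h4 => ?_⟩, fun n => ?_⟩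
  · rw [egfCoeff_omega σ one_ne_zero, clusterPoly_one]
  · rw [egfCoeff_omega σ (by omega), clusterPoly_eq_zero σ h2 (by omega), neg_zero]
  · rcases Nat.lt_or_ge n 2 with hn | hn
    -- Lengths 5 and 6 lie below the range of the decomposition: there is no cluster of length 5,
    -- and the only one of length 6 has a single mark. The conditions `h0` and `h1` make the
    -- recurrence agree with these values.
    · obtain rfl | rfl : n = 0 ∨ n = 1 := by omega
      · rw [zero_add, zero_add, egfCoeff_omega σ (n := 5) (by norm_num),
          clusterPoly_eq_zero σ (by norm_num) (by norm_num), egfCoeff_omega_zero, mul_one, h0,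
          mul_zero, neg_zero]
      · rw [egfCoeff_omega σ (n := 1 + 5) (by norm_num), clusterPoly_six,
          egfCoeff_omega σ (n := 1 + j) (by omega), clusterPoly_eq_zero σ (by omega) (by omega),
          egfCoeff_omega σ one_ne_zero, clusterPoly_one, h1]
        push_cast
        ring
    · rw [egfCoeff_omega σ (n := n + 5) (by omega), egfCoeff_omega σ (n := n + j) (by omega),
        egfCoeff_omega σ (n := n) (by omega)]
      have key : ∀ d, ∀ S ∈ clusters (n + 5 - d), 1 ≤ d → d ≤ 5 → d ∉ overlapSet σ →
          markCount σ (n + 5) (insert 0 (S.image (· + d))) = 0 := by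
        intro d S hS h1 h5 hd
        refine markCount_eq_zero (i := 0) (d := d) (Finset.mem_insert_self _ _) ?_ h1 (by omega) hd
        exact Finset.mem_insert_of_mem (Finset.mem_image.2
          ⟨0, (mem_clusters.1 hS).zero_mem (by omega), rfl⟩)
      have hG : clusterPoly σ (n + 5) = ∑ d ∈ ({5 - j, 5} : Finset ℕ),
          ∑ S ∈ clusters (n + 5 - d), (Polynomial.X - 1) ^ (S.card + 1) *
            (markCount σ (n + 5) (insert 0 (S.image (· + d))) : Polynomial ℚ) := by
        rw [clusterPoly, sum_clusters_eq _ (by omega)]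
        symm
        rw [Finset.sum_subset (s₂ := Finset.Icc 1 5)]
        · refine Finset.sum_congr rfl fun d hd => Finset.sum_congr rfl fun S _ => ?_
          rw [card_insert_zero_image_add (Finset.mem_Icc.1 hd).1]
        · intro d hd
          rw [Finset.mem_insert, Finset.mem_singleton] at hd
          rw [Finset.mem_Icc]
          omega
        · intro d hd hd'
          rw [Finset.mem_Icc] at hd
          rw [Finset.mem_insert, Finset.mem_singleton] at hd'
          refine Finset.sum_eq_zero fun S hS => ?_
          rw [key d S hS hd.1 hd.2 fun h => hd' (hO d h), Nat.cast_zero, mul_zero]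
      have hsub : n + 5 - (5 - j) = n + j := by omega
      rw [hG, Finset.sum_pair (by omega), hsub, Nat.add_sub_cancel, clusterPoly, clusterPoly]
      have e1 : ∀ S ∈ clusters (n + j), (Polynomial.X - 1) ^ (S.card + 1) *
          (markCount σ (n + 5) (insert 0 (S.image (· + (5 - j)))) : Polynomial ℚ) =
          (Polynomial.X - 1) * ((a n : ℕ) : Polynomial ℚ) *
            ((Polynomial.X - 1) ^ S.card * (markCount σ (n + j) S : Polynomial ℚ)) := by
        intro S hS
        rw [ha n S hn (mem_clusters.1 hS)]
        push_cast
        ring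
      have e2 : ∀ S ∈ clusters n, (Polynomial.X - 1) ^ (S.card + 1) *
          (markCount σ (n + 5) (insert 0 (S.image (· + 5))) : Polynomial ℚ) =
          (Polynomial.X - 1) * ((b n : ℕ) : Polynomial ℚ) *
            ((Polynomial.X - 1) ^ S.card * (markCount σ n S : Polynomial ℚ)) := by
        intro S hS
        rw [hb n S hn (mem_clusters.1 hS)]
        push_cast
        ring
      rw [Finset.sum_congr rfl e1, Finset.sum_congr rfl e2, ← Finset.mul_sum, ← Finset.mul_sum]
      ring

instance (σ : Equiv.Perm (Fin 6)) (d : ℕ) : Decidable (d ∈ overlapSet σ) :=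
  decidable_of_iff' _ mem_overlapSet_iff

theorem overlap_cases {σ : Equiv.Perm (Fin 6)} {p q : ℕ}
    (h : ∀ d < 6, d ∈ overlapSet σ → d = p ∨ d = q) : ∀ d ∈ overlapSet σ, d = p ∨ d = q :=
  fun d hd => h d hd.2.1 hd

theorem egfCoeff_ode_iff {f g h : PowerSeries (Polynomial ℚ)} (c : ℕ → Polynomial ℚ)
    (hc : ∀ n, egfCoeff h n = (1 - Polynomial.X) * c n) (hg : D^[5] f + h = g) :
    g = 0 ↔ ∀ n, egfCoeff f (n + 5) = (Polynomial.X - 1) * c n := by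
  rw [← egfCoeff_injective.eq_iff, funext_iff, ← hg]
  refine forall_congr' fun n => ?_
  rw [egfCoeff_add, egfCoeff_iterate_D, hc, egfCoeff_zero_left, add_eq_zero_iff_eq_neg, ← neg_mul,
    neg_sub]

theorem clusterRecurrence_iff_eq {a b : ℕ → ℕ} {j : ℕ} (hj : j ≤ 4)
    {f g : PowerSeries (Polynomial ℚ)} (hg : ClusterRecurrence a b j (egfCoeff g)) :
    ClusterRecurrence a b j (egfCoeff f) ↔ f = g :=
  ⟨fun hf => egfCoeff_injective (hf.unique hj hg), fun h => h ▸ hg⟩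

theorem ode_p123546_iff (f : PowerSeries (Polynomial ℚ)) :
    (D^[5] f + oneSubU * (D f + f) = 0 ∧ InitialConditions f) ↔ f = omega p123546 := by
  rw [← clusterRecurrence_iff_eq (a := fun _ => 1) (b := fun _ => 1) (j := 1) (by norm_num)
    (clusterRecurrence_omega le_rfl (by norm_num) (overlap_cases (by decide)) ?_ ?_ ?_ rfl),
    and_comm, ClusterRecurrence, initialConditions_iff, egfCoeff_ode_iff (fun n => ((1 : ℕ) : Polynomial ℚ) * egfCoeff f (n + 1) +
      ((1 : ℕ) : Polynomial ℚ) * egfCoeff f n)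
      (fun n => ?_) rfl]
  · rw [egfCoeff_oneSubU_mul, egfCoeff_add, egfCoeff_D, Nat.cast_one, one_mul, one_mul]
  · intro n S hn hS
    rw [one_mul]
    exact markCount_p123546_cons_four hS (by omega)
  · intro n S hn hS
    rw [one_mul]
    exact markCount_p123546_cons_five hS hn
  · rw [egfCoeff_omega _ one_ne_zero, clusterPoly_one]
    simp

theorem ode_p123645_iff (f : PowerSeries (Polynomial ℚ)) :
    (D^[5] f + oneSubU * PowerSeries.X * (D^[2] f + D f) = 0 ∧ InitialConditions f) ↔
      f = omega p123645 := by
  rw [← clusterRecurrence_iff_eq (a := fun n => n) (b := fun n => n) (j := 1) (by norm_num)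
    (clusterRecurrence_omega le_rfl (by norm_num) (overlap_cases (by decide)) ?_ ?_ ?_ rfl),
    and_comm, ClusterRecurrence, initialConditions_iff, egfCoeff_ode_iff (fun n => ((n : ℕ) : Polynomial ℚ) * egfCoeff f (n + 1) +
      ((n : ℕ) : Polynomial ℚ) * egfCoeff f n)
      (fun n => ?_) rfl]
  · rw [mul_assoc, egfCoeff_oneSubU_mul, egfCoeff_X_mul, egfCoeff_add, egfCoeff_D,
      egfCoeff_iterate_D]
    rcases n with _ | n
    · simp
    · simp only [Nat.add_sub_cancel]
      ring
  · intro n S hn hS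
    have := markCount_p123645_cons_four hS (by omega)
    rwa [Nat.add_sub_cancel] at this
  · intro n S hn hS
    exact markCount_p123645_cons_five hS hn
  · simp

/-- Multiplication by z followed by differentiation dictionary: the coefficient of zⁿ/n! in z ω' is
n times that of ω, matching the factor n for distance 5, while ω'' matches the shift by 2 for
distance 3. -/
theorem ode_p132465_iff (f : PowerSeries (Polynomial ℚ)) :
    (D^[5] f + oneSubU * (D^[2] f + PowerSeries.X * D f) = 0 ∧ InitialConditions f) ↔
      f = omega p132465 := by
  rw [← clusterRecurrence_iff_eq (a := fun _ => 1) (b := fun n => n) (j := 2) (by norm_num)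
    (clusterRecurrence_omega (by norm_num) le_rfl (overlap_cases (by decide)) ?_ ?_ ?_ rfl),
    and_comm, ClusterRecurrence, initialConditions_iff, egfCoeff_ode_iff (fun n => ((1 : ℕ) : Polynomial ℚ) * egfCoeff f (n + 2) +
      ((n : ℕ) : Polynomial ℚ) * egfCoeff f n)
      (fun n => ?_) rfl]
  · rw [egfCoeff_oneSubU_mul, egfCoeff_add, egfCoeff_X_mul, egfCoeff_D,
      egfCoeff_iterate_D]
    rcases n with _ | n
    · simp
    · simp only [Nat.add_sub_cancel]
      push_cast
      ring
  · intro n S hn hS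
    rw [one_mul]
    exact markCount_p132465_cons_three hS (by omega)
  · intro n S hn hS
    exact markCount_p132465_cons_five hS hn
  · rw [egfCoeff_omega _ two_ne_zero, clusterPoly_eq_zero _ le_rfl (by norm_num)]
    simp


/-! ### Isomorphic cluster posets from exchanging two entries in every window -/

theorem rel_window {σ : Equiv.Perm (Fin 6)} {S : Finset ℕ} {i : ℕ} (hi : i ∈ S) {a b : ℕ}
    (ha : a < 6) (hb : b < 6) (h : entry σ a < entry σ b) : rel σ S (i + a) (i + b) := by
  rw [entry_of_lt σ ha, entry_of_lt σ hb] at h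
  exact ⟨i, hi, ⟨a, ha⟩, ⟨b, hb⟩, rfl, rfl, h⟩

theorem transGen_fin {σ : Equiv.Perm (Fin 6)} {n : ℕ} {S : Finset ℕ} (hS : ∀ i ∈ S, i + 6 ≤ n)
    {x y : Fin n} (h : Relation.TransGen (rel σ S) x y) :
    Relation.TransGen (fun x y : Fin n => rel σ S x y) x y := by
  have key : ∀ z, Relation.TransGen (rel σ S) x z → ∀ hz : z < n,
      Relation.TransGen (fun x y : Fin n => rel σ S x y) x ⟨z, hz⟩ := by
    intro z hz
    induction hz with
    | single h => exact fun hz => Relation.TransGen.single h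
    | tail _ h ih =>
      exact fun hz => (ih (rel_lt hS h).1).tail h
  exact key y h y.2

/-- A relabelling of positions that sends the relations forced by `σ` into the order forced by
`τ`. -/
def RelHom (σ τ : Equiv.Perm (Fin 6)) (S : Finset ℕ) (φ : ℕ → ℕ) : Prop :=
  ∀ x y, rel σ S x y → Relation.TransGen (rel τ S) (φ x) (φ y)

/-- An involution of the positions smaller than `n` as a permutation. -/
def finPerm {n : ℕ} (φ : ℕ → ℕ) (hφ : ∀ x, φ (φ x) = x) (hn : ∀ x < n, φ x < n) :
    Equiv.Perm (Fin n) :=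
  Function.Involutive.toPerm (fun x => ⟨φ x, hn x x.2⟩) fun x => Fin.ext (hφ x)

theorem markCount_eq_of_relHom {σ τ : Equiv.Perm (Fin 6)} {n : ℕ} {S : Finset ℕ}
    (hS : ∀ i ∈ S, i + 6 ≤ n) {φ : ℕ → ℕ} (hφ : ∀ x, φ (φ x) = x) (hn : ∀ x < n, φ x < n)
    (h : RelHom σ τ S φ) (h' : RelHom τ σ S φ) : markCount σ n S = markCount τ n S :=
  markCount_eq_of_iso hS hS (finPerm φ hφ hn)
    (fun x y hxy => transGen_fin hS (h x y hxy)) (fun x y hxy => transGen_fin hS (h' x y hxy))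

theorem clusterRel_iff {σ : Equiv.Perm (Fin 6)} {n k : ℕ} {i : Fin k → ℕ} {x y : Fin n} :
    clusterRel σ n i x y ↔ rel σ (Finset.univ.image i) x y := by
  simp [clusterRel, rel]

theorem clusterPosetsIso_of_relHom {σ τ : Equiv.Perm (Fin 6)} {n k : ℕ} {i : Fin k → ℕ}
    (hi : ∀ j, i j + 6 ≤ n) {φ : ℕ → ℕ} (hφ : ∀ x, φ (φ x) = x) (hn : ∀ x < n, φ x < n)
    (h : RelHom σ τ (Finset.univ.image i) φ) (h' : RelHom τ σ (Finset.univ.image i) φ) :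
    ClusterPosetsIso σ τ n i i := by
  have hS : ∀ j ∈ Finset.univ.image i, j + 6 ≤ n := by simpa using hi
  have key : ∀ {σ τ : Equiv.Perm (Fin 6)}, RelHom σ τ (Finset.univ.image i) φ → ∀ {x y : Fin n},
      clusterLE σ n i x y → clusterLE τ n i (finPerm φ hφ hn x) (finPerm φ hφ hn y) := by
    intro σ τ h x y hxy
    induction hxy with
    | refl => exact Relation.ReflTransGen.refl
    | tail _ hbc ih =>
      refine ih.trans (Relation.TransGen.to_reflTransGen ?_)
      have := transGen_fin (x := finPerm φ hφ hn _) (y := finPerm φ hφ hn _) hS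
        (h _ _ (clusterRel_iff.1 hbc))
      simpa only [← clusterRel_iff] using this
  refine ⟨⟨finPerm φ hφ hn, fun {x y} => ⟨fun hxy => ?_, key h⟩⟩⟩
  have := key h' hxy
  have e : ∀ x, finPerm φ hφ hn (finPerm φ hφ hn x) = x := fun x => Fin.ext (hφ x)
  rwa [e, e] at this

/-- Exchanging the entries `i + p` and `i + p + 2` for all `i` in `S`. -/
def windowSwap (p : ℕ) (S : Finset ℕ) (x : ℕ) : ℕ :=
  if p ≤ x ∧ x - p ∈ S then x + 2 else if p + 2 ≤ x ∧ x - (p + 2) ∈ S then x - 2 else x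

section windowSwap

variable {p : ℕ} {S : Finset ℕ}

theorem windowSwap_left {i : ℕ} (hi : i ∈ S) : windowSwap p S (i + p) = i + p + 2 := by
  rw [windowSwap, if_pos ⟨by omega, by rwa [Nat.add_sub_cancel]⟩]

theorem windowSwap_right (h2 : ∀ i ∈ S, ∀ j ∈ S, j ≠ i + 2) {i : ℕ} (hi : i ∈ S) :
    windowSwap p S (i + p + 2) = i + p := by
  rw [windowSwap, if_neg, if_pos]
  · omega
  · exact ⟨by omega, by rwa [show i + p + 2 - (p + 2) = i by omega]⟩
  · rintro ⟨-, h⟩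
    exact h2 i hi _ h (by omega)

theorem windowSwap_of_ne {x : ℕ} (h : ∀ i ∈ S, x ≠ i + p ∧ x ≠ i + p + 2) :
    windowSwap p S x = x := by
  rw [windowSwap, if_neg, if_neg]
  · rintro ⟨h1, h2⟩
    have := h _ h2
    omega
  · rintro ⟨h1, h2⟩
    have := h _ h2
    omega

theorem windowSwap_windowSwap (h2 : ∀ i ∈ S, ∀ j ∈ S, j ≠ i + 2) (x : ℕ) :
    windowSwap p S (windowSwap p S x) = x := by
  by_cases h : ∀ i ∈ S, x ≠ i + p ∧ x ≠ i + p + 2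
  · rw [windowSwap_of_ne h, windowSwap_of_ne h]
  · push Not at h
    obtain ⟨i, hi, h⟩ := h
    by_cases hx : x = i + p
    · rw [hx, windowSwap_left hi, windowSwap_right h2 hi]
    · rw [h hx, windowSwap_right h2 hi, windowSwap_left hi]

theorem windowSwap_lt {n : ℕ} (hS : ∀ i ∈ S, i + 6 ≤ n) (hp : p ≤ 3) {x : ℕ} (hx : x < n) :
    windowSwap p S x < n := by
  rw [windowSwap]
  split_ifs with h1 h2
  · have := hS _ h1.2
    omega
  · omega
  · exact hx

/-- Exchanging the places 2 and 4 turns `σ` into `τ` in a single window. Interference occurs only at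
overlap distance 4, where the first entry of the later window is moved by the earlier one; the
remaining places behave as in one window. -/
theorem relHom_windowSwap_two {σ τ : Equiv.Perm (Fin 6)}
    (hS : ∀ i ∈ S, ∀ j ∈ S, j ≠ i + 1 ∧ j ≠ i + 2 ∧ j ≠ i + 3)
    (h1 : ∀ a < 6, ∀ b < 6, entry σ a < entry σ b →
      entry τ (windowSwap 2 {0} a) < entry τ (windowSwap 2 {0} b))
    (h2 : ∀ a < 6, ¬ entry σ a < entry σ 0) (h3 : ∀ a < 6, 1 < a → entry σ 1 < entry σ a)
    (h4 : entry τ 2 < entry τ 5) : RelHom σ τ S (windowSwap 2 S) := by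
  have hφ : ∀ i ∈ S, ∀ a < 6, 0 < a → windowSwap 2 S (i + a) = i + windowSwap 2 {0} a := by
    intro i hi a ha ha0
    have key : a ≠ 2 → a ≠ 4 → windowSwap 2 S (i + a) = i + a := fun h2 h4 =>
      windowSwap_of_ne fun j hj => by
        have := hS i hi j hj
        have := hS j hj i hi
        constructor <;> intro h <;> omega
    have h2' : ∀ i ∈ S, ∀ j ∈ S, j ≠ i + 2 := fun i hi j hj => (hS i hi j hj).2.1
    interval_cases a
    · exact key (by norm_num) (by norm_num)
    · exact windowSwap_left hi
    · exact key (by norm_num) (by norm_num)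
    · exact windowSwap_right h2' hi
    · exact key (by norm_num) (by norm_num)
  have hlt : ∀ a < 6, windowSwap 2 {0} a < 6 := by decide
  have hpos : ∀ i ∈ S, ∀ a < 6, ∀ b < 6, 0 < a → 0 < b → entry σ a < entry σ b →
      Relation.TransGen (rel τ S) (windowSwap 2 S (i + a)) (windowSwap 2 S (i + b)) := by
    intro i hi a ha b hb ha0 hb0 hab
    rw [hφ i hi a ha ha0, hφ i hi b hb hb0]
    exact Relation.TransGen.single (rel_window hi (hlt a ha) (hlt b hb) (h1 a ha b hb hab))
  intro x y hxy
  obtain ⟨i, hi, hx1, hx2, hy1, hy2, hlt'⟩ := rel_iff.1 hxy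
  obtain ⟨a, rfl⟩ := Nat.exists_eq_add_of_le hx1
  obtain ⟨b, rfl⟩ := Nat.exists_eq_add_of_le hy1
  rw [Nat.add_sub_cancel_left, Nat.add_sub_cancel_left] at hlt'
  have hb0 : 0 < b := Nat.pos_of_ne_zero fun h => h2 a (by omega) (h ▸ hlt')
  rcases Nat.eq_zero_or_pos a with rfl | ha0
  · by_cases h : ∃ j ∈ S, i = j + 4
    · obtain ⟨j, hj, rfl⟩ := h
      -- The first entry of this window has moved to place 2 of the window at `j`. By `h4` it is
      -- still below place 5 there, which is place 1 here; everything else in the window lies above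
      -- place 1.
      have e1 : windowSwap 2 S (j + 4 + 0) = j + 2 :=
        windowSwap_right (fun i hi j hj => (hS i hi j hj).2.1) hj
      have e2 : Relation.TransGen (rel τ S) (windowSwap 2 S (j + 4 + 0))
          (windowSwap 2 S (j + 4 + 1)) := by
        rw [e1, hφ _ hi 1 (by norm_num) (by norm_num)]
        exact Relation.TransGen.single (rel_window hj (by norm_num) (by norm_num) h4)
      rcases eq_or_ne b 1 with rfl | hb1
      · exact e2
      · exact e2.trans (hpos _ hi 1 (by norm_num) b (by omega) one_pos hb0
          (h3 b (by omega) (by omega)))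
    · have e1 : windowSwap 2 S (i + 0) = i + windowSwap 2 {0} 0 :=
        windowSwap_of_ne fun j hj => by
          have := hS j hj i hi
          refine ⟨by omega, fun h' => h ⟨j, hj, by omega⟩⟩
      rw [e1, hφ i hi b (by omega) hb0]
      exact Relation.TransGen.single
        (rel_window hi (hlt 0 (by norm_num)) (hlt b (by omega)) (h1 0 (by norm_num) b (by omega) hlt'))
  · exact hpos i hi a (by omega) b (by omega) ha0 hb0 hlt'

/-- At distance 3 the places 3 and 4 of a window are the places 0 and 1 of the next, so the swap
disturbs both the minimum (place 0) and the maximum (place 4) of a window. The second smallest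
entry, place 2, and the second largest, place 5, stay fixed; comparing with these restores all
relations. -/
theorem relHom_windowSwap_one {σ τ : Equiv.Perm (Fin 6)}
    (hS : ∀ i ∈ S, ∀ j ∈ S, j ≠ i + 1 ∧ j ≠ i + 2 ∧ j ≠ i + 4)
    (h1 : ∀ a < 6, ∀ b < 6, entry σ a < entry σ b →
      entry τ (windowSwap 1 {0} a) < entry τ (windowSwap 1 {0} b))
    (h2 : ∀ a < 6, ¬ entry σ a < entry σ 0)
    (h3 : ∀ a < 6, 0 < a → a ≠ 2 → entry σ 2 < entry σ a)
    (h4 : ∀ a < 6, ¬ entry σ 4 < entry σ a)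
    (h5 : ∀ a < 6, a ≠ 4 → a ≠ 5 → entry σ a < entry σ 5)
    (h6 : entry τ 1 < entry τ 5) (h7 : entry τ 2 < entry τ 3)
    (h8 : entry τ 0 < entry τ 2) (h9 : entry τ 5 < entry τ 4) :
    RelHom σ τ S (windowSwap 1 S) := by
  have h2' : ∀ i ∈ S, ∀ j ∈ S, j ≠ i + 2 := fun i hi j hj => (hS i hi j hj).2.1
  have hφ : ∀ i ∈ S, ∀ a < 6, 0 < a → a ≠ 4 →
      windowSwap 1 S (i + a) = i + windowSwap 1 {0} a := by
    intro i hi a ha ha0 ha4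
    have key : a ≠ 1 → a ≠ 3 → windowSwap 1 S (i + a) = i + a := fun h2 h4 =>
      windowSwap_of_ne fun j hj => by
        have := hS i hi j hj
        have := hS j hj i hi
        constructor <;> intro h <;> omega
    interval_cases a
    · exact windowSwap_left hi
    · exact key (by norm_num) (by norm_num)
    · exact windowSwap_right h2' hi
    · exact absurd rfl ha4
    · exact key (by norm_num) (by norm_num)
  have hlt : ∀ a < 6, windowSwap 1 {0} a < 6 := by decide
  have hpos : ∀ i ∈ S, ∀ a < 6, ∀ b < 6, 0 < a → 0 < b → a ≠ 4 → b ≠ 4 → entry σ a < entry σ b →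
      Relation.TransGen (rel τ S) (windowSwap 1 S (i + a)) (windowSwap 1 S (i + b)) := by
    intro i hi a ha b hb ha0 hb0 ha4 hb4 hab
    rw [hφ i hi a ha ha0 ha4, hφ i hi b hb hb0 hb4]
    exact Relation.TransGen.single (rel_window hi (hlt a ha) (hlt b hb) (h1 a ha b hb hab))
  have hfirst : ∀ i ∈ S,
      Relation.TransGen (rel τ S) (windowSwap 1 S (i + 0)) (windowSwap 1 S (i + 2)) := by
    intro i hi
    rw [hφ i hi 2 (by norm_num) (by norm_num) (by norm_num)]
    by_cases h : ∃ j ∈ S, i = j + 3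
    · obtain ⟨j, hj, rfl⟩ := h
      -- The minimum has moved to place 1 of the window at `j`, which is below place 5 of that
      -- window, i.e. place 2 of this one.
      have e1 : windowSwap 1 S (j + 3 + 0) = j + 1 := windowSwap_right h2' hj
      rw [e1]
      exact Relation.TransGen.single (rel_window hj (by norm_num) (by norm_num) h6)
    · have e1 : windowSwap 1 S (i + 0) = i + 0 :=
        windowSwap_of_ne fun j hj => by
          have := hS j hj i hi
          exact ⟨by omega, fun h' => h ⟨j, hj, by omega⟩⟩
      rw [e1]
      exact Relation.TransGen.single (rel_window hi (by norm_num) (hlt 2 (by norm_num)) h8)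
  have hlast : ∀ i ∈ S,
      Relation.TransGen (rel τ S) (windowSwap 1 S (i + 5)) (windowSwap 1 S (i + 4)) := by
    intro i hi
    rw [hφ i hi 5 (by norm_num) (by norm_num) (by norm_num)]
    by_cases h : i + 3 ∈ S
    -- The maximum has moved to place 3 of the next window; place 5 of this window is place 2 of the
    -- next, and is smaller there.
    · have e1 : windowSwap 1 S (i + 4) = i + 3 + 3 := windowSwap_left h
      rw [e1]
      exact Relation.TransGen.single (rel_window h (a := 2) (by norm_num) (by norm_num) h7)
    · have e1 : windowSwap 1 S (i + 4) = i + 4 :=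
        windowSwap_of_ne fun j hj => by
          have := hS i hi j hj
          refine ⟨fun h' => h ?_, by omega⟩
          rwa [show i + 3 = j by omega]
      rw [e1]
      exact Relation.TransGen.single (rel_window hi (a := 5) (by norm_num) (by norm_num) h9)
  have htop : ∀ i ∈ S, ∀ a < 6, a ≠ 4 → 0 < a →
      Relation.TransGen (rel τ S) (windowSwap 1 S (i + a)) (windowSwap 1 S (i + 4)) := by
    intro i hi a ha ha4 ha0
    rcases eq_or_ne a 5 with rfl | ha5
    · exact hlast i hi
    · exact (hpos i hi a ha 5 (by norm_num) ha0 (by norm_num) ha4 (by norm_num)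
        (h5 a ha ha4 ha5)).trans (hlast i hi)
  intro x y hxy
  obtain ⟨i, hi, hx1, hx2, hy1, hy2, hlt'⟩ := rel_iff.1 hxy
  obtain ⟨a, rfl⟩ := Nat.exists_eq_add_of_le hx1
  obtain ⟨b, rfl⟩ := Nat.exists_eq_add_of_le hy1
  rw [Nat.add_sub_cancel_left, Nat.add_sub_cancel_left] at hlt'
  have ha : a < 6 := by omega
  have hb : b < 6 := by omega
  have hb0 : 0 < b := Nat.pos_of_ne_zero fun h => h2 a ha (h ▸ hlt')
  have ha4 : a ≠ 4 := fun h => h4 b hb (h ▸ hlt')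
  rcases Nat.eq_zero_or_pos a with rfl | ha0
  · refine Relation.TransGen.trans_left (hfirst i hi) ?_
    rcases eq_or_ne b 2 with rfl | hb2
    · exact Relation.ReflTransGen.refl
    · rcases eq_or_ne b 4 with rfl | hb4
      · exact (htop i hi 2 (by norm_num) (by norm_num) (by norm_num)).to_reflTransGen
      · exact (hpos i hi 2 (by norm_num) b hb (by norm_num) hb0 (by norm_num) hb4
          (h3 b hb hb0 hb2)).to_reflTransGen
  · rcases eq_or_ne b 4 with rfl | hb4
    · exact htop i hi a ha ha4 ha0
    · exact hpos i hi a ha b hb ha0 hb0 ha4 hb4 hlt'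

end windowSwap

section indexTuples

variable {σ τ : Equiv.Perm (Fin 6)}

theorem overlapSet_eq (h : ∀ d < 6, d ∈ overlapSet σ ↔ d ∈ overlapSet τ) :
    overlapSet σ = overlapSet τ :=
  Set.ext fun d => ⟨fun hd => (h d hd.2.1).1 hd, fun hd => (h d hd.2.1).2 hd⟩

theorem indexTuples_eq (h : overlapSet σ = overlapSet τ) (n k : ℕ) :
    indexTuples σ n k = indexTuples τ n k := by
  simp only [indexTuples, h]

theorem le_of_mem_indexTuples {n k : ℕ} {i : Fin k → ℕ} (hi : i ∈ indexTuples σ n k)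
    {c : ℕ} (hc : ∀ d ∈ overlapSet σ, c ≤ d) (j t : ℕ) (h : j + t < k) :
    i ⟨j, by omega⟩ + c * t ≤ i ⟨j + t, h⟩ := by
  induction t with
  | zero => simp
  | succ t ih =>
    obtain ⟨d, hd, he⟩ := hi.2 (j + t) h
    have := ih (by omega)
    have := hc d hd
    simp only [← add_assoc] at he ⊢
    rw [he, mul_add]
    omega

theorem add_six_le_of_mem_indexTuples {n k : ℕ} {i : Fin k → ℕ} (hi : i ∈ indexTuples σ n k)
    (j : Fin k) : i j + 6 ≤ n := by
  have ⟨⟨hk, h0, hn⟩, _⟩ := hi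
  have := le_of_mem_indexTuples hi (c := 0) (fun _ _ => Nat.zero_le _) j (k - 1 - j) (by omega)
  have e : (⟨j + (k - 1 - j), by omega⟩ : Fin k) = ⟨k - 1, by omega⟩ := Fin.ext (by simp; omega)
  rw [e] at this
  simp only [Fin.eta] at this
  omega

/-- The differences of any two elements of `S` are overlaps of `σ` or at least `6`. -/
def GoodGaps (σ : Equiv.Perm (Fin 6)) (S : Finset ℕ) : Prop :=
  ∀ i ∈ S, ∀ j ∈ S, i < j → j < i + 6 → j - i ∈ overlapSet σ

/-- When all overlaps are at least 3, marks that are not consecutive are at least 6 apart, so the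
condition on consecutive marks controls all pairs. -/
theorem goodGaps_of_mem_indexTuples {n k : ℕ} {i : Fin k → ℕ} (hi : i ∈ indexTuples σ n k)
    (hc : ∀ d ∈ overlapSet σ, 3 ≤ d) : GoodGaps σ (Finset.univ.image i) := by
  intro x hx y hy hxy hy6
  obtain ⟨j, -, rfl⟩ := Finset.mem_image.1 hx
  obtain ⟨j', -, rfl⟩ := Finset.mem_image.1 hy
  have hjj : j < j' := by
    by_contra hle
    rw [not_lt] at hle
    have := le_of_mem_indexTuples hi hc j' (j - j') (by omega)
    have e : (⟨j' + (j - j'), by omega⟩ : Fin k) = j := Fin.ext (by simp; omega)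
    rw [e] at this
    simp only [Fin.eta] at this
    omega
  have := le_of_mem_indexTuples hi hc j (j' - j) (by omega)
  have e : (⟨j + (j' - j), by omega⟩ : Fin k) = j' := Fin.ext (by simp; omega)
  rw [e] at this
  simp only [Fin.eta] at this
  have e1 : (j' : ℕ) = j + 1 := by omega
  obtain ⟨d, hd, he⟩ := hi.2 j (by omega)
  have e' : (⟨j + 1, by omega⟩ : Fin k) = j' := Fin.ext e1.symm
  rw [e'] at he
  simp only [Fin.eta] at he
  rw [he, Nat.add_sub_cancel_left]
  exact hd

theorem markCount_eq_zero_of_not_goodGaps {S : Finset ℕ} (h : ¬ GoodGaps σ S) (n : ℕ) :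
    markCount σ n S = 0 := by
  simp only [GoodGaps, not_forall] at h
  obtain ⟨i, hi, j, hj, hij, hj6, hd⟩ := h
  exact markCount_eq_zero hi (by rwa [Nat.add_sub_cancel' hij.le]) (by omega) (by omega) hd

theorem GoodGaps.ne {S : Finset ℕ} (h : GoodGaps σ S) {d : ℕ} (hd : d ∉ overlapSet σ) (h1 : 1 ≤ d)
    (h6 : d < 6) {i j : ℕ} (hi : i ∈ S) (hj : j ∈ S) : j ≠ i + d := by
  rintro rfl
  have := h i hi _ hj (by omega) (by omega)
  rw [Nat.add_sub_cancel_left] at this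
  exact hd this

/-- Clusters with a gap that is not an overlap count zero for both patterns; on the others the swap
is an isomorphism. Excluding overlap 2 makes the swap a well-defined involution. -/
theorem P_eq_of_windowSwap {p : ℕ} (hp : p ≤ 3) (hO : overlapSet σ = overlapSet τ)
    (h2 : 2 ∉ overlapSet σ)
    (h : ∀ S, GoodGaps σ S → RelHom σ τ S (windowSwap p S) ∧ RelHom τ σ S (windowSwap p S)) :
    P σ = P τ := by
  refine P_eq_of_markCount_eq fun n S hS => ?_
  by_cases hg : GoodGaps σ S
  · exact markCount_eq_of_relHom hS.1
      (windowSwap_windowSwap fun i hi j hj => hg.ne h2 (by norm_num) (by norm_num) hi hj)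
      (fun x hx => windowSwap_lt hS.1 hp hx) (h S hg).1 (h S hg).2
  · rw [markCount_eq_zero_of_not_goodGaps hg, markCount_eq_zero_of_not_goodGaps]
    rwa [GoodGaps, ← hO]

theorem clusterPosetsIso_of_windowSwap {p : ℕ} (hp : p ≤ 3)
    (h2 : 2 ∉ overlapSet σ) (hc : ∀ d ∈ overlapSet σ, 3 ≤ d)
    (h : ∀ S, GoodGaps σ S → RelHom σ τ S (windowSwap p S) ∧ RelHom τ σ S (windowSwap p S))
    {n k : ℕ} {i : Fin k → ℕ} (hi : i ∈ indexTuples σ n k) : ClusterPosetsIso σ τ n i i := by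
  have hg := goodGaps_of_mem_indexTuples hi hc
  exact clusterPosetsIso_of_relHom (add_six_le_of_mem_indexTuples hi)
    (windowSwap_windowSwap fun i hi j hj => hg.ne h2 (by norm_num) (by norm_num) hi hj)
    (fun x hx => windowSwap_lt (by simpa using add_six_le_of_mem_indexTuples hi) hp hx)
    (h _ hg).1 (h _ hg).2

end indexTuples

theorem relHom_p123546 {S : Finset ℕ} (hS : GoodGaps p123546 S) :
    RelHom p123546 p124536 S (windowSwap 2 S) ∧ RelHom p124536 p123546 S (windowSwap 2 S) := by
  have h : ∀ i ∈ S, ∀ j ∈ S, j ≠ i + 1 ∧ j ≠ i + 2 ∧ j ≠ i + 3 := fun i hi j hj =>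
    ⟨hS.ne (by decide) (by norm_num) (by norm_num) hi hj,
      hS.ne (by decide) (by norm_num) (by norm_num) hi hj,
      hS.ne (by decide) (by norm_num) (by norm_num) hi hj⟩
  exact ⟨relHom_windowSwap_two h (by decide) (by decide) (by decide) (by decide),
    relHom_windowSwap_two h (by decide) (by decide) (by decide) (by decide)⟩

theorem relHom_p123645 {S : Finset ℕ} (hS : GoodGaps p123645 S) :
    RelHom p123645 p124635 S (windowSwap 2 S) ∧ RelHom p124635 p123645 S (windowSwap 2 S) := by
  have h : ∀ i ∈ S, ∀ j ∈ S, j ≠ i + 1 ∧ j ≠ i + 2 ∧ j ≠ i + 3 := fun i hi j hj =>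
    ⟨hS.ne (by decide) (by norm_num) (by norm_num) hi hj,
      hS.ne (by decide) (by norm_num) (by norm_num) hi hj,
      hS.ne (by decide) (by norm_num) (by norm_num) hi hj⟩
  exact ⟨relHom_windowSwap_two h (by decide) (by decide) (by decide) (by decide),
    relHom_windowSwap_two h (by decide) (by decide) (by decide) (by decide)⟩

theorem relHom_p132465 {S : Finset ℕ} (hS : GoodGaps p132465 S) :
    RelHom p132465 p142365 S (windowSwap 1 S) ∧ RelHom p142365 p132465 S (windowSwap 1 S) := by
  have h : ∀ i ∈ S, ∀ j ∈ S, j ≠ i + 1 ∧ j ≠ i + 2 ∧ j ≠ i + 4 := fun i hi j hj =>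
    ⟨hS.ne (by decide) (by norm_num) (by norm_num) hi hj,
      hS.ne (by decide) (by norm_num) (by norm_num) hi hj,
      hS.ne (by decide) (by norm_num) (by norm_num) hi hj⟩
  exact ⟨relHom_windowSwap_one h (by decide) (by decide) (by decide) (by decide) (by decide)
      (by decide) (by decide) (by decide) (by decide),
    relHom_windowSwap_one h (by decide) (by decide) (by decide) (by decide) (by decide)
      (by decide) (by decide) (by decide) (by decide)⟩

theorem P_p123546_eq : P p123546 = P p124536 :=
  P_eq_of_windowSwap (p := 2) (by norm_num) (overlapSet_eq (by decide)) (by decide)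
    fun _ => relHom_p123546

theorem P_p123645_eq : P p123645 = P p124635 :=
  P_eq_of_windowSwap (p := 2) (by norm_num) (overlapSet_eq (by decide)) (by decide)
    fun _ => relHom_p123645

theorem P_p132465_eq : P p132465 = P p142365 :=
  P_eq_of_windowSwap (p := 1) (by norm_num) (overlapSet_eq (by decide)) (by decide)
    fun _ => relHom_p132465

theorem three_le_of_mem_overlapSet {σ : Equiv.Perm (Fin 6)}
    (h : ∀ d < 6, d ∈ overlapSet σ → 3 ≤ d) : ∀ d ∈ overlapSet σ, 3 ≤ d :=
  fun d hd => h d hd.2.1 hd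

theorem clusterPosetsIso_p123645 {n k : ℕ} {i : Fin k → ℕ} (hi : i ∈ indexTuples p123645 n k) :
    ClusterPosetsIso p123645 p124635 n i i :=
  clusterPosetsIso_of_windowSwap (p := 2) (by norm_num) (by decide)
    (three_le_of_mem_overlapSet (by decide)) (fun _ => relHom_p123645) hi

theorem clusterPosetsIso_p132465 {n k : ℕ} {i : Fin k → ℕ} (hi : i ∈ indexTuples p132465 n k) :
    ClusterPosetsIso p132465 p142365 n i i :=
  clusterPosetsIso_of_windowSwap (p := 1) (by norm_num) (by decide)
    (three_le_of_mem_overlapSet (by decide)) (fun _ => relHom_p132465) hi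


/-! ### The patterns 154263 and 165243: cluster posets as trees -/

/-- The two patterns `154263` and `165243`. -/
def forkPattern : Bool → Equiv.Perm (Fin 6)
  | true => p154263
  | false => p165243

/-- The positions of the marked occurrences in a cluster whose adjacent marked occurrences are at
distance `5` (`true`) or `3` (`false`). -/
def forkStarts : List Bool → Finset ℕ
  | [] => {0}
  | true :: L => insert 0 ((forkStarts L).image (· + 5))
  | false :: L => insert 0 ((forkStarts L).image (· + 3))

/-- The length of a cluster. -/
def forkLength : List Bool → ℕ
  | [] => 6
  | true :: L => forkLength L + 5
  | false :: L => forkLength L + 3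

/-- The cluster posets of `154263` and `165243` are trees, made up of a spine, with levels
`0, …, spineTop L`, and of chains of `tailLength L l` further elements above the level `l`. The
element number `t` of the chain above the level `l` of the spine is denoted by `(l, t)`, where
`(l, 0)` is the level itself. -/
def spineTop : List Bool → ℕ
  | [] => 2
  | true :: L => spineTop L + 2
  | false :: L => spineTop L + 1

/-- The lowest level with a nonempty tail. -/
def firstFork : List Bool → ℕ
  | [] => 2
  | true :: _ => 2
  | false :: L => firstFork L + 1

/-- The number of elements of the tail above a given level. -/
def tailLength : List Bool → ℕ → ℕ
  | [], l => if l = 2 then 3 else 0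
  | true :: L, l => if l = 2 then 3 else if l < 2 then 0 else tailLength L (l - 2)
  | false :: L, l => if l = 0 then 0 else
      tailLength L (l - 1) + if l = firstFork L + 1 then 2 else 0

/-- The elements of the tree. -/
def InTree (L : List Bool) (v : ℕ × ℕ) : Prop := v.1 ≤ spineTop L ∧ v.2 ≤ tailLength L v.1

/-- The strict order of the tree. -/
def TreeLT (v w : ℕ × ℕ) : Prop := v.2 = 0 ∧ v.1 < w.1 ∨ v.1 = w.1 ∧ v.2 < w.2

instance (v w : ℕ × ℕ) : Decidable (TreeLT v w) := by unfold TreeLT; infer_instance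

/-- The elements of the tree which correspond to the positions in a single window. -/
def windowVertex : Bool → ℕ → ℕ × ℕ
  | _, 0 => (0, 0)
  | true, 1 => (2, 2)
  | true, 2 => (2, 1)
  | true, 4 => (2, 3)
  | false, 1 => (2, 3)
  | false, 2 => (2, 2)
  | false, 4 => (2, 1)
  | _, 3 => (1, 0)
  | _, _ => (2, 0)

/-- The place in the first tail after which the two new elements are inserted when a window is put
in front of a cluster, at distance `3`. -/
def insertPlace (β : Bool) : List Bool → ℕ
  | [] => if β then 1 else 3
  | true :: _ => if β then 1 else 3
  | false :: L => insertPlace β L + if β then 1 else 2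

/-- The element of the tree which corresponds to a position of the cluster. -/
def vertex (β : Bool) : List Bool → ℕ → ℕ × ℕ
  | [], x => windowVertex β x
  | true :: L, x => if x < 5 then windowVertex β x else
      ((vertex β L (x - 5)).1 + 2, (vertex β L (x - 5)).2)
  | false :: L, x =>
      if x = 0 then (0, 0)
      else if x = 1 then (firstFork L + 1, insertPlace β L + 2)
      else if x = 2 then (firstFork L + 1, insertPlace β L + 1)
      else ((vertex β L (x - 3)).1 + 1,
        if (vertex β L (x - 3)).1 = firstFork L ∧ insertPlace β L < (vertex β L (x - 3)).2
        then (vertex β L (x - 3)).2 + 2 else (vertex β L (x - 3)).2)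

theorem TreeLT.trans {u v w : ℕ × ℕ} (h : TreeLT u v) (h' : TreeLT v w) : TreeLT u w := by
  unfold TreeLT at *
  omega

theorem TreeLT.irrefl (v : ℕ × ℕ) : ¬ TreeLT v v := by
  unfold TreeLT
  omega

theorem vertex_add_five (β : Bool) (L : List Bool) (x : ℕ) :
    vertex β (true :: L) (x + 5) = ((vertex β L x).1 + 2, (vertex β L x).2) := by
  rw [vertex, if_neg (by omega), Nat.add_sub_cancel]

theorem vertex_add_three (β : Bool) (L : List Bool) (x : ℕ) :
    vertex β (false :: L) (x + 3) = ((vertex β L x).1 + 1,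
      if (vertex β L x).1 = firstFork L ∧ insertPlace β L < (vertex β L x).2
        then (vertex β L x).2 + 2 else (vertex β L x).2) := by
  rw [vertex, if_neg (by omega), if_neg (by omega), if_neg (by omega), Nat.add_sub_cancel]

theorem vertex_zero (β : Bool) (L : List Bool) : vertex β L 0 = (0, 0) := by
  rcases L with _ | ⟨_ | _, L⟩ <;> rfl

theorem six_le_forkLength (L : List Bool) : 6 ≤ forkLength L := by
  induction L with
  | nil => exact le_rfl
  | cons b L ih => cases b <;> simp only [forkLength] <;> omega

theorem two_le_firstFork (L : List Bool) : 2 ≤ firstFork L := by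
  induction L with
  | nil => exact le_rfl
  | cons b L ih => cases b <;> simp only [firstFork] <;> omega

theorem firstFork_le_spineTop (L : List Bool) : firstFork L ≤ spineTop L := by
  induction L with
  | nil => exact le_rfl
  | cons b L ih => cases b <;> simp only [firstFork, spineTop] <;> omega

theorem tailLength_of_lt_two (L : List Bool) {l : ℕ} (hl : l < 2) : tailLength L l = 0 := by
  induction L generalizing l with
  | nil => simp only [tailLength]; rw [if_neg (by omega)]
  | cons b L ih =>
    have := two_le_firstFork L
    cases b
    · simp only [tailLength]
      split_ifs with h h'
      · rfl
      · omega
      · rw [ih (by omega)]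
    · simp only [tailLength]
      rw [if_neg (by omega), if_pos hl]

theorem insertPlace_le (β : Bool) (L : List Bool) :
    0 < insertPlace β L ∧ insertPlace β L ≤ tailLength L (firstFork L) ∧
      (β = false → insertPlace β L = tailLength L (firstFork L)) := by
  induction L with
  | nil => cases β <;> simp [insertPlace, tailLength, firstFork]
  | cons b L ih =>
    cases b
    · simp only [insertPlace, tailLength, firstFork, Nat.add_sub_cancel, if_true,
        if_neg (Nat.succ_ne_zero _)]
      cases β <;> simp at ih ⊢ <;> omega
    · cases β <;> simp [insertPlace, tailLength, firstFork]

/-- The position in the first window which corresponds to the insertion place. -/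
def insertPosition (β : Bool) : ℕ := if β then 2 else 1

theorem vertex_insertPosition (β : Bool) (L : List Bool) :
    vertex β L (insertPosition β) = (firstFork L, insertPlace β L) := by
  rcases L with _ | ⟨_ | _, L⟩ <;> cases β <;> rfl

/-- Locates the places 1 and 2 of the first window in its tail. For 154263 they are consecutive with
place 2 lower and the insertion point between them; for 165243 place 1 is the upper one and the
insertion point follows it. -/
theorem vertex_one_two (β : Bool) (L : List Bool) :
    vertex β L 1 = (firstFork L, insertPlace β L + if β then 1 else 0) ∧
      vertex β L 2 = (firstFork L, insertPlace β L - if β then 0 else 1) := by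
  rcases L with _ | ⟨_ | _, L⟩ <;> cases β <;> exact ⟨rfl, rfl⟩

theorem inTree_vertex (β : Bool) (L : List Bool) {x : ℕ} (hx : x < forkLength L) :
    InTree L (vertex β L x) := by
  induction L generalizing x with
  | nil =>
    simp only [forkLength] at hx
    unfold InTree
    revert x β
    decide
  | cons b L ih =>
    cases b
    · simp only [forkLength] at hx
      have h1 := insertPlace_le β L
      have h2 := firstFork_le_spineTop L
      obtain rfl | rfl | rfl | ⟨y, rfl⟩ : x = 0 ∨ x = 1 ∨ x = 2 ∨ ∃ y, x = y + 3 := by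
        rcases x with _ | _ | _ | y
        · simp
        · simp
        · simp
        · exact Or.inr (Or.inr (Or.inr ⟨y, rfl⟩))
      · rw [vertex_zero]
        exact ⟨Nat.zero_le _, Nat.zero_le _⟩
      · simp only [InTree, vertex, spineTop, tailLength]
        simp
        omega
      · simp only [InTree, vertex, spineTop, tailLength]
        simp
        omega
      · have := ih (x := y) (by omega)
        rw [vertex_add_three]
        simp only [InTree, spineTop, tailLength, Nat.add_sub_cancel, if_neg (Nat.succ_ne_zero _),
          add_left_inj] at this ⊢
        split_ifs <;> omega
    · simp only [forkLength] at hx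
      by_cases h5 : x < 5
      · rw [vertex, if_pos h5]
        have : (windowVertex β x).1 ≤ 2 ∧
            (windowVertex β x).2 ≤ if (windowVertex β x).1 = 2 then 3 else 0 := by
          have h : ∀ β : Bool, ∀ x < 5, (windowVertex β x).1 ≤ 2 ∧
            (windowVertex β x).2 ≤ if (windowVertex β x).1 = 2 then 3 else 0 := by decide
          exact h β x h5
        simp only [InTree, spineTop, tailLength]
        refine ⟨by omega, this.2.trans ?_⟩
        split_ifs <;> omega
      · obtain ⟨y, rfl⟩ := Nat.exists_eq_add_of_le' (not_lt.1 h5)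
        have := ih (x := y) (by omega)
        have h0 := tailLength_of_lt_two L (l := 0) (by norm_num)
        rw [vertex_add_five]
        simp only [InTree, spineTop, tailLength, Nat.add_sub_cancel] at this ⊢
        refine ⟨by omega, ?_⟩
        by_cases hl : (vertex β L y).1 = 0
        · rw [hl] at this ⊢
          simp only [zero_add, if_true]
          omega
        · rw [if_neg (by omega), if_neg (by omega)]
          exact this.2

theorem exists_vertex_eq (β : Bool) (L : List Bool) {v : ℕ × ℕ} (hv : InTree L v) :
    ∃ x < forkLength L, vertex β L x = v := by
  induction L generalizing v with
  | nil =>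
    obtain ⟨l, t⟩ := v
    simp only [InTree, spineTop, tailLength] at hv
    have ht : t ≤ 3 := hv.2.trans (by split_ifs <;> omega)
    have h : ∀ β : Bool, ∀ l ≤ 2, ∀ t ≤ 3, (t ≤ if l = 2 then 3 else 0) →
        ∃ x < 6, windowVertex β x = (l, t) := by decide
    exact h β l hv.1 t ht hv.2
  | cons b L ih =>
    obtain ⟨l, t⟩ := v
    cases b
    · simp only [InTree, spineTop, tailLength, forkLength] at hv ⊢
      rcases l with _ | l
      · rw [if_pos rfl] at hv
        refine ⟨0, by omega, ?_⟩
        rw [vertex_zero]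
        ext <;> simp; omega
      · rw [if_neg (Nat.succ_ne_zero l), Nat.add_sub_cancel] at hv
        simp only [add_left_inj] at hv
        have h6 := six_le_forkLength L
        have h1 := insertPlace_le β L
        by_cases hl : l = firstFork L
        · rw [if_pos hl] at hv
          by_cases ht1 : t = insertPlace β L + 1
          · exact ⟨2, by omega, by simp [vertex, hl, ht1]⟩
          by_cases ht2 : t = insertPlace β L + 2
          · exact ⟨1, by omega, by simp [vertex, hl, ht2]⟩
          by_cases ht : t ≤ insertPlace β L
          · obtain ⟨x, hx, he⟩ := ih (v := (l, t)) ⟨by omega, by simp only [hl]; omega⟩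
            refine ⟨x + 3, by omega, ?_⟩
            rw [vertex_add_three, he, if_neg (by simp only; omega)]
          · obtain ⟨x, hx, he⟩ := ih (v := (l, t - 2)) ⟨by simp only; omega, by simp only; omega⟩
            refine ⟨x + 3, by omega, ?_⟩
            rw [vertex_add_three, he, if_pos (by simp only; omega)]
            ext <;> simp only; omega
        · rw [if_neg hl] at hv
          obtain ⟨x, hx, he⟩ := ih (v := (l, t)) ⟨by simp only; omega, by simp only; omega⟩
          refine ⟨x + 3, by omega, ?_⟩
          rw [vertex_add_three, he, if_neg (by simp only; omega)]
    · simp only [InTree, spineTop, tailLength, forkLength] at hv ⊢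
      have h6 := six_le_forkLength L
      by_cases hl : 2 < l
      · rw [if_neg (by omega), if_neg (by omega)] at hv
        obtain ⟨x, hx, he⟩ := ih (v := (l - 2, t)) ⟨by simp only; omega, hv.2⟩
        refine ⟨x + 5, by omega, ?_⟩
        rw [vertex_add_five, he]
        ext <;> simp only; omega
      · have hle : t ≤ if l = 2 then 3 else 0 := by
          split_ifs at hv ⊢ <;> omega
        have ht : t ≤ 3 := hle.trans (by split_ifs <;> omega)
        have h : ∀ β : Bool, ∀ l ≤ 2, ∀ t ≤ 3, (t ≤ if l = 2 then 3 else 0) →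
            ∃ x ≤ 5, windowVertex β x = (l, t) := by decide
        obtain ⟨x, hx, he⟩ := h β l (by omega) t ht hle
        refine ⟨x, by omega, ?_⟩
        rcases hx.lt_or_eq with hx | rfl
        · rw [vertex, if_pos hx, he]
        · rw [← he]
          change ((vertex β L 0).1 + 2, (vertex β L 0).2) = _
          rw [vertex_zero]
          rfl

theorem treeLT_windowVertex_iff : ∀ β : Bool, ∀ a < 6, ∀ b < 6,
    TreeLT (windowVertex β a) (windowVertex β b) ↔
      entry (forkPattern β) a < entry (forkPattern β) b := by
  decide

theorem vertex_true_cons_of_lt (β : Bool) (L : List Bool) {x : ℕ} (hx : x < 6) :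
    vertex β (true :: L) x = windowVertex β x := by
  by_cases h : x < 5
  · rw [vertex, if_pos h]
  · obtain rfl : x = 5 := by omega
    change ((vertex β L 0).1 + 2, (vertex β L 0).2) = _
    rw [vertex_zero]
    rfl

/-- At distance 3 the places 3, 4, 5 of the new window are the places 0, 1, 2 of the old one. The
new places 1 and 2 enter the old tail exactly where the pattern wants them relative to 4 and 5:
between these for 154263, above both for 165243. -/
theorem treeLT_vertex_false_cons (β : Bool) (L : List Bool) {a b : ℕ} (ha : a < 6) (hb : b < 6)
    (h : entry (forkPattern β) a < entry (forkPattern β) b) :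
    TreeLT (vertex β (false :: L) a) (vertex β (false :: L) b) := by
  have h1 := (vertex_one_two β L).1
  have h2 := (vertex_one_two β L).2
  have h3 := insertPlace_le β L
  have h4 := two_le_firstFork L
  have v0 : vertex β (false :: L) 0 = (0, 0) := rfl
  have v1 : vertex β (false :: L) 1 = (firstFork L + 1, insertPlace β L + 2) := rfl
  have v2 : vertex β (false :: L) 2 = (firstFork L + 1, insertPlace β L + 1) := rfl
  have v3 : vertex β (false :: L) 3 = (1, 0) := by
    rw [vertex_add_three β L 0, vertex_zero]
    simp
  have v4 : vertex β (false :: L) 4 = (firstFork L + 1, insertPlace β L + if β then 3 else 0) := by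
    rw [vertex_add_three β L 1, h1]
    cases β <;> simp
  have v5 : vertex β (false :: L) 5 = (firstFork L + 1, insertPlace β L - if β then 0 else 1) := by
    rw [vertex_add_three β L 2, h2]
    simp only [true_and]
    rw [if_neg (by omega)]
  rw [← treeLT_windowVertex_iff β a ha b hb] at h
  cases β <;> interval_cases a <;> interval_cases b <;>
    simp [TreeLT, windowVertex] at h <;>
    simp only [v0, v1, v2, v3, v4, v5, TreeLT] <;> simp at h3 ⊢ <;> omega


/-- The distance of adjacent marked occurrences. -/
def forkStep (b : Bool) : ℕ := if b then 5 else 3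

theorem forkStarts_cons (b : Bool) (L : List Bool) :
    forkStarts (b :: L) = insert 0 ((forkStarts L).image (· + forkStep b)) := by
  cases b <;> rfl

theorem forkLength_cons (b : Bool) (L : List Bool) :
    forkLength (b :: L) = forkLength L + forkStep b := by
  cases b <;> rfl

/-- Prepending a window raises the levels uniformly and spreads at most one tail apart to make room,
so it is an order embedding of the old tree. -/
theorem treeLT_vertex_add_iff (β b : Bool) (L : List Bool) (x y : ℕ) :
    TreeLT (vertex β (b :: L) (x + forkStep b)) (vertex β (b :: L) (y + forkStep b)) ↔
      TreeLT (vertex β L x) (vertex β L y) := by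
  cases b
  · change TreeLT (vertex β (false :: L) (x + 3)) (vertex β (false :: L) (y + 3)) ↔ _
    rw [vertex_add_three, vertex_add_three]
    simp only [TreeLT]
    generalize vertex β L x = v, vertex β L y = w
    by_cases h1 : v.1 = firstFork L ∧ insertPlace β L < v.2
    · rw [if_pos h1]
      by_cases h2 : w.1 = firstFork L ∧ insertPlace β L < w.2
      · rw [if_pos h2]
        omega
      · rw [if_neg h2]
        omega
    · rw [if_neg h1]
      by_cases h2 : w.1 = firstFork L ∧ insertPlace β L < w.2
      · rw [if_pos h2]
        omega
      · rw [if_neg h2]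
        omega
  · change TreeLT (vertex β (true :: L) (x + 5)) (vertex β (true :: L) (y + 5)) ↔ _
    rw [vertex_add_five, vertex_add_five]
    simp only [TreeLT]
    omega

theorem treeLT_vertex_window (β : Bool) (L : List Bool) {a b : ℕ} (ha : a < 6) (hb : b < 6)
    (h : entry (forkPattern β) a < entry (forkPattern β) b) :
    TreeLT (vertex β L a) (vertex β L b) := by
  rcases L with _ | ⟨_ | _, L⟩
  · exact (treeLT_windowVertex_iff β a ha b hb).2 h
  · exact treeLT_vertex_false_cons β L ha hb h
  · rw [vertex_true_cons_of_lt β L ha, vertex_true_cons_of_lt β L hb]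
    exact (treeLT_windowVertex_iff β a ha b hb).2 h

theorem treeLT_of_rel (β : Bool) (L : List Bool) {x y : ℕ}
    (h : rel (forkPattern β) (forkStarts L) x y) : TreeLT (vertex β L x) (vertex β L y) := by
  induction L generalizing x y with
  | nil =>
    obtain ⟨i, hi, h1, h2, h3, h4, h5⟩ := rel_iff.1 h
    obtain rfl : i = 0 := Finset.mem_singleton.1 hi
    exact treeLT_vertex_window β [] h2 h4 h5
  | cons b L ih =>
    obtain ⟨i, hi, h1, h2, h3, h4, h5⟩ := rel_iff.1 h
    rw [forkStarts_cons] at hi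
    rcases Finset.mem_insert.1 hi with rfl | hi
    · exact treeLT_vertex_window β (b :: L) (by omega) (by omega) h5
    · obtain ⟨j, hj, rfl⟩ := Finset.mem_image.1 hi
      obtain ⟨x, rfl⟩ : ∃ x', x = x' + forkStep b := ⟨x - forkStep b, by omega⟩
      obtain ⟨y, rfl⟩ : ∃ y', y = y' + forkStep b := ⟨y - forkStep b, by omega⟩
      rw [treeLT_vertex_add_iff]
      refine ih (rel_iff.2 ⟨j, hj, by omega, by omega, by omega, by omega, ?_⟩)
      rwa [Nat.add_sub_add_right, Nat.add_sub_add_right] at h5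

theorem treeLT_of_transGen (β : Bool) (L : List Bool) {x y : ℕ}
    (h : Relation.TransGen (rel (forkPattern β) (forkStarts L)) x y) :
    TreeLT (vertex β L x) (vertex β L y) := by
  induction h with
  | single h => exact treeLT_of_rel β L h
  | tail _ h ih => exact ih.trans (treeLT_of_rel β L h)

theorem zero_mem_forkStarts (L : List Bool) : 0 ∈ forkStarts L := by
  rcases L with _ | ⟨_ | _, L⟩ <;> simp [forkStarts]

theorem transGen_cons (β b : Bool) (L : List Bool) {x y : ℕ}
    (h : Relation.TransGen (rel (forkPattern β) (forkStarts L)) x y) :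
    Relation.TransGen (rel (forkPattern β) (forkStarts (b :: L))) (x + forkStep b)
      (y + forkStep b) := by
  have key : ∀ {x y}, rel (forkPattern β) (forkStarts L) x y →
      rel (forkPattern β) (forkStarts (b :: L)) (x + forkStep b) (y + forkStep b) := by
    intro x y h
    obtain ⟨i, hi, h⟩ := (rel_image_add _ _ (forkStep b) x y).2 h
    rw [forkStarts_cons]
    exact ⟨i, Finset.mem_insert_of_mem hi, h⟩
  induction h with
  | single h => exact Relation.TransGen.single (key h)
  | tail _ h ih => exact ih.tail (key h)

theorem rel_first_window (β : Bool) (L : List Bool) {a b : ℕ} (ha : a < 6) (hb : b < 6)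
    (h : entry (forkPattern β) a < entry (forkPattern β) b) :
    rel (forkPattern β) (forkStarts L) a b := by
  have := rel_window (zero_mem_forkStarts L) ha hb h
  rwa [zero_add, zero_add] at this

theorem vertex_add_eq_iff (β b : Bool) (L : List Bool) (x y : ℕ) :
    vertex β (b :: L) (x + forkStep b) = vertex β (b :: L) (y + forkStep b) ↔
      vertex β L x = vertex β L y := by
  cases b
  · change vertex β (false :: L) (x + 3) = vertex β (false :: L) (y + 3) ↔ _
    rw [vertex_add_three, vertex_add_three, Prod.ext_iff, Prod.ext_iff]
    simp only
    split_ifs with h1 h2 h2 <;> constructor <;> rintro ⟨h, h'⟩ <;> constructor <;> omega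
  · change vertex β (true :: L) (x + 5) = vertex β (true :: L) (y + 5) ↔ _
    rw [vertex_add_five, vertex_add_five, Prod.ext_iff, Prod.ext_iff]
    simp only
    omega

theorem vertex_true_cons_cases (β : Bool) (L : List Bool) {x : ℕ} (hx : x < 5) :
    (entry (forkPattern β) x < entry (forkPattern β) 5 ∧ (vertex β (true :: L) x).1 < 2) ∨
    (entry (forkPattern β) 5 < entry (forkPattern β) x ∧ (vertex β (true :: L) x).1 = 2 ∧
      0 < (vertex β (true :: L) x).2) := by
  rw [vertex_true_cons_of_lt β L (by omega)]
  have h : ∀ β : Bool, ∀ x < 5,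
      (entry (forkPattern β) x < entry (forkPattern β) 5 ∧ (windowVertex β x).1 < 2) ∨
      (entry (forkPattern β) 5 < entry (forkPattern β) x ∧ (windowVertex β x).1 = 2 ∧
        0 < (windowVertex β x).2) := by decide
  exact h β x hx

theorem vertex_true_cons_add_five (β : Bool) (L : List Bool) {y : ℕ} (hy : y < forkLength L) :
    2 ≤ (vertex β (true :: L) (y + 5)).1 ∧ ((vertex β (true :: L) (y + 5)).1 = 2 →
      (vertex β (true :: L) (y + 5)).2 = 0 ∧ vertex β L y = (0, 0)) := by
  rw [vertex_add_five]
  refine ⟨by simp only; omega, fun h => ?_⟩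
  have h0 : (vertex β L y).1 = 0 := by simp only at h; omega
  have h1 := (inTree_vertex β L hy).2
  rw [h0, tailLength_of_lt_two L (by norm_num)] at h1
  have h2 : (vertex β L y).2 = 0 := by omega
  exact ⟨h2, Prod.ext h0 h2⟩

theorem vertex_false_cons_cases (β : Bool) (L : List Bool) {y : ℕ} :
    0 < (vertex β (false :: L) (y + 3)).1 ∧
      (vertex β (false :: L) (y + 3) ≠ (firstFork L + 1, insertPlace β L + 1)) ∧
      (vertex β (false :: L) (y + 3) ≠ (firstFork L + 1, insertPlace β L + 2)) := by
  rw [vertex_add_three, Ne, Ne, Prod.ext_iff, Prod.ext_iff]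
  simp only
  split_ifs <;> omega

theorem vertex_injective (β : Bool) (L : List Bool) {x y : ℕ} (hx : x < forkLength L)
    (hy : y < forkLength L) (h : vertex β L x = vertex β L y) : x = y := by
  induction L generalizing x y with
  | nil =>
    have key : ∀ β : Bool, ∀ x < 6, ∀ y < 6, windowVertex β x = windowVertex β y → x = y := by
      decide
    exact key β x hx y hy h
  | cons b L ih =>
    have hold : ∀ {x y}, forkStep b ≤ x → forkStep b ≤ y → x < forkLength (b :: L) →
        y < forkLength (b :: L) → vertex β (b :: L) x = vertex β (b :: L) y → x = y := by
      intro x y hx5 hy5 hx hy h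
      obtain ⟨x, rfl⟩ := Nat.exists_eq_add_of_le' hx5
      obtain ⟨y, rfl⟩ := Nat.exists_eq_add_of_le' hy5
      rw [forkLength_cons] at hx hy
      rw [ih (by omega) (by omega) ((vertex_add_eq_iff β b L x y).1 h)]
    have hmix : ∀ {x y}, x < forkStep b → forkStep b ≤ y →
        y < forkLength (b :: L) → vertex β (b :: L) x ≠ vertex β (b :: L) y := by
      intro x y hx hy5 hy h
      obtain ⟨y, rfl⟩ := Nat.exists_eq_add_of_le' hy5
      rw [forkLength_cons] at hy
      cases b
      · have h3 : vertex β (false :: L) x = vertex β (false :: L) (y + 3) := h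
        have h4 := vertex_false_cons_cases β L (y := y)
        have hx : x < 3 := hx
        rw [← h3] at h4
        interval_cases x
        · exact absurd h4.1 (lt_irrefl _)
        · exact h4.2.2 rfl
        · exact h4.2.1 rfl
      · have h3 : vertex β (true :: L) x = vertex β (true :: L) (y + 5) := h
        have h4 := vertex_true_cons_add_five β L (y := y) (by omega)
        rw [← h3] at h4
        rcases vertex_true_cons_cases β L hx with h5 | h5
        · omega
        · have := (h4.2 h5.2.1).1
          omega
    by_cases hx5 : forkStep b ≤ x
    · by_cases hy5 : forkStep b ≤ y
      · exact hold hx5 hy5 hx hy h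
      · exact absurd h.symm (hmix (not_le.1 hy5) hx5 hx)
    · by_cases hy5 : forkStep b ≤ y
      · exact absurd h (hmix (not_le.1 hx5) hy5 hy)
      · rw [not_le] at hx5 hy5
        cases b
        · have hx5 : x < 3 := hx5
          have hy5 : y < 3 := hy5
          interval_cases x <;> interval_cases y <;> first
            | rfl
            | (simp [vertex] at h)
        · have hx5 : x < 5 := hx5
          have hy5 : y < 5 := hy5
          rw [vertex_true_cons_of_lt β L (by omega), vertex_true_cons_of_lt β L (by omega)] at h
          have key : ∀ β : Bool, ∀ x < 6, ∀ y < 6,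
            windowVertex β x = windowVertex β y → x = y := by decide
          exact key β x (by omega) y (by omega) h

/-- Any two comparable elements of the tree are comparable in the cluster poset. -/
theorem transGen_of_treeLT (β : Bool) (L : List Bool) {x y : ℕ} (hx : x < forkLength L)
    (hy : y < forkLength L) (h : TreeLT (vertex β L x) (vertex β L y)) :
    Relation.TransGen (rel (forkPattern β) (forkStarts L)) x y := by
  induction L generalizing x y with
  | nil =>
    exact Relation.TransGen.single
      (rel_first_window β [] hx hy ((treeLT_windowVertex_iff β x hx y hy).1 h))
  | cons b L ih =>
    have hwin : ∀ {x y}, x < 6 → y < 6 → entry (forkPattern β) x < entry (forkPattern β) y →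
        Relation.TransGen (rel (forkPattern β) (forkStarts (b :: L))) x y :=
      fun hx hy h => Relation.TransGen.single (rel_first_window β _ hx hy h)
    have hle : ∀ {x y}, x < forkLength L → y < forkLength L →
        vertex β L x = vertex β L y ∨ TreeLT (vertex β L x) (vertex β L y) →
        Relation.ReflTransGen (rel (forkPattern β) (forkStarts (b :: L))) (x + forkStep b)
          (y + forkStep b) := by
      intro x y hx hy h
      rcases h with h | h
      · rw [vertex_injective β L hx hy h]
      · exact (transGen_cons β b L (ih hx hy h)).to_reflTransGen
    have hroot : ∀ {y}, y < forkLength L →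
        Relation.ReflTransGen (rel (forkPattern β) (forkStarts (b :: L))) (forkStep b)
          (y + forkStep b) := by
      intro y hy
      have h6 := six_le_forkLength L
      have := hle (x := 0) (y := y) (by omega) hy (by
        rw [vertex_zero, Prod.ext_iff, TreeLT]
        have := (inTree_vertex β L hy).2
        by_cases h0 : (vertex β L y).1 = 0
        · rw [h0, tailLength_of_lt_two L (by norm_num)] at this
          simp only
          omega
        · exact Or.inr (Or.inl ⟨rfl, Nat.pos_of_ne_zero h0⟩))
      rwa [zero_add] at this
    rw [forkLength_cons] at hx hy
    have h6 := six_le_forkLength L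
    by_cases hx5 : forkStep b ≤ x
    · obtain ⟨x, rfl⟩ := Nat.exists_eq_add_of_le' hx5
      by_cases hy5 : forkStep b ≤ y
      · obtain ⟨y, rfl⟩ := Nat.exists_eq_add_of_le' hy5
        exact transGen_cons β b L (ih (by omega) (by omega) ((treeLT_vertex_add_iff β b L x y).1 h))
      · rw [not_le] at hy5
        cases b
        · have hy5 : y < 3 := hy5
          have h : TreeLT (vertex β (false :: L) (x + 3)) (vertex β (false :: L) y) := h
          -- An old element below one of the two inserted ones lies at or below the insertion place,
          -- which belongs to an old position; that position is also in the new window and is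
          -- smaller than both inserted entries.
          have hins : ∀ y, y = 1 ∨ y = 2 →
              TreeLT (vertex β (false :: L) (x + 3)) (vertex β (false :: L) y) →
              Relation.TransGen (rel (forkPattern β) (forkStarts (false :: L))) (x + 3) y := by
            intro y hy h
            have hxi := hle (x := x) (y := insertPosition β) (by omega)
              (by cases β <;> simp [insertPosition] <;> omega) (by
                rw [vertex_insertPosition, Prod.ext_iff, TreeLT]
                rw [vertex_add_three] at h
                simp only [TreeLT] at h ⊢
                have h1 : (vertex β (false :: L) y).1 = firstFork L + 1 := by
                  rcases hy with rfl | rfl <;> rfl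
                have h2 : (vertex β (false :: L) y).2 ≤ insertPlace β L + 2 := by
                  rcases hy with rfl | rfl <;> simp [vertex]
                have h3 : vertex β (false :: L) (x + 3) ≠ vertex β (false :: L) y := by
                  rcases hy with rfl | rfl
                  · exact (vertex_false_cons_cases β L).2.2
                  · exact (vertex_false_cons_cases β L).2.1
                split_ifs at h <;> omega)
            refine Relation.TransGen.trans_right hxi ?_
            have hw : ∀ β : Bool, ∀ y, y = 1 ∨ y = 2 → insertPosition β + forkStep false < 6 ∧
                entry (forkPattern β) (insertPosition β + forkStep false) <
                  entry (forkPattern β) y := by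
              rintro β y (rfl | rfl) <;> cases β <;> decide
            exact hwin (hw β y hy).1 (by omega) (hw β y hy).2
          interval_cases y
          · rw [vertex_zero] at h
            simp [TreeLT] at h
          · exact hins 1 (Or.inl rfl) h
          · exact hins 2 (Or.inr rfl) h
        · have hy5 : y < 5 := hy5
          have h : TreeLT (vertex β (true :: L) (x + 5)) (vertex β (true :: L) y) := h
          have h1 := vertex_true_cons_add_five β L (y := x) (by omega)
          rcases vertex_true_cons_cases β L hy5 with h2 | h2
          -- The places of the first window below level 2 cannot lie above old elements; for places
          -- in the new tail, the only old element below is the start of the old cluster.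
          · unfold TreeLT at h
            omega
          · have hx0 : vertex β L x = vertex β L 0 := by
              rw [vertex_zero]
              unfold TreeLT at h
              exact (h1.2 (by omega)).2
            rw [vertex_injective β L (by omega) (by omega) hx0]
            exact hwin (by decide) (by omega) h2.1
    · rw [not_le] at hx5
      by_cases hy5 : forkStep b ≤ y
      · obtain ⟨y, rfl⟩ := Nat.exists_eq_add_of_le' hy5
        cases b
        · have hx5 : x < 3 := hx5
          have h : TreeLT (vertex β (false :: L) x) (vertex β (false :: L) (y + 3)) := h
          have hins : ∀ x, x = 1 ∨ x = 2 →
              TreeLT (vertex β (false :: L) x) (vertex β (false :: L) (y + 3)) →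
              Relation.TransGen (rel (forkPattern β) (forkStarts (false :: L))) x (y + 3) := by
            intro x hx h
            have h1 : (vertex β (false :: L) x).1 = firstFork L + 1 := by
              rcases hx with rfl | rfl <;> rfl
            have h2 : insertPlace β L + 1 ≤ (vertex β (false :: L) x).2 := by
              rcases hx with rfl | rfl <;> simp [vertex]
            have hv : (vertex β L y).1 = firstFork L ∧ insertPlace β L < (vertex β L y).2 := by
              rw [vertex_add_three] at h
              simp only [TreeLT] at h
              split_ifs at h with hc
              · exact hc
              · omega
            -- For 165243 the insertion is at the top of the tail, so nothing old lies above the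
            -- inserted elements. For 154263 the next old element above is place 1 of the old
            -- window, which is place 4 of the new one.
            cases β
            · have h3 := (insertPlace_le false L).2.2 rfl
              have h4 := (inTree_vertex false L (x := y) (by omega)).2
              rw [hv.1] at h4
              omega
            · refine Relation.TransGen.trans_left
                (hwin (x := x) (y := 1 + forkStep false) (by omega) (by decide) ?_)
                (hle (by omega) (by omega) ?_)
              · rcases hx with rfl | rfl <;> decide
              · rw [(vertex_one_two true L).1, Prod.ext_iff, TreeLT]
                simp only [if_true]
                omega
          interval_cases x
          · refine Relation.TransGen.trans_left (hwin (x := 0) (y := 3) (by norm_num) (by norm_num) ?_)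
              (hroot (by omega))
            cases β <;> decide
          · exact hins 1 (Or.inl rfl) h
          · exact hins 2 (Or.inr rfl) h
        · have hx5 : x < 5 := hx5
          have h : TreeLT (vertex β (true :: L) x) (vertex β (true :: L) (y + 5)) := h
          have h1 := vertex_true_cons_add_five β L (y := y) (by omega)
          rcases vertex_true_cons_cases β L hx5 with h2 | h2
          · exact Relation.TransGen.trans_left (hwin (x := x) (y := 5) (by omega) (by norm_num) h2.1)
              (hroot (by omega))
          · unfold TreeLT at h
            omega
      · rw [not_le] at hy5
        have hs : forkStep b ≤ 5 := by cases b <;> decide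
        refine hwin (by omega) (by omega) ?_
        by_contra hn
        rcases eq_or_lt_of_le (not_lt.1 hn) with he | hlt
        · have key : ∀ β : Bool, ∀ x < 6, ∀ y < 6, entry (forkPattern β) y = entry (forkPattern β) x →
            x = y := by decide
          rw [key β x (by omega) y (by omega) he] at h
          exact TreeLT.irrefl _ h
        · have := treeLT_vertex_window β (b :: L) (by omega) (by omega) hlt
          exact TreeLT.irrefl _ (this.trans h)


theorem add_six_le_forkLength (L : List Bool) : ∀ i ∈ forkStarts L, i + 6 ≤ forkLength L := by
  induction L with
  | nil => simp [forkStarts, forkLength]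
  | cons b L ih =>
    intro i hi
    rw [forkStarts_cons] at hi
    rw [forkLength_cons]
    rcases Finset.mem_insert.1 hi with rfl | hi
    · have := six_le_forkLength L
      omega
    · obtain ⟨j, hj, rfl⟩ := Finset.mem_image.1 hi
      have := ih j hj
      omega

/-- The positions of a cluster are in bijection with the elements of the tree. -/
noncomputable def treeEquiv (β : Bool) (L : List Bool) :
    Fin (forkLength L) ≃ {v : ℕ × ℕ // InTree L v} :=
  Equiv.ofBijective (fun x => ⟨vertex β L x, inTree_vertex β L x.2⟩)
    ⟨fun x y h => Fin.ext (vertex_injective β L x.2 y.2 (congrArg Subtype.val h)), fun v => by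
      obtain ⟨x, hx, h⟩ := exists_vertex_eq β L v.2
      exact ⟨⟨x, hx⟩, Subtype.ext h⟩⟩

theorem transGen_rel_fin_iff (β : Bool) (L : List Bool) {x y : Fin (forkLength L)} :
    Relation.TransGen (fun x y : Fin (forkLength L) => rel (forkPattern β) (forkStarts L) x y) x y ↔
      TreeLT (treeEquiv β L x) (treeEquiv β L y) :=
  ⟨fun h => treeLT_of_transGen β L (h.lift (fun x : Fin (forkLength L) => (x : ℕ)) fun _ _ h => h),
    fun h => transGen_fin (add_six_le_forkLength L) (transGen_of_treeLT β L x.2 y.2 h)⟩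

/-- The order of the tree. -/
def TreeLE (L : List Bool) (v w : {v : ℕ × ℕ // InTree L v}) : Prop :=
  v = w ∨ TreeLT v w

/-- The cluster posets are isomorphic to the tree. -/
noncomputable def clusterLEIso (β : Bool) (L : List Bool) {k : ℕ} {i : Fin k → ℕ}
    (hi : Finset.univ.image i = forkStarts L) :
    clusterLE (forkPattern β) (forkLength L) i ≃r TreeLE L where
  toEquiv := treeEquiv β L
  map_rel_iff' := by
    intro x y
    have : clusterRel (forkPattern β) (forkLength L) i =
        fun x y : Fin (forkLength L) => rel (forkPattern β) (forkStarts L) x y := by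
      funext x y
      rw [clusterRel_iff, hi]
    rw [TreeLE, clusterLE, Relation.reflTransGen_iff_eq_or_transGen, this, transGen_rel_fin_iff,
      (treeEquiv β L).injective.eq_iff, eq_comm]

theorem markCount_forkPattern (L : List Bool) :
    markCount (forkPattern true) (forkLength L) (forkStarts L) =
      markCount (forkPattern false) (forkLength L) (forkStarts L) := by
  refine markCount_eq_of_iso (add_six_le_forkLength L) (add_six_le_forkLength L)
    ((treeEquiv true L).trans (treeEquiv false L).symm) (fun x y h => ?_) (fun x y h => ?_)
  · rw [transGen_rel_fin_iff]
    simpa using (transGen_rel_fin_iff true L).1 (Relation.TransGen.single h)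
  · rw [transGen_rel_fin_iff]
    simpa using (transGen_rel_fin_iff false L).1 (Relation.TransGen.single h)

theorem mem_overlapSet_forkPattern (β : Bool) {d : ℕ} :
    d ∈ overlapSet (forkPattern β) ↔ d = 3 ∨ d = 5 := by
  have key : ∀ β, ∀ d < 6, d ∈ overlapSet (forkPattern β) ↔ d = 3 ∨ d = 5 := by decide
  constructor
  · exact fun h => (key β d h.2.1).1 h
  · rintro (rfl | rfl) <;> exact (key β _ (by norm_num)).2 (by norm_num)

/-- Since 3 and 5 are the only overlaps, a cluster that can contribute is encoded by its sequence of
distances. -/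
theorem exists_forkStarts (β : Bool) {n : ℕ} (hn : 6 ≤ n) {S : Finset ℕ} (hS : IsCluster n S)
    (hg : GoodGaps (forkPattern β) S) : ∃ L, S = forkStarts L ∧ n = forkLength L := by
  induction n using Nat.strong_induction_on generalizing S with
  | _ n ih =>
    rcases Nat.eq_or_lt_of_le hn with rfl | hn
    · have := mem_clusters.2 hS
      rw [clusters_six, Finset.mem_singleton] at this
      exact ⟨[], this, rfl⟩
    · obtain ⟨d, h1, h5, T, hT, rfl⟩ := hS.exists_cons hn
      have h0 := hT.zero_mem (by omega)
      have hd := hg 0 (Finset.mem_insert_self _ _) d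
        (Finset.mem_insert_of_mem (Finset.mem_image.2 ⟨0, h0, zero_add d⟩)) (by omega) (by omega)
      obtain ⟨L, rfl, hL⟩ := ih (n - d) (by omega) (hT.six_le (by omega)) hT (by
        intro i hi j hj hij hj6
        have := hg (i + d) (Finset.mem_insert_of_mem (Finset.mem_image_of_mem _ hi)) (j + d)
          (Finset.mem_insert_of_mem (Finset.mem_image_of_mem _ hj)) (by omega) (by omega)
        rwa [Nat.add_sub_add_right] at this)
      obtain ⟨b, rfl⟩ : ∃ b, d = forkStep b := by
        rcases (mem_overlapSet_forkPattern β).1 hd with h | h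
        · exact ⟨false, h⟩
        · exact ⟨true, h⟩
      exact ⟨b :: L, (forkStarts_cons b L).symm, by rw [forkLength_cons]; omega⟩

theorem overlapSet_forkPattern (β β' : Bool) :
    overlapSet (forkPattern β) = overlapSet (forkPattern β') :=
  Set.ext fun _ => (mem_overlapSet_forkPattern β).trans (mem_overlapSet_forkPattern β').symm

theorem P_forkPattern : P (forkPattern true) = P (forkPattern false) := by
  refine P_eq_of_markCount_eq fun n S hS => ?_
  by_cases hg : GoodGaps (forkPattern true) S
  · rcases Nat.lt_or_ge n 6 with hn | hn
    · obtain rfl : S = ∅ := Finset.eq_empty_of_forall_notMem fun i hi => by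
        have := hS.1 i hi
        omega
      simp [markCount]
    · obtain ⟨L, rfl, rfl⟩ := exists_forkStarts true hn hS hg
      exact markCount_forkPattern L
  · rw [markCount_eq_zero_of_not_goodGaps hg, markCount_eq_zero_of_not_goodGaps]
    rwa [GoodGaps, overlapSet_forkPattern false true]

theorem isCluster_of_mem_indexTuples {σ : Equiv.Perm (Fin 6)} {n k : ℕ} {i : Fin k → ℕ}
    (hi : i ∈ indexTuples σ n k) : IsCluster n (Finset.univ.image i) := by
  refine ⟨by simpa using add_six_le_of_mem_indexTuples hi, ?_⟩
  obtain ⟨⟨hk, h0, hn⟩, hi⟩ := hi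
  have key : ∀ (j : ℕ) (hj : j < k) (l : ℕ), 0 < l → l < i ⟨j, hj⟩ + 6 →
      ∃ j, i j < l ∧ l < i j + 6 := by
    intro j
    induction j with
    | zero => exact fun hj l h1 h2 => ⟨_, by rw [h0]; exact h1, h2⟩
    | succ j ih =>
      intro hj l h1 h2
      obtain ⟨d, hd, he⟩ := hi j hj
      have := hd.2.1
      rcases lt_or_ge (i ⟨j + 1, hj⟩) l with h | h
      · exact ⟨_, h, h2⟩
      · exact ih (by omega) l h1 (by omega)
  intro l h1 h2
  obtain ⟨j, h⟩ := key (k - 1) (by omega) l h1 (by omega)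
  exact ⟨i j, Finset.mem_image_of_mem i (Finset.mem_univ j), h⟩

theorem exists_forkStarts_of_mem_indexTuples {β : Bool} {n k : ℕ} {i : Fin k → ℕ}
    (hi : i ∈ indexTuples (forkPattern β) n k) :
    ∃ L, Finset.univ.image i = forkStarts L ∧ n = forkLength L := by
  refine exists_forkStarts β ?_ (isCluster_of_mem_indexTuples hi)
    (goodGaps_of_mem_indexTuples hi fun d hd => ?_)
  · obtain ⟨⟨hk, h0, hn⟩, -⟩ := hi
    omega
  · have := (mem_overlapSet_forkPattern β).1 hd
    omega

theorem strictMono_of_mem_indexTuples {σ : Equiv.Perm (Fin 6)} {n k : ℕ} {i : Fin k → ℕ}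
    (hi : i ∈ indexTuples σ n k) : StrictMono i := by
  intro j j' h
  have h' : (j : ℕ) < j' := h
  have := le_of_mem_indexTuples hi (c := 1) (fun d hd => hd.1) j (j' - j) (by omega)
  have e : (⟨j + (j' - j), by omega⟩ : Fin k) = j' := Fin.ext (by simp; omega)
  rw [e] at this
  simp only [Fin.eta] at this
  omega

/-- The relation `r` has an element `x` with `k` elements below it that is the meet of two larger
elements. -/
def HasFork {α : Type*} (r : α → α → Prop) (k : ℕ) : Prop :=
  ∃ x y z, r x y ∧ r x z ∧ x ≠ y ∧ x ≠ z ∧ (∀ w, r w y → r w z → r w x) ∧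
    Nat.card {w // r w x} = k

theorem HasFork.map {α α' : Type*} {r : α → α → Prop} {r' : α' → α' → Prop} (e : r ≃r r') {k : ℕ}
    (h : HasFork r k) : HasFork r' k := by
  obtain ⟨x, y, z, h1, h2, h3, h4, h5, rfl⟩ := h
  refine ⟨e x, e y, e z, e.map_rel_iff.2 h1, e.map_rel_iff.2 h2, e.injective.ne h3,
    e.injective.ne h4, fun w hy hz => ?_, Nat.card_congr ?_⟩
  · obtain ⟨w, rfl⟩ := e.surjective w
    exact e.map_rel_iff.2 (h5 w (e.map_rel_iff.1 hy) (e.map_rel_iff.1 hz))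
  · exact (e.toEquiv.subtypeEquiv fun w => (e.map_rel_iff (a := w) (b := x)).symm).symm

/-- The levels at which the tree branches. -/
def IsForkLevel (L : List Bool) (s : ℕ) : Prop := s < spineTop L ∧ 0 < tailLength L s

theorem treeLE_iff {L : List Bool} {v w : {v : ℕ × ℕ // InTree L v}} : TreeLE L v w ↔
    (v.1.2 = 0 ∧ v.1.1 < w.1.1) ∨ (v.1.1 = w.1.1 ∧ v.1.2 ≤ w.1.2) := by
  rw [TreeLE, TreeLT, Subtype.ext_iff, Prod.ext_iff]
  omega

theorem card_treeLE (L : List Bool) (s : ℕ) (hs : InTree L (s, 0)) :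
    Nat.card {w // TreeLE L w ⟨(s, 0), hs⟩} = s + 1 := by
  have key : ∀ w, TreeLE L w ⟨(s, 0), hs⟩ ↔ w.1.1 ≤ s ∧ w.1.2 = 0 := by
    intro w
    rw [treeLE_iff]
    simp only
    omega
  rw [← Nat.card_fin (s + 1)]
  refine Nat.card_congr ⟨fun w => ⟨w.1.1.1, Nat.lt_succ_of_le ((key w.1).1 w.2).1⟩,
    fun j => ⟨⟨(j, 0), (Nat.le_of_lt_succ j.2).trans hs.1, Nat.zero_le _⟩,
      (key _).2 ⟨Nat.le_of_lt_succ j.2, rfl⟩⟩, fun w => ?_, fun j => rfl⟩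
  exact Subtype.ext (Subtype.ext (Prod.ext rfl ((key w.1).1 w.2).2.symm))

/-- A strict meet of two elements occurs exactly where a nonempty tail leaves a spine that
continues. The shift by one arises because a spine element of level s has s + 1 elements below it,
itself included. -/
theorem hasFork_treeLE_iff (L : List Bool) (s : ℕ) :
    HasFork (TreeLE L) (s + 1) ↔ IsForkLevel L s := by
  constructor
  · rintro ⟨⟨⟨s', t⟩, hx⟩, ⟨⟨a, b⟩, hy⟩, ⟨⟨c, d⟩, hz⟩, h1, h2, h3, h4, h5, h6⟩
    have hy' := h5 _ (Or.inl rfl)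
    have hz' := fun h => h5 _ h (Or.inl rfl)
    have ha := h5 ⟨(a, 0), hy.1, Nat.zero_le _⟩
    have hc := h5 ⟨(c, 0), hz.1, Nat.zero_le _⟩
    simp only [treeLE_iff, ne_eq, Subtype.mk.injEq, Prod.mk.injEq, true_and] at h1 h2 h3 h4 hy' hz' ha hc
    -- Above an element of a tail the order is a chain, so a strict meet lies on the spine.
    obtain rfl : t = 0 := by omega
    rw [card_treeLE, Nat.succ_inj] at h6
    subst h6
    obtain ⟨hy1, hy2⟩ := hy
    obtain ⟨hz1, hz2⟩ := hz
    simp only at hy1 hy2 hz1 hz2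
    -- The spine element at the lower of the two levels is below both `y` and `z`, hence below the
    -- meet; so that level is the level of the meet itself.
    rcases lt_or_ge a c with hac | hac
    · have := ha (by omega) (by omega)
      obtain rfl : s' = a := by omega
      constructor <;> omega
    · have := hc (by omega) (by omega)
      obtain rfl : s' = c := by omega
      constructor <;> omega
  · rintro ⟨h1, h2⟩
    refine ⟨⟨(s, 0), h1.le, Nat.zero_le _⟩, ⟨(s, 1), h1.le, h2⟩, ⟨(s + 1, 0), h1, Nat.zero_le _⟩,
      ?_, ?_, ?_, ?_, ?_, card_treeLE L s _⟩
    · simp [treeLE_iff]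
    · simp [treeLE_iff]
    · simp [Subtype.ext_iff]
    · simp [Subtype.ext_iff]
    · rintro ⟨⟨a, b⟩, hw⟩ h h'
      simp only [treeLE_iff] at h h' ⊢
      omega

theorem isForkLevel_true_cons (L : List Bool) (s : ℕ) :
    IsForkLevel (true :: L) s ↔ s = 2 ∨ 2 ≤ s ∧ IsForkLevel L (s - 2) := by
  have := firstFork_le_spineTop L
  have := two_le_firstFork L
  simp only [IsForkLevel, spineTop, tailLength]
  split_ifs <;> omega

theorem isForkLevel_false_cons (L : List Bool) (s : ℕ) :
    IsForkLevel (false :: L) s ↔ 1 ≤ s ∧ IsForkLevel L (s - 1) := by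
  obtain ⟨h1, h2, -⟩ := insertPlace_le true L
  simp only [IsForkLevel, spineTop, tailLength]
  split_ifs with h h'
  · omega
  · subst h'
    rw [Nat.add_sub_cancel]
    omega
  · omega

theorem IsForkLevel.two_le {L : List Bool} {s : ℕ} (h : IsForkLevel L s) : 2 ≤ s := by
  by_contra h2
  rw [IsForkLevel, tailLength_of_lt_two L (by omega)] at h
  omega

/-- The first distance is 5 exactly when level 2 branches, since after a distance 3 all branchings
are at level 3 or higher. Stripping it shifts the remaining branch levels, and the length detects
the end of the list, where no branching is left to see. -/
theorem eq_of_isForkLevel {L L' : List Bool} (hl : forkLength L = forkLength L')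
    (h : ∀ s, IsForkLevel L s ↔ IsForkLevel L' s) : L = L' := by
  have hne : ∀ (b : Bool) (L : List Bool), forkLength [] ≠ forkLength (b :: L) := by
    intro b L
    have := six_le_forkLength L
    rw [forkLength_cons]
    cases b <;> simp only [forkLength, forkStep, if_true, Bool.false_eq_true, if_false] <;> omega
  have hmix : ∀ L L' : List Bool, ¬ ∀ s, IsForkLevel (true :: L) s ↔ IsForkLevel (false :: L') s := by
    intro L L' h
    have := ((isForkLevel_false_cons L' 2).1
      ((h 2).1 ((isForkLevel_true_cons L 2).2 (Or.inl rfl)))).2.two_le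
    omega
  induction L generalizing L' with
  | nil =>
    rcases L' with _ | ⟨b, L'⟩
    · rfl
    · exact absurd hl (hne b L')
  | cons b L ih =>
    rcases L' with _ | ⟨b', L'⟩
    · exact absurd hl.symm (hne b L)
    · rw [forkLength_cons, forkLength_cons] at hl
      rcases b with _ | _ <;> rcases b' with _ | _
      · refine congrArg _ (ih (Nat.add_right_cancel hl) fun s => ?_)
        simpa [isForkLevel_false_cons] using h (s + 1)
      · exact absurd (fun s => (h s).symm) (hmix L' L)
      · exact absurd h (hmix L L')
      · refine congrArg _ (ih (Nat.add_right_cancel hl) fun s => ?_)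
        have h2 := h (s + 2)
        rw [isForkLevel_true_cons, isForkLevel_true_cons, Nat.add_sub_cancel] at h2
        constructor
        · intro hs
          have := hs.two_le
          exact ((h2.1 (Or.inr ⟨by omega, hs⟩)).resolve_left (by omega)).2
        · intro hs
          have := hs.two_le
          exact ((h2.2 (Or.inr ⟨by omega, hs⟩)).resolve_left (by omega)).2

/-- The witness is the tuple itself, as both patterns have the same overlaps and the same trees. Any
other candidate yields an isomorphic tree, hence the same distances and the same increasing tuple.
-/
theorem existsUnique_clusterPosetsIso_forkPattern {n k : ℕ} {i : Fin k → ℕ}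
    (hi : i ∈ indexTuples (forkPattern true) n k) :
    ∃! i' : Fin k → ℕ, i' ∈ indexTuples (forkPattern false) n k ∧
      ClusterPosetsIso (forkPattern true) (forkPattern false) n i i' := by
  obtain ⟨L, hL, rfl⟩ := exists_forkStarts_of_mem_indexTuples hi
  refine ⟨i, ⟨?_, ⟨(clusterLEIso true L hL).trans (clusterLEIso false L hL).symm⟩⟩, ?_⟩
  · rwa [indexTuples_eq (overlapSet_forkPattern false true)]
  · rintro i' ⟨hi', ⟨e⟩⟩
    obtain ⟨L', hL', hn⟩ := exists_forkStarts_of_mem_indexTuples hi'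
    have e' : TreeLE L ≃r TreeLE L' := by
      have f := clusterLEIso false L' hL'
      rw [← hn] at f
      exact ((clusterLEIso true L hL).symm.trans e).trans f
    obtain rfl : L = L' := eq_of_isForkLevel hn fun s => by
      rw [← hasFork_treeLE_iff, ← hasFork_treeLE_iff]
      exact ⟨HasFork.map e', HasFork.map e'.symm⟩
    refine ((strictMono_of_mem_indexTuples hi').range_inj (strictMono_of_mem_indexTuples hi)).1 ?_
    have := hL'.trans hL.symm
    simpa [← Finset.coe_inj] using this


/-! ### Symmetries and patterns with compatible overlaps -/

theorem P_eq_of_equiv {σ τ : Equiv.Perm (Fin 6)}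
    (e : ∀ n, Equiv.Perm (Fin n) ≃ Equiv.Perm (Fin n))
    (h : ∀ n π, occCount τ (e n π) = occCount σ π) : P σ = P τ := by
  unfold P
  congr 1
  funext n
  congr 1
  exact Fintype.sum_equiv (e n) _ _ fun π => by rw [h]

theorem P_complement (σ : Equiv.Perm (Fin 6)) : P σ = P (Fin.revPerm * σ) := by
  refine P_eq_of_equiv (fun n => Equiv.mulLeft Fin.revPerm) fun n π => ?_
  unfold occCount
  congr 1
  refine Finset.filter_congr fun i _ => exists_congr fun h => ?_
  simp only [Equiv.coe_mulLeft, Equiv.Perm.mul_apply, Fin.revPerm_apply, Fin.rev_lt_rev]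
  exact forall_comm

theorem occursAt_reverse_iff {σ : Equiv.Perm (Fin 6)} {n : ℕ} {π : Equiv.Perm (Fin n)} {i j : ℕ}
    (h : i + 6 + j = n) : OccursAt (σ * Fin.revPerm) (π * Fin.revPerm) i ↔ OccursAt σ π j := by
  have key : ∀ a : Fin 6, Fin.rev (⟨i + a, by omega⟩ : Fin n) = ⟨j + a.rev, by
      have := a.rev.2
      omega⟩ := by
    intro a
    ext
    simp only [Fin.val_rev]
    omega
  constructor
  · rintro ⟨_, h'⟩
    refine ⟨by omega, fun a b => ?_⟩
    have := h' a.rev b.rev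
    simpa only [Equiv.Perm.mul_apply, Fin.revPerm_apply, key, Fin.rev_rev] using this
  · rintro ⟨_, h'⟩
    refine ⟨by omega, fun a b => ?_⟩
    have := h' a.rev b.rev
    simpa only [Equiv.Perm.mul_apply, Fin.revPerm_apply, key] using this

theorem P_reverse (σ : Equiv.Perm (Fin 6)) : P σ = P (σ * Fin.revPerm) := by
  refine P_eq_of_equiv (fun n => Equiv.mulRight Fin.revPerm) fun n π => ?_
  have hi : ∀ {τ : Equiv.Perm (Fin 6)} {ρ : Equiv.Perm (Fin n)} {i : ℕ}, OccursAt τ ρ i →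
      i + 6 ≤ n := fun h => h.1
  refine Finset.card_nbij' (fun i => n - 6 - i) (fun i => n - 6 - i) ?_ ?_ ?_ ?_ <;> intro i h
  · rw [Finset.mem_coe, Finset.mem_filter, Finset.mem_range] at h ⊢
    dsimp only
    have := hi h.2
    exact ⟨by omega, (occursAt_reverse_iff (by omega)).1 h.2⟩
  · rw [Finset.mem_coe, Finset.mem_filter, Finset.mem_range] at h ⊢
    dsimp only
    have := hi h.2
    exact ⟨by omega, (occursAt_reverse_iff (by omega)).2 h.2⟩
  · rw [Finset.mem_coe, Finset.mem_filter] at h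
    have := hi h.2
    show n - 6 - (n - 6 - i) = i
    omega
  · rw [Finset.mem_coe, Finset.mem_filter] at h
    have := hi h.2
    show n - 6 - (n - 6 - i) = i
    omega

/-- The value at distance `d` after the value `r`, or `6` if there is none. -/
def stepValue (σ : Equiv.Perm (Fin 6)) (d : ℕ) (r : Fin 6) : ℕ :=
  if h : σ.symm r + d < 6 then σ ⟨σ.symm r + d, h⟩ else 6

/-- The patterns `σ` and `τ` have the same overlaps, and for each overlap the entries that two
overlapping occurrences have in common correspond to each other by their values. -/
def Compatible (σ τ : Equiv.Perm (Fin 6)) : Prop :=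
  ∀ d, 1 ≤ d → d < 6 → (d ∈ overlapSet σ ↔ d ∈ overlapSet τ) ∧
    (d ∈ overlapSet σ → ∀ r, stepValue σ d r = stepValue τ d r)

section Compatible

variable {σ τ : Equiv.Perm (Fin 6)}

theorem Compatible.symm (h : Compatible σ τ) : Compatible τ σ := fun d h1 h6 =>
  ⟨(h d h1 h6).1.symm, fun hd r => ((h d h1 h6).2 ((h d h1 h6).1.2 hd) r).symm⟩

theorem Compatible.goodGaps (h : Compatible σ τ) {S : Finset ℕ} (hS : GoodGaps σ S) :
    GoodGaps τ S := fun i hi j hj hij hj6 =>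
  (h (j - i) (by omega) (by omega)).1.1 (hS i hi j hj hij hj6)

/-- The position of the value of `σ` at position `a` in `τ`. -/
def matchPosition (σ τ : Equiv.Perm (Fin 6)) (a : ℕ) : ℕ :=
  if h : a < 6 then τ.symm (σ ⟨a, h⟩) else a

theorem matchPosition_lt {a : ℕ} (h : a < 6) : matchPosition σ τ a < 6 := by
  rw [matchPosition, dif_pos h]
  exact Fin.is_lt _

theorem matchPosition_matchPosition {a : ℕ} (h : a < 6) :
    matchPosition τ σ (matchPosition σ τ a) = a := by
  have := matchPosition_lt (σ := σ) (τ := τ) h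
  rw [matchPosition, dif_pos this]
  simp [matchPosition, h]

theorem entry_matchPosition {a : ℕ} (h : a < 6) : entry τ (matchPosition σ τ a) = entry σ a := by
  rw [entry_of_lt τ (matchPosition_lt h), entry_of_lt σ h]
  simp [matchPosition, h]

/-- Matching entries by value commutes with the shift by an overlap, because both patterns send a
value to the same value `d` places later. The default 6 in `stepValue` shows that the shift stays
inside the window of `τ` too. -/
theorem Compatible.matchPosition_add (h : Compatible σ τ) {d : ℕ} (hd : d ∈ overlapSet σ) {a : ℕ}
    (ha : a + d < 6) : matchPosition σ τ (a + d) = matchPosition σ τ a + d := by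
  have h1 := (h d hd.1 hd.2.1).2 hd (σ ⟨a, by omega⟩)
  have ha' : a < 6 := by omega
  simp only [stepValue, Equiv.symm_apply_apply, dif_pos ha] at h1
  rw [matchPosition, matchPosition, dif_pos ha, dif_pos ha']
  split_ifs at h1 with h2
  · rw [Fin.ext h1, Equiv.symm_apply_apply]
  · have := (σ ⟨a + d, ha⟩).2
    omega

open Classical in
/-- In each window, move the positions of the entries of `σ` to those of `τ`. -/
noncomputable def windowMatch (σ τ : Equiv.Perm (Fin 6)) (S : Finset ℕ) (x : ℕ) : ℕ :=
  if h : ∃ i ∈ S, i ≤ x ∧ x < i + 6 then h.choose + matchPosition σ τ (x - h.choose) else x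

/-- The image of a position does not depend on the window chosen to compute it, since two windows
sharing a position differ by an overlap. -/
theorem Compatible.windowMatch_add (h : Compatible σ τ) {S : Finset ℕ} (hS : GoodGaps σ S) {i : ℕ}
    (hi : i ∈ S) {a : ℕ} (ha : a < 6) : windowMatch σ τ S (i + a) = i + matchPosition σ τ a := by
  have hex : ∃ j ∈ S, j ≤ i + a ∧ i + a < j + 6 := ⟨i, hi, by omega, by omega⟩
  rw [windowMatch, dif_pos hex]
  obtain ⟨hj, h1, h2⟩ := hex.choose_spec
  generalize hex.choose = j at hj h1 h2
  rcases lt_trichotomy i j with hij | rfl | hij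
  · have := h.matchPosition_add (hS i hi j hj hij (by omega)) (a := i + a - j) (by omega)
    rw [show i + a - j + (j - i) = a by omega] at this
    omega
  · rw [Nat.add_sub_cancel_left]
  · have := h.matchPosition_add (hS j hj i hi hij (by omega)) (a := a) (by omega)
    rw [show a + (i - j) = i + a - j by omega] at this
    omega

theorem Compatible.windowMatch_windowMatch (h : Compatible σ τ) {S : Finset ℕ}
    (hS : GoodGaps σ S) (x : ℕ) : windowMatch τ σ S (windowMatch σ τ S x) = x := by
  by_cases hx : ∃ i ∈ S, i ≤ x ∧ x < i + 6
  · obtain ⟨i, hi, h1, h2⟩ := hx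
    obtain ⟨a, rfl⟩ := Nat.exists_eq_add_of_le h1
    have ha : a < 6 := by omega
    rw [h.windowMatch_add hS hi ha, h.symm.windowMatch_add (h.goodGaps hS) hi (matchPosition_lt ha),
      matchPosition_matchPosition ha]
  · rw [windowMatch, windowMatch, dif_neg hx, dif_neg hx]

theorem Compatible.windowMatch_lt (h : Compatible σ τ) {n : ℕ} {S : Finset ℕ} (hS : GoodGaps σ S)
    (hn : ∀ i ∈ S, i + 6 ≤ n) {x : ℕ} (hx : x < n) : windowMatch σ τ S x < n := by
  by_cases hx' : ∃ i ∈ S, i ≤ x ∧ x < i + 6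
  · obtain ⟨i, hi, h1, h2⟩ := hx'
    obtain ⟨a, rfl⟩ := Nat.exists_eq_add_of_le h1
    have ha : a < 6 := by omega
    rw [h.windowMatch_add hS hi ha]
    have := matchPosition_lt (σ := σ) (τ := τ) ha
    have := hn i hi
    omega
  · rwa [windowMatch, dif_neg hx']

theorem Compatible.rel_windowMatch (h : Compatible σ τ) {S : Finset ℕ} (hS : GoodGaps σ S)
    {x y : ℕ} (hxy : rel σ S x y) : rel τ S (windowMatch σ τ S x) (windowMatch σ τ S y) := by
  obtain ⟨i, hi, h1, h2, h3, h4, h5⟩ := rel_iff.1 hxy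
  obtain ⟨a, rfl⟩ := Nat.exists_eq_add_of_le h1
  obtain ⟨b, rfl⟩ := Nat.exists_eq_add_of_le h3
  rw [Nat.add_sub_cancel_left, Nat.add_sub_cancel_left] at h5
  have ha : a < 6 := by omega
  have hb : b < 6 := by omega
  rw [h.windowMatch_add hS hi ha, h.windowMatch_add hS hi hb]
  refine rel_window hi (matchPosition_lt ha) (matchPosition_lt hb) ?_
  rwa [entry_matchPosition ha, entry_matchPosition hb]

/-- Matching positions by value in all windows at once relabels the cluster poset of `σ` into that
of `τ`, relation by relation. -/
theorem Compatible.P_eq (h : Compatible σ τ) : P σ = P τ := by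
  refine P_eq_of_markCount_eq fun n S hS => ?_
  by_cases hg : GoodGaps σ S
  · have hg' := h.goodGaps hg
    let φ : Equiv.Perm (Fin n) :=
      ⟨fun x => ⟨windowMatch σ τ S x, h.windowMatch_lt hg hS.1 x.2⟩,
        fun x => ⟨windowMatch τ σ S x, h.symm.windowMatch_lt hg' hS.1 x.2⟩,
        fun x => Fin.ext (h.windowMatch_windowMatch hg x),
        fun x => Fin.ext (h.symm.windowMatch_windowMatch hg' x)⟩
    exact markCount_eq_of_iso hS.1 hS.1 φ
      (fun x y hxy => Relation.TransGen.single (h.rel_windowMatch hg hxy))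
      (fun x y hxy => Relation.TransGen.single (h.symm.rel_windowMatch hg' hxy))
  · rw [markCount_eq_zero_of_not_goodGaps hg, markCount_eq_zero_of_not_goodGaps]
    exact fun hg' => hg (h.symm.goodGaps hg')

end Compatible


/-! ### Computable versions of the keys and of the cluster numbers -/

/-- The entries, shifted down by one, of a pattern in one-line notation. -/
def ofNumeral (n : ℕ) : List ℕ :=
  [n / 100000 - 1, n / 10000 % 10 - 1, n / 1000 % 10 - 1, n / 100 % 10 - 1, n / 10 % 10 - 1,
    n % 10 - 1]

/-- Whether `d` is an overlap of the pattern with entries `l`. -/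
def listOverlap (l : List ℕ) (d : ℕ) : Bool :=
  (List.range (6 - d)).all fun a => (List.range (6 - d)).all fun b =>
    Nat.blt (l.getD (a + d) 0) (l.getD (b + d) 0) == Nat.blt (l.getD a 0) (l.getD b 0)

/-- The values that follow the values `0, …, 5` at distance `d`, if any. -/
def listStep (l : List ℕ) (d : ℕ) : List ℕ :=
  (List.range 6).map fun r => l.getD (l.idxOf r + d) 6

/-- Patterns with equal keys have equal numbers of permutations with given marked occurrences. -/
def listKey (l : List ℕ) : ℕ :=
  Nat.ofDigits 8
    ((List.range' 1 5).flatMap fun d => bif listOverlap l d then listStep l d else List.replicate 6 7)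

/-- The reverse complement. -/
def reverseComplement (l : List ℕ) : List ℕ := l.reverse.map (5 - ·)

/-- The starting positions of the windows of the clusters of length `n` with `k` marks. -/
def starts : ℕ → ℕ → List (List ℕ)
  | 0, _ => []
  | k + 1, n =>
    if n ≤ 6 then if n = 6 ∧ k = 0 then [[0]] else []
    else (List.range' 1 5).flatMap fun d => (starts k (n - d)).map fun s => 0 :: s.map (· + d)

/-- The set of the elements of a list as a bit mask. -/
def mask (s : List ℕ) : ℕ := s.foldr (fun x m => 2 ^ x ||| m) 0

/-- The position `x` together with the positions of smaller entries in the windows starting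
in `s`. -/
def below (l s : List ℕ) (x : ℕ) : List ℕ :=
  x :: s.flatMap fun i => bif Nat.ble i x && Nat.blt x (i + 6) then
    ((List.range 6).filter fun a => Nat.blt (l.getD a 0) (l.getD (x - i) 0)).map (i + ·) else []

/-- Add the state `M` with multiplicity `c` to a list of states with multiplicities. -/
def addState (M c : ℕ) : List (ℕ × ℕ) → List (ℕ × ℕ)
  | [] => [(M, c)]
  | p :: ps => bif Nat.beq M p.1 then (M, c + p.2) :: ps else p :: addState M c ps

/-- Remove a minimal element from each state in all possible ways. -/
def nextStates (qs ps : List (ℕ × ℕ)) : List (ℕ × ℕ) :=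
  ps.foldr (fun p acc => qs.foldr (fun q acc =>
    bif Nat.beq (p.1 &&& q.2) q.1 then addState (p.1 ^^^ q.1) p.2 acc else acc) acc) []

/-- The total multiplicity after the removal of `n` minimal elements. -/
def countStates (qs : List (ℕ × ℕ)) : ℕ → List (ℕ × ℕ) → ℕ
  | 0, ps => (ps.map Prod.snd).sum
  | n + 1, ps => countStates qs n (nextStates qs ps)

/-- The number of permutations with occurrences at the positions in `s`. -/
def listMarkCount (l : List ℕ) (n : ℕ) (s : List ℕ) : ℕ :=
  countStates ((List.range n).map fun x => (2 ^ x, mask (below l s x))) n [(2 ^ n - 1, 1)]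

/-- The number of clusters, computed from the entries of the pattern. -/
def listClusterNumber (l : List ℕ) (n k : ℕ) : ℕ :=
  ((starts k n).map (listMarkCount l n)).sum

/-- The numbers of clusters with two marks. -/
def invariantTwo (l : List ℕ) : ℕ :=
  -- The packing need not be injective: it suffices that equivalent patterns get equal values.
  (List.range' 7 5).foldl (fun c n => 1000 * c + listClusterNumber l n 2) 0

/-- Some numbers of clusters with three marks. -/
def invariantThree (l : List ℕ) : ℕ :=
  10000 * listClusterNumber l 14 3 + listClusterNumber l 15 3

/-- The order of the patterns by the numbers of clusters with two and with three marks. -/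
def InvariantLT (l l' : List ℕ) : Prop :=
  invariantTwo l < invariantTwo l' ∨
    invariantTwo l = invariantTwo l' ∧ invariantThree l < invariantThree l'

instance : DecidableRel InvariantLT := fun _ _ => by unfold InvariantLT; infer_instance

/-- Representatives of the classes, in increasing order. -/
def representatives : List (List ℕ) :=
  [    123465, 123564, 213645, 124563, 215634, 315624, 241653, 134562, 123546, 162345, 165234,
    213465, 164523, 213564, 214563, 312564, 152634, 261534, 134526, 132645, 234615, 154623,
    312654, 264513, 123645, 162435, 163524, 213654, 214653, 365214, 142635, 251634, 352614,
    143526, 145623, 263514, 235614, 134625, 153624, 243615, 254613, 163425, 125634, 215643,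
    231645, 326154, 143625, 241635, 253614, 351624, 153426, 135624, 263415, 245613, 132465,
    162354, 216435, 154263, 231564, 263154, 241563, 261453, 124356, 156234, 126345, 145236,
    236145, 321654, 356124, 163254, 164253, 253164, 254163, 136245, 146235, 143265, 152364,
    251463, 265143, 125346, 256134, 153264, 264153, 135246, 246135, 162534, 214365, 132546,
    315264, 142536, 362514, 123456].map ofNumeral

/-- Representatives of the classes of patterns with equal keys, up to symmetry, that are merged
with another such class. -/
def specials : List (List ℕ) := [124536, 124635, 142365, 165243].map ofNumeral

/-- The keys of the representatives and of the special patterns. -/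
def keys : List ℕ :=
  [    1061082692135429192000995327, 1061077969768946322355781631, 1061016579004669016968003583,
    1061073247402463452710567935, 1060978800072806059806294015, 1060185442503683959410393087,
    1060941021140943102644584447, 1061068525035980583065354239, 1061086739682543896451088383,
    1061080836868555497470427135, 1061075524188247870610079743, 1061015904203315250282364927,
    1061070211507940243749732351, 1060978125253437894611173375, 1060940346303560538939981823,
    1060184766675509477684281343, 1061077073714750062212415487, 1060976353987704449795096575,
    1061086738637708782901133311, 1061082015154333205668036607, 1061015901212925097708355583,
    1061072277543276499219513343, 1060184765522587973077434367, 1060937984471800757776023551,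
    1061082017171945838730018815, 1061080836850541098960945151, 1061075524170233472100597759,
    1060978125109322706535317503, 1060940346159445350864125951, 1060182990077514074061537279,
    1061081998995417742662696959, 1060977903514206641397432319, 1060184539604016265663873023,
    1061086730567258250653204479, 1061072535797693531153235967, 1060976353699474073643384831,
    1060978121128140635939799039, 1061082015118304408649072639, 1061077073696735663702933503,
    1061015885072024033212497919, 1060940050507137013245804543, 1061080836832526700451463167,
    1061077294643333382499467263, 1060940346015330162788270079, 1061015901645270661935923199,
    1060184765144285604378312703, 1061081998977403344153214975, 1061015885360254409364209663,
    1060977903225976265245720575, 1060184540756937770270719999, 1061086666003653992669773823,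
    1061077291598900034397011967, 1061014722927147389510746111, 1060940308761554045179527167,
    1061082692132850012600139775, 1061077969761867322898776063, 1061016578997590017510998015,
    1061073247399467420963831807, 1060978800070226880405438463, 1060978800065712491820220415,
    1060941021138333068198674431, 1060941021133864103187578879, 1061086739697948260514660351,
    1061077073704294943582846975, 1061082017164866839273013247, 1061086730582276617415950335,
    1061015901638177093949849599, 1060184765141706424977457151, 1060184540746175131982757887,
    1061077969761855709307207679, 1061073247395245296313171967, 1060978800069934616470880255,
    1060941021137944115960348671, 1061082015147242592619462655, 1061081998988199586265300991,
    1061082692132811392254214143, 1061077969766089447549435903, 1060941021138086227838238719,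
    1060941021130485029077516287, 1061086739679687021644742655, 1060977903503748567830364159,
    1061077969766077833957867519, 1060941021133721991309688831, 1061086738670869091522183167,
    1061015885353033298029314047, 1061075524188247840382255103, 1061015904203315240290222079,
    1061086738673737568988168191, 1060184766675509466752352255, 1061086730585272637993779199,
    1060182990077514043746942975, 1061086739697979105567529169, 1061086739664529497941606399,
    1061082017153931440220536831, 1061082692132819157555085311, 1061073247392008334080999423]


/-! ### Correctness of the computations -/

theorem testBit_mask (s : List ℕ) (y : ℕ) : (mask s).testBit y = decide (y ∈ s) := by
  induction s with
  | nil => simp [mask]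
  | cons x s ih =>
    change (2 ^ x ||| mask s).testBit y = _
    rw [Nat.testBit_or, ih, Nat.testBit_two_pow]
    simp [eq_comm]

/-- The elements of a bit mask. -/
def maskSet (N M : ℕ) : Finset ℕ := (Finset.range N).filter fun y => M.testBit y = true

theorem maskSet_xor {N M x : ℕ} (hx : x ∈ maskSet N M) :
    maskSet N (M ^^^ 2 ^ x) = (maskSet N M).erase x := by
  ext y
  simp only [maskSet, Finset.mem_filter, Finset.mem_erase, Finset.mem_range, Nat.testBit_xor,
    Nat.testBit_two_pow] at hx ⊢
  by_cases hxy : x = y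
  · subst hxy
    simp [hx.2]
  · simp [hxy, Ne.symm hxy]

/-- The mask of `x` and everything below it meets the remaining set in `x` alone precisely when `x`
remains and is minimal. One comparison thus tests membership and minimality. -/
theorem land_mask_eq_iff {N M x : ℕ} {R : ℕ → ℕ → Prop} (hR : ∀ y, ¬ R y y)
    (hN : ∀ y, R y x → y < N) {s : List ℕ} (hs : ∀ y, y ∈ s ↔ y = x ∨ R y x) (hx : x < N) :
    M &&& mask s = 2 ^ x ↔ x ∈ maskSet N M ∧ ∀ y ∈ maskSet N M, ¬ R y x := by
  have h1 : M &&& mask s = 2 ^ x ↔ ∀ y, (M.testBit y = true ∧ y ∈ s) ↔ x = y := by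
    constructor
    · intro h y
      have := congrArg (Nat.testBit · y) h
      simp only [Nat.testBit_land, testBit_mask, Nat.testBit_two_pow] at this
      simpa using congrArg (· = true) this
    · intro h
      refine Nat.eq_of_testBit_eq fun y => ?_
      rw [Nat.testBit_land, testBit_mask, Nat.testBit_two_pow, Bool.eq_iff_iff]
      simpa using h y
  simp only [h1, maskSet, Finset.mem_filter, Finset.mem_range]
  constructor
  · intro h
    refine ⟨⟨hx, ((h x).2 rfl).1⟩, fun y hy hyx => ?_⟩
    obtain rfl := (h y).1 ⟨hy.2, (hs y).2 (Or.inr hyx)⟩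
    exact hR _ hyx
  · rintro ⟨h2, h3⟩ y
    constructor
    · rintro ⟨h4, h5⟩
      rcases (hs y).1 h5 with rfl | h5
      · rfl
      · exact absurd h5 (h3 y ⟨hN y h5, h4⟩)
    · rintro rfl
      exact ⟨h2.2, (hs x).2 (Or.inl rfl)⟩

/-- The number of linear extensions of all states, with multiplicities. -/
noncomputable def stateSum (R : ℕ → ℕ → Prop) (N m : ℕ) (ps : List (ℕ × ℕ)) : ℕ :=
  (ps.map fun p => p.2 * linExt R m (maskSet N p.1)).sum

theorem stateSum_cons (R : ℕ → ℕ → Prop) (N m : ℕ) (p : ℕ × ℕ) (ps : List (ℕ × ℕ)) :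
    stateSum R N m (p :: ps) = p.2 * linExt R m (maskSet N p.1) + stateSum R N m ps := by
  simp [stateSum]

theorem stateSum_addState (R : ℕ → ℕ → Prop) (N m M c : ℕ) (ps : List (ℕ × ℕ)) :
    stateSum R N m (addState M c ps) = c * linExt R m (maskSet N M) + stateSum R N m ps := by
  induction ps with
  | nil => rw [addState, stateSum_cons]
  | cons p ps ih =>
    rw [addState]
    cases h : Nat.beq M p.1
    · rw [cond_false, stateSum_cons, stateSum_cons, ih]
      omega
    · obtain rfl := Nat.eq_of_beq_eq_true h
      rw [cond_true, stateSum_cons, stateSum_cons]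
      ring

/-- One step of the recursion defining `linExt`, carried out for all states at once; equal remaining
sets are merged by adding multiplicities, which keeps the computation small. -/
theorem stateSum_nextStates {R : ℕ → ℕ → Prop} {N : ℕ} {b : ℕ → List ℕ} (hR : ∀ y, ¬ R y y)
    (hN : ∀ x y, R y x → y < N) (hb : ∀ x < N, ∀ y, y ∈ b x ↔ y = x ∨ R y x) (m : ℕ)
    (ps : List (ℕ × ℕ)) :
    stateSum R N m (nextStates ((List.range N).map fun x => (2 ^ x, mask (b x))) ps) =
      stateSum R N (m + 1) ps := by
  classical
  have key : ∀ (M c : ℕ) (acc : List (ℕ × ℕ)) (xs : List ℕ),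
      stateSum R N m ((xs.map fun x => (2 ^ x, mask (b x))).foldr (fun q acc =>
        bif Nat.beq (M &&& q.2) q.1 then addState (M ^^^ q.1) c acc else acc) acc) =
      (xs.map fun x => if M &&& mask (b x) = 2 ^ x then
        c * linExt R m (maskSet N (M ^^^ 2 ^ x)) else 0).sum + stateSum R N m acc := by
    intro M c acc xs
    induction xs with
    | nil => simp
    | cons x xs ih =>
      simp only [List.map_cons, List.foldr_cons, List.sum_cons]
      cases h : Nat.beq (M &&& mask (b x)) (2 ^ x)
      · rw [cond_false, ih, if_neg (Nat.ne_of_beq_eq_false h), zero_add]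
      · rw [cond_true, stateSum_addState, ih, if_pos (Nat.eq_of_beq_eq_true h), add_assoc]
  induction ps with
  | nil => rfl
  | cons p ps ih =>
    rw [stateSum_cons, ← ih]
    change stateSum R N m (List.foldr _ (nextStates _ ps) _) = _
    rw [key, ← List.sum_toFinset _ List.nodup_range, List.toFinset_range, ← Finset.sum_filter, linExt,
      Finset.mul_sum]
    congr 1
    have hf : (Finset.range N).filter (fun x => p.1 &&& mask (b x) = 2 ^ x) =
        (maskSet N p.1).filter (fun x => ∀ y ∈ maskSet N p.1, ¬ R y x) := by
      ext x
      rw [Finset.mem_filter, Finset.mem_filter, Finset.mem_range]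
      constructor
      · rintro ⟨hx, h⟩
        exact (land_mask_eq_iff hR (hN x) (hb x hx) hx).1 h
      · intro h
        have hx : x < N := Finset.mem_range.1 (Finset.mem_filter.1 h.1).1
        exact ⟨hx, (land_mask_eq_iff hR (hN x) (hb x hx) hx).2 h⟩
    rw [hf]
    exact Finset.sum_congr rfl fun x hx => by rw [maskSet_xor (Finset.mem_filter.1 hx).1]

theorem countStates_eq {R : ℕ → ℕ → Prop} {N : ℕ} {b : ℕ → List ℕ} (hR : ∀ y, ¬ R y y)
    (hN : ∀ x y, R y x → y < N) (hb : ∀ x < N, ∀ y, y ∈ b x ↔ y = x ∨ R y x) (m : ℕ)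
    (ps : List (ℕ × ℕ)) :
    countStates ((List.range N).map fun x => (2 ^ x, mask (b x))) m ps = stateSum R N m ps := by
  induction m generalizing ps with
  | zero => simp [countStates, stateSum, linExt]
  | succ m ih => rw [countStates, ih, stateSum_nextStates hR hN hb]

/-- The entries of a pattern. -/
def code (σ : Equiv.Perm (Fin 6)) : List ℕ := List.ofFn fun a => (σ a : ℕ)

theorem getD_code (σ : Equiv.Perm (Fin 6)) (a c : ℕ) :
    (code σ).getD a c = if h : a < 6 then (σ ⟨a, h⟩ : ℕ) else c := by
  rw [code, List.getD_eq_getElem?_getD, List.getElem?_ofFn]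
  split_ifs <;> rfl

theorem getD_code_zero (σ : Equiv.Perm (Fin 6)) (a : ℕ) : (code σ).getD a 0 = entry σ a :=
  getD_code σ a 0

theorem code_injective : Function.Injective code := fun _ _ h =>
  Equiv.ext fun a => Fin.ext (congrFun (List.ofFn_injective h) a)

theorem nodup_code (σ : Equiv.Perm (Fin 6)) : (code σ).Nodup :=
  List.nodup_ofFn.2 (Fin.val_injective.comp σ.injective)

theorem idxOf_code (σ : Equiv.Perm (Fin 6)) (r : Fin 6) : (code σ).idxOf (r : ℕ) = σ.symm r := by
  have hl : (σ.symm r : ℕ) < (code σ).length := by simp [code]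
  have := (nodup_code σ).idxOf_getElem (σ.symm r) hl
  rwa [show (code σ)[(σ.symm r : ℕ)] = r by simp only [code, List.getElem_ofFn, Fin.eta, Equiv.apply_symm_apply]] at this

theorem mem_below_iff (σ : Equiv.Perm (Fin 6)) (s : List ℕ) (x y : ℕ) :
    y ∈ below (code σ) s x ↔ y = x ∨ rel σ s.toFinset y x := by
  rw [below, List.mem_cons, List.mem_flatMap, rel_iff]
  refine or_congr_right (exists_congr fun i => ?_)
  rw [List.mem_toFinset]
  refine and_congr_right fun _ => ?_
  cases h : Nat.ble i x && Nat.blt x (i + 6)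
  · rw [cond_false]
    simp only [List.not_mem_nil, false_iff]
    rintro ⟨-, -, h1, h2, -⟩
    rw [← Bool.not_eq_true, Bool.and_eq_true, Nat.ble_eq, Nat.blt_eq] at h
    exact h ⟨h1, h2⟩
  · rw [cond_true]
    simp only [Bool.and_eq_true, Nat.ble_eq, Nat.blt_eq] at h
    simp only [List.mem_map, List.mem_filter, List.mem_range, Nat.blt_eq, getD_code_zero]
    constructor
    · rintro ⟨a, ⟨h1, h2⟩, rfl⟩
      exact ⟨by omega, by omega, h.1, h.2, by rwa [Nat.add_sub_cancel_left]⟩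
    · rintro ⟨h1, h2, -, -, h3⟩
      exact ⟨y - i, ⟨by omega, h3⟩, by omega⟩

theorem listMarkCount_code (σ : Equiv.Perm (Fin 6)) {n : ℕ} {s : List ℕ}
    (hs : ∀ i ∈ s.toFinset, i + 6 ≤ n) :
    listMarkCount (code σ) n s = markCount σ n s.toFinset := by
  rw [listMarkCount, countStates_eq (R := rel σ s.toFinset) _ (fun x y h => (rel_lt hs h).1)
    (fun x _ y => mem_below_iff σ s x y), markCount_eq_linExt hs]
  · have : maskSet n (2 ^ n - 1) = Finset.range n := by
      refine Finset.filter_true_of_mem fun y hy => ?_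
      rw [Nat.testBit_two_pow_sub_one]
      exact decide_eq_true (Finset.mem_range.1 hy)
    simp [stateSum, this]
  · intro y h
    obtain ⟨i, _, _, _, _, _, h⟩ := rel_iff.1 h
    exact lt_irrefl _ h

theorem toFinset_zero_cons (s : List ℕ) (d : ℕ) :
    (0 :: s.map (· + d)).toFinset = insert 0 (s.toFinset.image (· + d)) := by
  ext
  simp

theorem isCluster_of_mem_starts {k n : ℕ} {s : List ℕ} (h : s ∈ starts k n) :
    IsCluster n s.toFinset := by
  induction k generalizing n s with
  | zero => simp [starts] at h
  | succ k ih =>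
    rw [starts] at h
    split_ifs at h with h1 h2
    · obtain rfl := List.mem_singleton.1 h
      refine mem_clusters.1 ?_
      rw [h2.1, clusters_six]
      simp
    · simp at h
    · obtain ⟨d, hd, h⟩ := List.mem_flatMap.1 h
      obtain ⟨t, ht, rfl⟩ := List.mem_map.1 h
      rw [List.mem_range'_1] at hd
      rw [toFinset_zero_cons]
      exact (ih ht).cons (by omega) (by omega) (by omega)

theorem sum_clusters_card_eq (F : Finset ℕ → ℕ) (k : ℕ) {n : ℕ} (hn : 2 ≤ n) :
    ∑ S ∈ (clusters n).filter (fun S => S.card = k), F S =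
      ((starts k n).map fun s => F s.toFinset).sum := by
  induction k generalizing n F with
  | zero =>
    rw [Finset.filter_false_of_mem]
    · simp [starts]
    · intro S hS h
      have := (mem_clusters.1 hS).zero_mem hn
      rw [Finset.card_eq_zero.1 h] at this
      simp at this
  | succ k ih =>
    rw [starts]
    split_ifs with h1 h2
    · rw [h2.1, clusters_six, h2.2, Finset.filter_true_of_mem (by simp)]
      simp
    · rcases Nat.lt_or_ge n 6 with h6 | h6
      · simp [clusters_eq_empty hn (by omega)]
      · obtain rfl : n = 6 := by omega
        rw [clusters_six, Finset.filter_false_of_mem]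
        · simp
        · intro S hS h
          rw [Finset.mem_singleton.1 hS, Finset.card_singleton] at h
          omega
    · rw [Finset.sum_filter, sum_clusters_eq _ (by omega), List.map_flatMap, List.flatMap_def,
        List.sum_flatten, List.map_map]
      rw [show Finset.Icc 1 5 = (List.range' 1 5).toFinset by decide,
        List.sum_toFinset _ (by decide)]
      congr 1
      refine List.map_congr_left fun d hd => ?_
      rw [List.mem_range'_1] at hd
      have := ih (fun S => F (insert 0 (S.image (· + d)))) (n := n - d) (by omega)
      rw [Finset.sum_filter] at this
      rw [Function.comp_apply, List.map_map]
      simp only [card_insert_zero_image_add hd.1, Nat.add_right_cancel_iff, Function.comp_def,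
        toFinset_zero_cons]
      exact this

theorem clusterNumber_eq (σ : Equiv.Perm (Fin 6)) {n : ℕ} (hn : 2 ≤ n) (k : ℕ) :
    clusterNumber σ n k = listClusterNumber (code σ) n k := by
  rw [clusterNumber, sum_clusters_card_eq _ k hn, listClusterNumber]
  congr 1
  exact List.map_congr_left fun s hs =>
    (listMarkCount_code σ (isCluster_of_mem_starts hs).1).symm

/-- Both invariants are functions of cluster numbers, which `P` determines. -/
theorem invariant_eq_of_P_eq {σ τ : Equiv.Perm (Fin 6)} (h : P σ = P τ) :
    invariantTwo (code σ) = invariantTwo (code τ) ∧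
      invariantThree (code σ) = invariantThree (code τ) := by
  have key : ∀ n k, 2 ≤ n → listClusterNumber (code σ) n k = listClusterNumber (code τ) n k := by
    intro n k hn
    rw [← clusterNumber_eq σ hn, ← clusterNumber_eq τ hn, clusterNumber_eq_of_P_eq h (by omega)]
  constructor
  · refine List.foldl_ext _ _ _ fun c n hn => ?_
    rw [List.mem_range'_1] at hn
    rw [key n 2 (by omega)]
  · rw [invariantThree, invariantThree, key 14 3 (by norm_num), key 15 3 (by norm_num)]


/-! ### Counting the classes -/

theorem keys_eq : (representatives ++ specials).map listKey = keys := by decide +kernel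

/-- The representatives being sorted, comparing neighbours is enough: transitivity separates all
pairs. -/
theorem isChain_representatives : representatives.IsChain InvariantLT := by decide +kernel

/-- The first two alternatives discard patterns that are not normalised. Every other one, or else
its reverse complement, has a listed key. -/
theorem listKey_mem_keys : ((List.range 6).permutations'.all fun l =>
    Nat.ble (l.getD 5 0) (l.getD 0 0) || Nat.blt 5 (l.getD 0 0 + l.getD 5 0) ||
      keys.any (Nat.beq (listKey l)) || keys.any (Nat.beq (listKey (reverseComplement l)))) = true := by
  decide +kernel

theorem mem_permutations : ∀ l ∈ representatives ++ specials, l.Perm (List.range 6) := by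
  decide +kernel

theorem code_perm (σ : Equiv.Perm (Fin 6)) : (code σ).Perm (List.range 6) := by
  refine (List.perm_ext_iff_of_nodup (nodup_code σ) List.nodup_range).2 fun x => ?_
  rw [code, List.mem_ofFn, List.mem_range]
  exact ⟨fun ⟨a, ha⟩ => ha ▸ (σ a).2, fun hx => ⟨σ.symm ⟨x, hx⟩, by simp⟩⟩

theorem exists_code_eq {l : List ℕ} (h : l.Perm (List.range 6)) : ∃ σ, code σ = l := by
  have hl : l.length = 6 := by rw [h.length_eq, List.length_range]
  have hn : l.Nodup := h.nodup_iff.2 List.nodup_range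
  have hlt : ∀ a : Fin 6, l[(a : ℕ)] < 6 := fun a =>
    List.mem_range.1 (h.mem_iff.1 (List.getElem_mem _))
  have hinj : Function.Injective fun a : Fin 6 => (⟨l[(a : ℕ)], hlt a⟩ : Fin 6) := fun a b hab =>
    Fin.ext ((hn.getElem_inj_iff).1 (congrArg Fin.val hab))
  refine ⟨Equiv.ofBijective _ (Finite.injective_iff_bijective.1 hinj), ?_⟩
  refine List.ext_getElem (by simp [code, hl]) fun a h1 h2 => ?_
  simp only [code, List.getElem_ofFn]
  rfl

theorem code_reverse (σ : Equiv.Perm (Fin 6)) : code (σ * Fin.revPerm) = (code σ).reverse := by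
  refine List.ext_getElem (by simp [code]) fun a h1 h2 => ?_
  simp only [code, List.getElem_reverse, List.getElem_ofFn, List.length_ofFn,
    Equiv.Perm.mul_apply, Fin.revPerm_apply]
  congr 2
  ext
  simp only [Fin.val_rev]
  omega

theorem code_complement (σ : Equiv.Perm (Fin 6)) :
    code (Fin.revPerm * σ) = (code σ).map (5 - ·) := by
  rw [code, code, List.map_ofFn]
  congr 1
  funext a
  simp only [Equiv.Perm.mul_apply, Fin.revPerm_apply, Fin.val_rev, Function.comp_apply]
  omega

theorem listOverlap_code (σ : Equiv.Perm (Fin 6)) {d : ℕ} (h1 : 1 ≤ d) (h6 : d < 6) :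
    listOverlap (code σ) d = true ↔ d ∈ overlapSet σ := by
  have key : ∀ a b c d, Nat.blt a b = Nat.blt c d ↔ (a < b ↔ c < d) := fun a b c d => by
    rw [Bool.eq_iff_iff, Nat.blt_eq, Nat.blt_eq]
  rw [mem_overlapSet_iff, listOverlap]
  simp only [List.all_eq_true, List.mem_range, getD_code_zero, beq_iff_eq, key]
  exact ⟨fun h => ⟨h1, h6, fun a _ b _ ha hb => h a (by omega) b (by omega)⟩,
    fun h a ha b hb => h.2.2 a (by omega) b (by omega) (by omega) (by omega)⟩

theorem listStep_code (σ : Equiv.Perm (Fin 6)) (d : ℕ) :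
    listStep (code σ) d = List.ofFn (stepValue σ d) := by
  refine List.ext_getElem (by simp [listStep]) fun r h1 h2 => ?_
  have hr : r < 6 := by simpa [listStep] using h1
  have := idxOf_code σ ⟨r, hr⟩
  simp only at this
  simp only [listStep, List.getElem_map, List.getElem_range, List.getElem_ofFn, getD_code, this]
  rfl

/-- The key is a number in base 8 with six digits for each distance, so its digits can be recovered.
A step value is at most 6, hence the padding digit 7 marks the distances that are not overlaps. -/
theorem compatible_of_listKey_eq {σ τ : Equiv.Perm (Fin 6)}
    (h : listKey (code σ) = listKey (code τ)) : Compatible σ τ := by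
  let f : Equiv.Perm (Fin 6) → ℕ → List ℕ := fun σ d =>
    bif listOverlap (code σ) d then listStep (code σ) d else List.replicate 6 7
  have hlen : ∀ σ d, (f σ d).length = 6 := by
    intro σ d
    simp only [f]
    cases listOverlap (code σ) d <;> simp [listStep]
  have hlt : ∀ σ d, ∀ x ∈ f σ d, x < 8 := by
    intro σ d x hx
    simp only [f] at hx
    cases ho : listOverlap (code σ) d <;> rw [ho] at hx
    · rw [cond_false] at hx
      rw [List.eq_of_mem_replicate hx]
      norm_num
    · rw [cond_true, listStep_code, List.mem_ofFn] at hx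
      obtain ⟨r, rfl⟩ := hx
      rw [stepValue]
      split_ifs with h
      · have := (σ ⟨_, h⟩).2
        omega
      · norm_num
  have hflat : (List.range' 1 5).flatMap (f σ) = (List.range' 1 5).flatMap (f τ) := by
    refine Nat.ofDigits_inj_of_len_eq (b := 8) (by norm_num) ?_ ?_ ?_ h
    · simp [List.length_flatMap, hlen]
    · intro x hx
      obtain ⟨d, -, hx⟩ := List.mem_flatMap.1 hx
      exact hlt σ d x hx
    · intro x hx
      obtain ⟨d, -, hx⟩ := List.mem_flatMap.1 hx
      exact hlt τ d x hx
  have hf : ∀ d ∈ List.range' 1 5, f σ d = f τ d := by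
    generalize List.range' 1 5 = ds at hflat
    induction ds with
    | nil => simp
    | cons d ds ih =>
      rw [List.flatMap_cons, List.flatMap_cons] at hflat
      obtain ⟨h1, h2⟩ := List.append_inj hflat ((hlen σ d).trans (hlen τ d).symm)
      exact List.forall_mem_cons.2 ⟨h1, ih h2⟩
  intro d h1 h6
  have hd := hf d (by rw [List.mem_range'_1]; omega)
  have hne : ∀ σ : Equiv.Perm (Fin 6), List.ofFn (stepValue σ d) ≠ List.replicate 6 7 := by
    intro σ h
    have h7 : stepValue σ d (σ 0) ∈ List.replicate 6 7 := h ▸ (List.mem_ofFn.2 ⟨_, rfl⟩)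
    have := List.eq_of_mem_replicate h7
    rw [stepValue] at this
    split_ifs at this with h
    · have := (σ ⟨_, h⟩).2
      omega
    · omega
  simp only [f, listStep_code] at hd
  rw [← listOverlap_code σ h1 h6, ← listOverlap_code τ h1 h6]
  cases hσ : listOverlap (code σ) d <;> cases hτ : listOverlap (code τ) d <;>
    simp only [hσ, hτ, cond_true, cond_false] at hd
  · simp
  · exact absurd hd.symm (hne τ)
  · exact absurd hd (hne σ)
  · exact ⟨Iff.rfl, fun _ r => congrFun (List.ofFn_injective hd) r⟩


/-- Up to symmetry, the first entry of a pattern is smaller than the last one, and their sum is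
small. -/
theorem exists_normalized (σ : Equiv.Perm (Fin 6)) :
    ∃ τ : Equiv.Perm (Fin 6), P σ = P τ ∧ (τ 0 : ℕ) < τ 5 ∧ (τ 0 : ℕ) + τ 5 ≤ 5 := by
  have h1 : ∃ τ : Equiv.Perm (Fin 6), P σ = P τ ∧ (τ 0 : ℕ) < τ 5 := by
    rcases lt_trichotomy (σ 0) (σ 5) with h | h | h
    · exact ⟨σ, rfl, h⟩
    · exact absurd (σ.injective h) (by decide)
    · exact ⟨_, P_reverse σ, h⟩
  obtain ⟨τ, h, hτ⟩ := h1
  rcases le_or_gt ((τ 0 : ℕ) + τ 5) 5 with h5 | h5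
  · exact ⟨τ, h, hτ, h5⟩
  · refine ⟨Fin.revPerm * (τ * Fin.revPerm), (h.trans (P_reverse τ)).trans (P_complement _), ?_⟩
    have e0 : (Fin.revPerm * (τ * Fin.revPerm) : Equiv.Perm (Fin 6)) 0 = (τ 5).rev := rfl
    have e5 : (Fin.revPerm * (τ * Fin.revPerm) : Equiv.Perm (Fin 6)) 5 = (τ 0).rev := rfl
    have := (τ 5).2
    rw [e0, e5, Fin.val_rev, Fin.val_rev]
    omega

/-- This is where the four nontrivial equivalences enter the count: each special pattern is the
partner of a representative. -/
theorem P_eq_of_code_mem_specials {σ : Equiv.Perm (Fin 6)} (h : code σ ∈ specials) :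
    ∃ τ, code τ ∈ representatives ∧ P σ = P τ := by
  have e : specials = [code p124536, code p124635, code p142365, code p165243] := by decide
  rw [e] at h
  simp only [List.mem_cons, code_injective.eq_iff, List.not_mem_nil, or_false] at h
  rcases h with rfl | rfl | rfl | rfl
  · exact ⟨p123546, by decide +kernel, P_p123546_eq.symm⟩
  · exact ⟨p123645, by decide +kernel, P_p123645_eq.symm⟩
  · exact ⟨p132465, by decide +kernel, P_p132465_eq.symm⟩
  · exact ⟨p154263, by decide +kernel, P_forkPattern.symm⟩

theorem exists_representative_of_listKey_mem {σ : Equiv.Perm (Fin 6)}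
    (h : keys.any (Nat.beq (listKey (code σ))) = true) :
    ∃ τ, code τ ∈ representatives ∧ P σ = P τ := by
  obtain ⟨key, hk, h⟩ := List.any_eq_true.1 h
  rw [← Nat.eq_of_beq_eq_true h, ← keys_eq] at hk
  obtain ⟨l, hl, hk⟩ := List.mem_map.1 hk
  obtain ⟨τ, rfl⟩ := exists_code_eq (mem_permutations l hl)
  have hP : P σ = P τ := (compatible_of_listKey_eq hk.symm).P_eq
  rcases List.mem_append.1 hl with hl | hl
  · exact ⟨τ, hl, hP⟩
  · obtain ⟨ρ, hρ, h⟩ := P_eq_of_code_mem_specials hl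
    exact ⟨ρ, hρ, hP.trans h⟩

theorem exists_representative (σ : Equiv.Perm (Fin 6)) :
    ∃ τ, code τ ∈ representatives ∧ P σ = P τ := by
  obtain ⟨τ, hP, h1, h2⟩ := exists_normalized σ
  rw [hP]
  have h := List.all_eq_true.1 listKey_mem_keys (code τ)
    (List.mem_permutations'.2 (code_perm τ))
  have e0 : (code τ).getD 0 0 = τ 0 := getD_code τ 0 0
  have e5 : (code τ).getD 5 0 = τ 5 := getD_code τ 5 0
  rw [e0, e5, Bool.or_eq_true, Bool.or_eq_true, Bool.or_eq_true, Nat.ble_eq, Nat.blt_eq] at h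
  rcases h with ((h | h) | h) | h
  · omega
  · omega
  · exact exists_representative_of_listKey_mem h
  · rw [reverseComplement, ← code_reverse, ← code_complement] at h
    obtain ⟨ρ, hρ, h⟩ := exists_representative_of_listKey_mem h
    exact ⟨ρ, hρ, ((P_reverse τ).trans (P_complement _)).trans h⟩

theorem InvariantLT.trans {l₁ l₂ l₃ : List ℕ} (h : InvariantLT l₁ l₂) (h' : InvariantLT l₂ l₃) :
    InvariantLT l₁ l₃ := by
  unfold InvariantLT at *
  omega

/-- The classes of the 92 representatives are distinct by the sorted invariants, and they exhaust
all patterns by `exists_representative`. -/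
theorem card_quotient : Nat.card (Quotient (strongSetoid 6)) = 92 := by
  have hlen : representatives.length = 92 := rfl
  have hmem : ∀ j : Fin 92, representatives[(j : ℕ)] ∈ representatives := fun j =>
    List.getElem_mem _
  have hex : ∀ j : Fin 92, ∃ σ, code σ = representatives[(j : ℕ)] := fun j =>
    exists_code_eq (mem_permutations _ (List.mem_append_left _ (hmem j)))
  choose ρ hρ using hex
  have : IsTrans (List ℕ) InvariantLT := ⟨fun _ _ _ => InvariantLT.trans⟩
  have hpw := List.pairwise_iff_getElem.1 isChain_representatives.pairwise
  have hlt : ∀ i j : Fin 92, i < j → P (ρ i) ≠ P (ρ j) := by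
    intro i j hij h
    have h1 := hpw i j (by omega) (by omega) hij
    have h2 := invariant_eq_of_P_eq h
    rw [hρ, hρ] at h2
    unfold InvariantLT at h1
    omega
  rw [← Nat.card_fin 92]
  refine (Nat.card_congr (Equiv.ofBijective
    (fun j => (Quotient.mk (strongSetoid 6) (ρ j))) ⟨fun i j h => ?_, fun q => ?_⟩)).symm
  · have h : P (ρ i) = P (ρ j) := Quotient.exact h
    rcases lt_trichotomy i j with hij | hij | hij
    · exact absurd h (hlt i j hij)
    · exact hij
    · exact absurd h.symm (hlt j i hij)
  · obtain ⟨σ, rfl⟩ := Quotient.exists_rep q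
    obtain ⟨τ, hτ, h⟩ := exists_representative σ
    obtain ⟨j, hj, hjτ⟩ := List.getElem_of_mem hτ
    refine ⟨⟨j, hj⟩, Quotient.sound (s := strongSetoid 6) ?_⟩
    have : ρ ⟨j, hj⟩ = τ := code_injective ((hρ _).trans hjτ)
    rw [this]
    exact h.symm

end ConsecutivePattern

theorem mainTheorem8 :
    -- `123546 ~ 124536`, with common equation `ω⁽⁵⁾ + (1 - u)(ω' + ω) = 0`
    (ConsecutivePattern.StronglyCWilfEquiv ConsecutivePattern.p123546
        ConsecutivePattern.p124536 ∧
      ∀ σ ∈ ({ConsecutivePattern.p123546, ConsecutivePattern.p124536} :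
          Set (Equiv.Perm (Fin 6))),
        ∀ f : PowerSeries (Polynomial ℚ),
          (ConsecutivePattern.D^[5] f + ConsecutivePattern.oneSubU *
              (ConsecutivePattern.D f + f) = 0 ∧
            ConsecutivePattern.InitialConditions f) ↔ f = ConsecutivePattern.omega σ) ∧
    -- `123645 ~ 124635`, with common equation `ω⁽⁵⁾ + (1 - u) z (ω'' + ω') = 0`
    (ConsecutivePattern.StronglyCWilfEquiv ConsecutivePattern.p123645
        ConsecutivePattern.p124635 ∧
      (∀ n k : ℕ,
        ConsecutivePattern.indexTuples ConsecutivePattern.p123645 n k =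
          ConsecutivePattern.indexTuples ConsecutivePattern.p124635 n k ∧
        ∀ i ∈ ConsecutivePattern.indexTuples ConsecutivePattern.p123645 n k,
          ConsecutivePattern.ClusterPosetsIso ConsecutivePattern.p123645
            ConsecutivePattern.p124635 n i i) ∧
      ∀ σ ∈ ({ConsecutivePattern.p123645, ConsecutivePattern.p124635} :
          Set (Equiv.Perm (Fin 6))),
        ∀ f : PowerSeries (Polynomial ℚ),
          (ConsecutivePattern.D^[5] f + ConsecutivePattern.oneSubU * PowerSeries.X *
              (ConsecutivePattern.D^[2] f + ConsecutivePattern.D f) = 0 ∧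
            ConsecutivePattern.InitialConditions f) ↔ f = ConsecutivePattern.omega σ) ∧
    -- `132465 ~ 142365`, with common equation `ω⁽⁵⁾ + (1 - u)(ω'' + z ω') = 0`
    (ConsecutivePattern.StronglyCWilfEquiv ConsecutivePattern.p132465
        ConsecutivePattern.p142365 ∧
      (∀ n k : ℕ,
        ConsecutivePattern.indexTuples ConsecutivePattern.p132465 n k =
          ConsecutivePattern.indexTuples ConsecutivePattern.p142365 n k ∧
        ∀ i ∈ ConsecutivePattern.indexTuples ConsecutivePattern.p132465 n k,
          ConsecutivePattern.ClusterPosetsIso ConsecutivePattern.p132465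
            ConsecutivePattern.p142365 n i i) ∧
      ∀ σ ∈ ({ConsecutivePattern.p132465, ConsecutivePattern.p142365} :
          Set (Equiv.Perm (Fin 6))),
        ∀ f : PowerSeries (Polynomial ℚ),
          (ConsecutivePattern.D^[5] f + ConsecutivePattern.oneSubU *
              (ConsecutivePattern.D^[2] f + PowerSeries.X * ConsecutivePattern.D f) = 0 ∧
            ConsecutivePattern.InitialConditions f) ↔ f = ConsecutivePattern.omega σ) ∧
    -- `154263 ~ 165243`, with isomorphic cluster posets
    (ConsecutivePattern.StronglyCWilfEquiv ConsecutivePattern.p154263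
        ConsecutivePattern.p165243 ∧
      ∀ n k : ℕ, ∀ i ∈ ConsecutivePattern.indexTuples ConsecutivePattern.p154263 n k,
        ∃! i' : Fin k → ℕ,
          i' ∈ ConsecutivePattern.indexTuples ConsecutivePattern.p165243 n k ∧
            ConsecutivePattern.ClusterPosetsIso ConsecutivePattern.p154263
              ConsecutivePattern.p165243 n i i') ∧
    -- the patterns of length 6 form exactly 92 classes
    Nat.card (Quotient (ConsecutivePattern.strongSetoid 6)) = 92 := by
  -- As ω depends on P only, each differential equation need be derived for just one pattern of its
  -- pair.
  have hω : ∀ {σ τ : Equiv.Perm (Fin 6)}, ConsecutivePattern.P σ = ConsecutivePattern.P τ →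
      ConsecutivePattern.omega τ = ConsecutivePattern.omega σ := fun h => by
    rw [ConsecutivePattern.omega, ← h, ConsecutivePattern.omega]
  refine ⟨⟨ConsecutivePattern.P_p123546_eq, ?_⟩,
    ⟨ConsecutivePattern.P_p123645_eq, fun n k => ⟨ConsecutivePattern.indexTuples_eq
      (ConsecutivePattern.overlapSet_eq (by decide)) n k,
      fun i hi => ConsecutivePattern.clusterPosetsIso_p123645 hi⟩, ?_⟩,
    ⟨ConsecutivePattern.P_p132465_eq, fun n k => ⟨ConsecutivePattern.indexTuples_eq
      (ConsecutivePattern.overlapSet_eq (by decide)) n k,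
      fun i hi => ConsecutivePattern.clusterPosetsIso_p132465 hi⟩, ?_⟩,
    ⟨ConsecutivePattern.P_forkPattern, fun n k i hi =>
      ConsecutivePattern.existsUnique_clusterPosetsIso_forkPattern hi⟩,
    ConsecutivePattern.card_quotient⟩
  · rintro σ (rfl | rfl) f
    · exact ConsecutivePattern.ode_p123546_iff f
    · rw [hω ConsecutivePattern.P_p123546_eq]
      exact ConsecutivePattern.ode_p123546_iff f
  · rintro σ (rfl | rfl) f
    · exact ConsecutivePattern.ode_p123645_iff f
    · rw [hω ConsecutivePattern.P_p123645_eq]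
      exact ConsecutivePattern.ode_p123645_iff f
  · rintro σ (rfl | rfl) f
    · exact ConsecutivePattern.ode_p132465_iff f
    · rw [hω ConsecutivePattern.P_p132465_eq]
      exact ConsecutivePattern.ode_p132465_iff f
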